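/- Let $n\ge 3$, let $\Omega\subset\mathbb{R}^n$ be a bounded open set, let $\widetilde\Omega\subset\mathbb{R}^n$ be an open set with $\overline{\Omega}\subset\widetilde\Omega$, and let $\varphi\in C^\infty(\widetilde\Omega,\mathbb{R})$ be a limiting Carleman weight for $-h^2\Delta$ in $\widetilde\Omega$: that is, $\nabla\varphi\neq 0$ in $\widetilde\Omega$ and, with $p_\varphi(x,\xi)=\xi^2+2i\nabla\varphi(x)\cdot\xi-|\nabla\varphi(x)|^2$, the Poisson bracket satisfies $\{\operatorname{Re}p_\varphi,\operatorname{Im}p_\varphi\}(x,\xi)=0$ whenever $p_\varphi(x,\xi)=0$, $(x,\xi)\in\widetilde\Omega\times\mathbb{R}^n$. Let $A\in L^\infty(\Omega,\mathbb{C}^n)$ and $q\in L^\infty(\Omega,\mathbb{C})$, and let $$L_{A,q}w=\sum_{j=1}^n(D_j+A_j)^2w+qw=-\Delta w+A\cdot Dw+D\cdot(Aw)+(A^2+q)w,\qquad D=i^{-1}\nabla,\quad A^2=\sum_{j=1}^n A_j^2,$$ for $w\in C_0^\infty(\Omega)$, in the sense of distributions on $\mathbb{R}^n$ (with $Aw$,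 $A\cdot Dw$, $(A^2+q)w$ extended by zero outside $\Omega$). For $h>0$ and $s\in\mathbb{R}$ put $\|v\|_{H^s_{\mathrm{scl}}(\mathbb{R}^n)}=\|\langle hD\rangle^s v\|_{L^2(\mathbb{R}^n)}$, where $\langle\xi\rangle=(1+|\xi|^2)^{1/2}$. Then there are constants $C>0$ and $h_0>0$, which may depend on $n,\Omega,\widetilde\Omega,\varphi,A,q$ but not on $h$ or $u$, such that for all $0<h<h_0$ and all $u\in C_0^\infty(\Omega)$ the distribution $e^{\varphi/h}(h^2L_{A,q})e^{-\varphi/h}u$ belongs to $H^{-1}(\mathbb{R}^n)$ and $$h\,\|u\|_{H^1_{\mathrm{scl}}(\mathbb{R}^n)}\le C\,\big\|e^{\varphi/h}(h^2L_{A,q})e^{-\varphi/h}u\big\|_{H^{-1}_{\mathrm{scl}}(\mathbb{R}^n)}.$$ -/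

import Mathlib

open MeasureTheory Set
open scoped SchwartzMap ENNReal ContDiff

noncomputable section

namespace MagneticCarleman

/-- The space `ℝⁿ` with its Euclidean norm. -/
abbrev Rn (n : ℕ) : Type := EuclideanSpace ℝ (Fin n)

/-- The partial derivative `∂f/∂x_j`. -/
def partialDeriv {n : ℕ} {F : Type*} [NormedAddCommGroup F] [NormedSpace ℝ F]
    (j : Fin n) (f : Rn n → F) (x : Rn n) : F :=
  fderiv ℝ f x (EuclideanSpace.single j 1)

/-- `D_j f = i⁻¹ ∂f/∂x_j`. -/
def D {n : ℕ} (j : Fin n) (f : Rn n → ℂ) (x : Rn n) : ℂ :=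
  Complex.I⁻¹ * partialDeriv j f x

/-! ### Limiting Carleman weights -/

/-- The Poisson bracket `{a, b} = ∑ⱼ (∂_{ξⱼ} a ∂_{xⱼ} b - ∂_{xⱼ} a ∂_{ξⱼ} b)` of functions of
`(x, ξ)`. -/
def poissonBracket {n : ℕ} (a b : Rn n → Rn n → ℝ) (x ξ : Rn n) : ℝ :=
  ∑ j : Fin n,
    (partialDeriv j (fun η => a x η) ξ * partialDeriv j (fun y => b y ξ) x
      - partialDeriv j (fun y => a y ξ) x * partialDeriv j (fun η => b x η) ξ)

/-- The semiclassical principal symbol `p_φ(x, ξ) = ξ² + 2 i ∇φ · ξ - |∇φ|²` of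
`e^{φ/h} (-h²Δ) e^{-φ/h}`. -/
def carlemanSymbol {n : ℕ} (φ : Rn n → ℝ) (x ξ : Rn n) : ℂ :=
  ((‖ξ‖ ^ 2 : ℝ) : ℂ) + 2 * Complex.I * ((inner ℝ (gradient φ x) ξ : ℝ) : ℂ)
    - ((‖gradient φ x‖ ^ 2 : ℝ) : ℂ)

/-- `φ` (smooth and real valued on the open set `U`) is a limiting Carleman weight for `-h²Δ`
in `U`. -/
structure IsLimitingCarlemanWeight {n : ℕ} (U : Set (Rn n)) (φ : Rn n → ℝ) : Prop where
  smooth : ContDiffOn ℝ ∞ φ U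
  gradient_ne_zero : ∀ x ∈ U, gradient φ x ≠ 0
  bracket_eq_zero : ∀ x ∈ U, ∀ ξ : Rn n, carlemanSymbol φ x ξ = 0 →
    poissonBracket (fun y η => (carlemanSymbol φ y η).re)
      (fun y η => (carlemanSymbol φ y η).im) x ξ = 0

/-! ### Semiclassical Sobolev norms -/

/-- The operator `⟨hD⟩^s` on tempered distributions, `⟨ξ⟩ = (1 + |ξ|²)^{1/2}`. Mathlib's Fourier
transform has the kernel `exp (-2 π i x · ξ)`, so that `D` has the symbol `2 π ξ`. -/
def semiclassicalBessel {n : ℕ} (h s : ℝ) : 𝓢'(Rn n, ℂ) →L[ℂ] 𝓢'(Rn n, ℂ) :=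
  TemperedDistribution.fourierMultiplierCLM ℂ
    (fun ξ : Rn n => (((1 + ‖(2 * Real.pi * h) • ξ‖ ^ 2) ^ (s / 2) : ℝ) : ℂ))

/-- `‖T‖_{H^s_scl(ℝⁿ)} = ‖⟨hD⟩^s T‖_{L²(ℝⁿ)}`, with the value `∞` if `⟨hD⟩^s T` is not in `L²`,
that is, if `T` is not in `H^s(ℝⁿ)`. (The infimum is over at most one function.) -/
def semiclassicalNorm {n : ℕ} (h s : ℝ) (T : 𝓢'(Rn n, ℂ)) : ℝ≥0∞ :=
  ⨅ (f : Lp ℂ 2 (volume : Measure (Rn n)))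
    (_ : semiclassicalBessel h s T = (f : 𝓢'(Rn n, ℂ))), ‖f‖ₑ

/-! ### The magnetic Schrödinger operator -/

/-- The distribution `L_{A,q} w = ∑ⱼ (Dⱼ + Aⱼ)² w + q w`, for `w` smooth with compact support
in the open set `Ω` and bounded `A`, `q` on `Ω`, as a functional of the test function `ψ`. The
outer `Dⱼ` acts in the sense of distributions, `⟨Dⱼ g, ψ⟩ = -∫ g Dⱼψ`; thus
`⟨L_{A,q} w, ψ⟩ = ∫_Ω ∑ⱼ (Dⱼw + Aⱼw) (-Dⱼψ + Aⱼψ) + q w ψ`. Only the values of `ψ` in `Ω` enter. -/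
def magneticSchrodinger {n : ℕ} (Ω : Set (Rn n)) (A : Rn n → EuclideanSpace ℂ (Fin n))
    (q : Rn n → ℂ) (w : Rn n → ℂ) : (Rn n → ℂ) → ℂ := fun ψ =>
  ∫ x in Ω, ((∑ j : Fin n, (D j w x + A x j * w x) * (-D j ψ x + A x j * ψ x))
    + q x * w x * ψ x)

/-- The product of a smooth function and a distribution: `⟨g T, ψ⟩ = ⟨T, g ψ⟩`. -/
def mulDistribution {n : ℕ} (g : Rn n → ℂ) (T : (Rn n → ℂ) → ℂ) : (Rn n → ℂ) → ℂ :=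
  fun ψ => T (fun x => g x * ψ x)

/-- The distribution `e^{φ/h} (h² L_{A,q}) e^{-φ/h} u`, for `u` smooth with compact support in
`Ω`, and `φ` smooth in a neighbourhood of the closure of `Ω`. -/
def conjugatedSchrodinger {n : ℕ} (Ω : Set (Rn n)) (φ : Rn n → ℝ)
    (A : Rn n → EuclideanSpace ℂ (Fin n)) (q : Rn n → ℂ) (h : ℝ) (u : Rn n → ℂ) :
    (Rn n → ℂ) → ℂ :=
  mulDistribution (fun x => Complex.exp ((φ x / h : ℝ) : ℂ))
    (fun ψ => (h : ℂ) ^ 2 *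
      magneticSchrodinger Ω A q (fun x => Complex.exp ((-(φ x / h) : ℝ) : ℂ) * u x) ψ)

end MagneticCarleman

end

noncomputable section

namespace MagneticCarleman

variable {n : ℕ}

/-! ### Partial derivatives -/

section Partial

variable {F : Type*} [NormedAddCommGroup F] [NormedSpace ℝ F]
  {𝔸 : Type*} [NormedCommRing 𝔸] [NormedAlgebra ℝ 𝔸]

/-! The bracket condition at a zero of the symbol says that the Hessian of `φ`, on vectors
orthogonal to `∇φ` and of length `|∇φ|`, equals minus its value on `∇φ`. By scaling and orthogonal
decomposition this fixes the whole Hessian form up to terms containing `∇φ · X`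
(`hessForm_eq_of_isLimitingCarlemanWeight`). A limiting weight therefore gives a commutator without
a sign. Positivity comes from the convexified weight `ψ = φ + τ φ²/2`, whose Hessian gains `τ ∇φ ⊗
∇φ`.

In `L²`, write the conjugated Laplacian as `P = S + K`, symmetric plus antisymmetric. Then `‖Pv‖² =
‖Sv‖² + ‖Kv‖² + 2 ∫ Sv Kv`, and the cross term is a quadratic form in the Hessian of `ψ`. Modulo
multiples of `Sv` and `Kv` and errors of size `h²`, it is bounded below by a constant times `hτ
‖v‖²`. This gives `hτ ‖v‖²_{H¹} ≤ M ‖Pv‖²_{L²}`, with `M` independent of `τ` (`carleman_L2`).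

To put `H⁻¹` on the right without pseudodifferential calculus, solve `(1 - h²Δ) g = Pw`, so that the
`H¹` norm of `g` is the `H⁻¹` norm of `Pw`. Apply the `L²` estimate to `v = w - χg` with a cutoff
`χ` equal to one on the support of `w`. The second derivatives of `g` cancel in `Pv`, hence
`‖Pv‖_{L²} ≤ C ‖g‖_{H¹}` (`carleman_shift`).

Finally take `τ = h/ε`. Then `h ‖w‖_{H¹} ≤ √(εM) ‖g‖_{H¹}`. Pairing the full operator with the
conjugate of `g` gives `‖g‖²_{H¹}` up to an error `C₁ h ‖w‖_{H¹} ‖g‖_{H¹}`; only sup bounds on `A`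
and `q` enter, because the derivative falling on `A` is moved to the test function. A small `ε`
absorbs this error. Since `ψ/h = φ/h + φ²/(2ε)`, convexification costs only the fixed factor `exp
(φ²/(2ε))`, which is bounded above and below independently of `h` (`carleman_formDensity`). -/

lemma contDiff_partialDeriv {f : Rn n → F} (hf : ContDiff ℝ ∞ f) (j : Fin n) :
    ContDiff ℝ ∞ (partialDeriv j f) := by
  have h : ContDiff ℝ ∞ (fderiv ℝ f) := hf.fderiv_right (by simp)
  exact h.clm_apply contDiff_const

lemma ContDiff.differentiableAt_infty {f : Rn n → F} (hf : ContDiff ℝ ∞ f) (x : Rn n) :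
    DifferentiableAt ℝ f x :=
  (hf.differentiable (by simp)).differentiableAt

lemma partialDeriv_congr {f g : Rn n → F} {x : Rn n} (h : f =ᶠ[nhds x] g) (j : Fin n) :
    partialDeriv j f x = partialDeriv j g x := by
  simp [partialDeriv, h.fderiv_eq]

lemma partialDeriv_const (c : F) (j : Fin n) (x : Rn n) :
    partialDeriv j (fun _ => c) x = 0 := by
  simp [partialDeriv]

lemma partialDeriv_add {f g : Rn n → F} {x : Rn n} (hf : DifferentiableAt ℝ f x)
    (hg : DifferentiableAt ℝ g x) (j : Fin n) :
    partialDeriv j (fun y => f y + g y) x = partialDeriv j f x + partialDeriv j g x := by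
  simp [partialDeriv, fderiv_fun_add hf hg]

lemma partialDeriv_sub {f g : Rn n → F} {x : Rn n} (hf : DifferentiableAt ℝ f x)
    (hg : DifferentiableAt ℝ g x) (j : Fin n) :
    partialDeriv j (fun y => f y - g y) x = partialDeriv j f x - partialDeriv j g x := by
  simp [partialDeriv, fderiv_fun_sub hf hg]

lemma partialDeriv_sum {ι : Type*} {s : Finset ι} {f : ι → Rn n → F} {x : Rn n}
    (hf : ∀ i ∈ s, DifferentiableAt ℝ (f i) x) (j : Fin n) :
    partialDeriv j (fun y => ∑ i ∈ s, f i y) x = ∑ i ∈ s, partialDeriv j (f i) x := by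
  simp [partialDeriv, fderiv_fun_sum hf]

lemma partialDeriv_mul {f g : Rn n → 𝔸} {x : Rn n} (hf : DifferentiableAt ℝ f x)
    (hg : DifferentiableAt ℝ g x) (j : Fin n) :
    partialDeriv j (fun y => f y * g y) x
      = partialDeriv j f x * g x + f x * partialDeriv j g x := by
  simp [partialDeriv, fderiv_fun_mul hf hg]; ring

lemma partialDeriv_const_mul {f : Rn n → 𝔸} {x : Rn n} (hf : DifferentiableAt ℝ f x)
    (c : 𝔸) (j : Fin n) :
    partialDeriv j (fun y => c * f y) x = c * partialDeriv j f x := by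
  simp [partialDeriv, fderiv_const_mul hf c]

lemma partialDeriv_clm_comp {G : Type*} [NormedAddCommGroup G] [NormedSpace ℝ G]
    (L : F →L[ℝ] G) {f : Rn n → F} {x : Rn n} (hf : DifferentiableAt ℝ f x) (j : Fin n) :
    partialDeriv j (fun y => L (f y)) x = L (partialDeriv j f x) := by
  have := (L.hasFDerivAt.comp x hf.hasFDerivAt).fderiv
  simp only [partialDeriv]
  rw [show (fun y => L (f y)) = L ∘ f from rfl, this]; rfl

lemma partialDeriv_comm {f : Rn n → F} (hf : ContDiff ℝ ∞ f) (j k : Fin n) (x : Rn n) :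
    partialDeriv j (partialDeriv k f) x = partialDeriv k (partialDeriv j f) x := by
  have h : ContDiff ℝ ∞ (fderiv ℝ f) := hf.fderiv_right (by simp)
  have hd := ContDiff.differentiableAt_infty h x
  have key (a b : Fin n) : partialDeriv a (partialDeriv b f) x
      = fderiv ℝ (fderiv ℝ f) x (EuclideanSpace.single a 1) (EuclideanSpace.single b 1) := by
    have := (hd.hasFDerivAt.clm_apply
      (hasFDerivAt_const (EuclideanSpace.single b (1 : ℝ)) x)).fderiv
    rw [partialDeriv, show partialDeriv b f
      = fun y => fderiv ℝ f y (EuclideanSpace.single b 1) from rfl, this]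
    simp
  rw [key, key]
  exact (hf.contDiffAt.isSymmSndFDerivAt (by
    rw [minSmoothness_of_isRCLikeNormedField]; exact WithTop.coe_le_coe.2 le_top)) _ _

lemma tsupport_partialDeriv_subset (f : Rn n → F) (j : Fin n) :
    tsupport (partialDeriv j f) ⊆ tsupport f := by
  refine (tsupport_fderiv_apply_subset ℝ (EuclideanSpace.single j 1)).trans le_rfl

lemma HasCompactSupport.partialDeriv {f : Rn n → F} (hf : HasCompactSupport f) (j : Fin n) :
    HasCompactSupport (partialDeriv j f) :=
  hf.fderiv_apply ℝ (EuclideanSpace.single j 1)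

lemma integral_partialDeriv_eq_zero {𝕜 : Type*} [RCLike 𝕜] {f : Rn n → 𝕜} (hf : ContDiff ℝ ∞ f)
    (hc : HasCompactSupport f) (j : Fin n) : ∫ x, partialDeriv j f x = 0 := by
  -- Integration by parts against the constant function one.
  have := integral_mul_fderiv_eq_neg_fderiv_mul_of_integrable (𝕜 := 𝕜) (μ := volume)
    (f := fun _ : Rn n => (1 : 𝕜)) (g := f) (v := EuclideanSpace.single j 1)
    (by simp) (by
      simp only [one_mul]
      exact (contDiff_partialDeriv hf j).continuous.integrable_of_hasCompactSupport
        (HasCompactSupport.partialDeriv hc j))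
    (by simpa using hf.continuous.integrable_of_hasCompactSupport hc)
    (fun x _ => by fun_prop) (fun x _ => ContDiff.differentiableAt_infty hf x)
  simpa [MagneticCarleman.partialDeriv] using this

end Partial

/-! ### Gradient product, Laplacian and Hessian -/

/-- `∇f · ∇g`. -/
def grdDot (f g : Rn n → ℝ) (x : Rn n) : ℝ := ∑ k, partialDeriv k f x * partialDeriv k g x

/-- The Laplacian `∑ ∂_k² f`. -/
def lap (f : Rn n → ℝ) (x : Rn n) : ℝ := ∑ k, partialDeriv k (partialDeriv k f) x

/-- The Hessian of `f` at `x` as a bilinear form in coordinates. -/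
def hessForm (f : Rn n → ℝ) (x : Rn n) (a b : Fin n → ℝ) : ℝ :=
  ∑ j, ∑ k, partialDeriv j (partialDeriv k f) x * a j * b k

/-- The gradient in coordinates. -/
def grd (f : Rn n → ℝ) (x : Rn n) (k : Fin n) : ℝ := partialDeriv k f x

section Smooth

variable {f g k : Rn n → ℝ}

lemma contDiff_grdDot (hf : ContDiff ℝ ∞ f) (hg : ContDiff ℝ ∞ g) : ContDiff ℝ ∞ (grdDot f g) :=
  ContDiff.sum fun k _ => (contDiff_partialDeriv hf k).mul (contDiff_partialDeriv hg k)

lemma contDiff_lap (hf : ContDiff ℝ ∞ f) : ContDiff ℝ ∞ (lap f) :=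
  ContDiff.sum fun k _ => contDiff_partialDeriv (contDiff_partialDeriv hf k) k

lemma grdDot_comm (f g : Rn n → ℝ) (x : Rn n) : grdDot f g x = grdDot g f x := by
  simp [grdDot, mul_comm]

lemma grdDot_mul_right (hg : ContDiff ℝ ∞ g) (hk : ContDiff ℝ ∞ k) (f : Rn n → ℝ) (x : Rn n) :
    grdDot f (fun y => g y * k y) x = grdDot f g x * k x + g x * grdDot f k x := by
  simp only [grdDot, partialDeriv_mul (ContDiff.differentiableAt_infty hg x)
    (ContDiff.differentiableAt_infty hk x), Finset.sum_mul, Finset.mul_sum,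
    ← Finset.sum_add_distrib]
  exact Finset.sum_congr rfl fun _ _ => by ring

lemma grdDot_sub_right (hg : ContDiff ℝ ∞ g) (hk : ContDiff ℝ ∞ k) (f : Rn n → ℝ) (x : Rn n) :
    grdDot f (fun y => g y - k y) x = grdDot f g x - grdDot f k x := by
  simp only [grdDot, partialDeriv_sub (ContDiff.differentiableAt_infty hg x)
    (ContDiff.differentiableAt_infty hk x), ← Finset.sum_sub_distrib, mul_sub]

lemma lap_sub (hf : ContDiff ℝ ∞ f) (hg : ContDiff ℝ ∞ g) (x : Rn n) :
    lap (fun y => f y - g y) x = lap f x - lap g x := by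
  simp only [lap, ← Finset.sum_sub_distrib]
  refine Finset.sum_congr rfl fun j _ => ?_
  rw [show partialDeriv j (fun y => f y - g y) = fun y => partialDeriv j f y - partialDeriv j g y
    from funext fun y => partialDeriv_sub (ContDiff.differentiableAt_infty hf y)
      (ContDiff.differentiableAt_infty hg y) j]
  exact partialDeriv_sub (ContDiff.differentiableAt_infty (contDiff_partialDeriv hf j) x)
    (ContDiff.differentiableAt_infty (contDiff_partialDeriv hg j) x) j

/-- `div (f ∇g) = ∇f · ∇g + f Δg`. -/
lemma sum_partialDeriv_mul_partialDeriv (hf : ContDiff ℝ ∞ f) (hg : ContDiff ℝ ∞ g) (x : Rn n) :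
    ∑ j, partialDeriv j (fun y => f y * partialDeriv j g y) x = grdDot f g x + f x * lap g x := by
  simp only [grdDot, lap, Finset.mul_sum, ← Finset.sum_add_distrib]
  exact Finset.sum_congr rfl fun j _ => partialDeriv_mul (ContDiff.differentiableAt_infty hf x)
    (ContDiff.differentiableAt_infty (contDiff_partialDeriv hg j) x) j

lemma lap_mul (hf : ContDiff ℝ ∞ f) (hg : ContDiff ℝ ∞ g) (x : Rn n) :
    lap (fun y => f y * g y) x = f x * lap g x + 2 * grdDot f g x + lap f x * g x := by
  have h1 : lap (fun y => f y * g y) x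
      = ∑ j, partialDeriv j (fun y => f y * partialDeriv j g y) x
        + ∑ j, partialDeriv j (fun y => g y * partialDeriv j f y) x := by
    simp only [lap, ← Finset.sum_add_distrib]
    refine Finset.sum_congr rfl fun j _ => ?_
    rw [show partialDeriv j (fun y => f y * g y)
      = fun y => f y * partialDeriv j g y + g y * partialDeriv j f y
      from funext fun y => by
        rw [partialDeriv_mul (ContDiff.differentiableAt_infty hf y)
          (ContDiff.differentiableAt_infty hg y) j]; ring]
    exact partialDeriv_add
      (ContDiff.differentiableAt_infty (hf.mul (contDiff_partialDeriv hg j)) x)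
      (ContDiff.differentiableAt_infty (hg.mul (contDiff_partialDeriv hf j)) x) j
  rw [h1, sum_partialDeriv_mul_partialDeriv hf hg, sum_partialDeriv_mul_partialDeriv hg hf,
    grdDot_comm g f]
  ring

lemma partialDeriv_grdDot (hf : ContDiff ℝ ∞ f) (hg : ContDiff ℝ ∞ g) (j : Fin n) (x : Rn n) :
    partialDeriv j (grdDot f g) x
      = ∑ k, (partialDeriv j (partialDeriv k f) x * partialDeriv k g x
        + partialDeriv k f x * partialDeriv j (partialDeriv k g) x) := by
  unfold grdDot
  rw [partialDeriv_sum fun k _ => ContDiff.differentiableAt_infty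
    ((contDiff_partialDeriv hf k).mul (contDiff_partialDeriv hg k)) x]
  exact Finset.sum_congr rfl fun k _ => partialDeriv_mul
    (ContDiff.differentiableAt_infty (contDiff_partialDeriv hf k) x)
    (ContDiff.differentiableAt_infty (contDiff_partialDeriv hg k) x) j

lemma hessForm_comm (hf : ContDiff ℝ ∞ f) (x : Rn n) (a b : Fin n → ℝ) :
    hessForm f x a b = hessForm f x b a := by
  unfold hessForm
  rw [Finset.sum_comm]
  refine Finset.sum_congr rfl fun j _ => Finset.sum_congr rfl fun k _ => ?_
  rw [partialDeriv_comm hf]; ring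

/-- `∇k · ∇(∇f · ∇g) = Hess f (∇k, ∇g) + Hess g (∇k, ∇f)`. -/
lemma grdDot_grdDot (hf : ContDiff ℝ ∞ f) (hg : ContDiff ℝ ∞ g) (k : Rn n → ℝ) (x : Rn n) :
    grdDot k (grdDot f g) x
      = hessForm f x (grd k x) (grd g x) + hessForm g x (grd k x) (grd f x) := by
  conv_lhs => unfold grdDot
  simp only [hessForm, grd, ← Finset.sum_add_distrib]
  refine Finset.sum_congr rfl fun j _ => ?_
  rw [show (fun x => ∑ k, partialDeriv k f x * partialDeriv k g x) = grdDot f g from rfl,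
    partialDeriv_grdDot hf hg, Finset.mul_sum]
  exact Finset.sum_congr rfl fun i _ => by ring

lemma tsupport_grdDot_subset_right (f g : Rn n → ℝ) : tsupport (grdDot f g) ⊆ tsupport g := by
  refine closure_minimal (fun x hx => ?_) (isClosed_tsupport g)
  by_contra h
  refine hx (Finset.sum_eq_zero fun k _ => ?_)
  rw [image_eq_zero_of_notMem_tsupport (fun h' => h (tsupport_partialDeriv_subset g k h')),
    mul_zero]

lemma tsupport_lap_subset (f : Rn n → ℝ) : tsupport (lap f) ⊆ tsupport f := by
  refine closure_minimal (fun x hx => ?_) (isClosed_tsupport f)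
  by_contra h
  exact hx (Finset.sum_eq_zero fun k _ => image_eq_zero_of_notMem_tsupport
    fun h' => h (tsupport_partialDeriv_subset f k (tsupport_partialDeriv_subset _ k h')))

lemma hasCompactSupport_grdDot_right (f : Rn n → ℝ) (hg : HasCompactSupport g) :
    HasCompactSupport (grdDot f g) :=
  hg.of_isClosed_subset (isClosed_tsupport _) (tsupport_grdDot_subset_right f g)

lemma hasCompactSupport_grdDot_left (hf : HasCompactSupport f) (g : Rn n → ℝ) :
    HasCompactSupport (grdDot f g) := by
  rw [show grdDot f g = grdDot g f from funext (grdDot_comm f g)]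
  exact hasCompactSupport_grdDot_right g hf

lemma hasCompactSupport_lap (hf : HasCompactSupport f) : HasCompactSupport (lap f) :=
  hf.of_isClosed_subset (isClosed_tsupport _) (tsupport_lap_subset f)

lemma integrable_green (hf : ContDiff ℝ ∞ f) (hg : ContDiff ℝ ∞ g)
    (hc : HasCompactSupport f ∨ HasCompactSupport g) :
    Integrable fun x => f x * lap g x + grdDot f g x := by
  refine Integrable.add ?_ ?_
  · exact (hf.mul (contDiff_lap hg)).continuous.integrable_of_hasCompactSupport
      (hc.elim (fun h => h.mul_right) fun h => (hasCompactSupport_lap h).mul_left)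
  · exact (contDiff_grdDot hf hg).continuous.integrable_of_hasCompactSupport
      (hc.elim (fun h => hasCompactSupport_grdDot_left h g)
        fun h => hasCompactSupport_grdDot_right f h)

/-- Green's formula. -/
lemma integral_green (hf : ContDiff ℝ ∞ f) (hg : ContDiff ℝ ∞ g)
    (hc : HasCompactSupport f ∨ HasCompactSupport g) :
    ∫ x, (f x * lap g x + grdDot f g x) = 0 := by
  have hs (j : Fin n) : HasCompactSupport (fun y => f y * partialDeriv j g y) :=
    hc.elim (fun h => h.mul_right) fun h => (HasCompactSupport.partialDeriv h j).mul_left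
  have hd (j : Fin n) : ContDiff ℝ ∞ (fun y => f y * partialDeriv j g y) :=
    hf.mul (contDiff_partialDeriv hg j)
  have h0 : ∫ x, ∑ j, partialDeriv j (fun y => f y * partialDeriv j g y) x = 0 := by
    rw [integral_finsetSum _ fun j _ =>
      (contDiff_partialDeriv (hd j) j).continuous.integrable_of_hasCompactSupport
        (HasCompactSupport.partialDeriv (hs j) j)]
    exact Finset.sum_eq_zero fun j _ => integral_partialDeriv_eq_zero (hd j) (hs j) j
  simpa only [sum_partialDeriv_mul_partialDeriv hf hg, add_comm] using h0

lemma grdDot_sq_le (f g : Rn n → ℝ) (x : Rn n) :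
    grdDot f g x ^ 2 ≤ grdDot f f x * grdDot g g x := by
  have := Finset.sum_mul_sq_le_sq_mul_sq Finset.univ (fun k => partialDeriv k f x)
    (fun k => partialDeriv k g x)
  simpa only [grdDot, ← sq] using this

lemma grdDot_self_nonneg (f : Rn n → ℝ) (x : Rn n) : 0 ≤ grdDot f f x :=
  Finset.sum_nonneg fun _ _ => mul_self_nonneg _

end Smooth

/-! ### The conjugated Laplacian on real functions -/

/-- The symmetric part `-h² Δ - |∇ψ|²` of `e^{ψ/h} (-h² Δ) e^{-ψ/h}`. -/
def symPart (h : ℝ) (ψ v : Rn n → ℝ) (x : Rn n) : ℝ := -h ^ 2 * lap v x - grdDot ψ ψ x * v x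

/-- The antisymmetric part `2 h ∇ψ · ∇ + h Δψ` of `e^{ψ/h} (-h² Δ) e^{-ψ/h}`. -/
def skewPart (h : ℝ) (ψ v : Rn n → ℝ) (x : Rn n) : ℝ :=
  2 * h * grdDot ψ v x + h * lap ψ x * v x

/-- The operator `e^{ψ/h} (-h² Δ) e^{-ψ/h}`. -/
def conjLaplacian (h : ℝ) (ψ v : Rn n → ℝ) (x : Rn n) : ℝ := symPart h ψ v x + skewPart h ψ v x

/-! ### Commutator and energy identities, all consequences of Green's formula. -/

section Identities

variable {ψ v m : Rn n → ℝ}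

lemma contDiff_symPart (h : ℝ) (hψ : ContDiff ℝ ∞ ψ) (hv : ContDiff ℝ ∞ v) :
    ContDiff ℝ ∞ (symPart h ψ v) :=
  (contDiff_const.mul (contDiff_lap hv)).sub ((contDiff_grdDot hψ hψ).mul hv)

lemma contDiff_skewPart (h : ℝ) (hψ : ContDiff ℝ ∞ ψ) (hv : ContDiff ℝ ∞ v) :
    ContDiff ℝ ∞ (skewPart h ψ v) :=
  (contDiff_const.mul (contDiff_grdDot hψ hv)).add
    ((contDiff_const.mul (contDiff_lap hψ)).mul hv)

lemma contDiff_conjLaplacian (h : ℝ) (hψ : ContDiff ℝ ∞ ψ) (hv : ContDiff ℝ ∞ v) :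
    ContDiff ℝ ∞ (conjLaplacian h ψ v) :=
  (contDiff_symPart h hψ hv).add (contDiff_skewPart h hψ hv)

lemma hasCompactSupport_symPart (h : ℝ) (ψ : Rn n → ℝ) (hc : HasCompactSupport v) :
    HasCompactSupport (symPart h ψ v) :=
  ((hasCompactSupport_lap hc).mul_left (f := fun _ => -h ^ 2)).sub
    (hc.mul_left (f := grdDot ψ ψ))

lemma hasCompactSupport_skewPart (h : ℝ) (ψ : Rn n → ℝ) (hc : HasCompactSupport v) :
    HasCompactSupport (skewPart h ψ v) :=
  ((hasCompactSupport_grdDot_right ψ hc).mul_left (f := fun _ => 2 * h)).add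
    (hc.mul_left (f := fun x => h * lap ψ x))

lemma hasCompactSupport_conjLaplacian (h : ℝ) (ψ : Rn n → ℝ) (hc : HasCompactSupport v) :
    HasCompactSupport (conjLaplacian h ψ v) :=
  (hasCompactSupport_symPart h ψ hc).add (hasCompactSupport_skewPart h ψ hc)

/-- The pointwise density whose integral is twice the inner product of the symmetric and the
antisymmetric parts. -/
def commDensity (h : ℝ) (ψ v : Rn n → ℝ) (x : Rn n) : ℝ :=
  4 * h * (h ^ 2 * hessForm ψ x (grd v x) (grd v x)
    + v x ^ 2 * hessForm ψ x (grd ψ x) (grd ψ x)) + 2 * h ^ 3 * (v x * grdDot v (lap ψ) x)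

/-- Each bracket after `commDensity` has the form `f Δg + ∇f · ∇g = div (f ∇g)`, so it integrates to
zero. The fields are `(∇ψ·∇v)∇v`, `vΔψ ∇v`, `|∇v|² ∇ψ` and `|∇ψ|² v² ∇ψ`. The Hessian of `v` enters
through the first and the third, and these contributions cancel. -/
lemma two_mul_symPart_mul_skewPart (h : ℝ) (hψ : ContDiff ℝ ∞ ψ) (hv : ContDiff ℝ ∞ v)
    (x : Rn n) :
    2 * symPart h ψ v x * skewPart h ψ v x = commDensity h ψ v x
      + (-4 * h ^ 3) * (grdDot ψ v x * lap v x + grdDot (grdDot ψ v) v x)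
      + (-2 * h ^ 3) * ((lap ψ x * v x) * lap v x + grdDot (fun y => lap ψ y * v y) v x)
      + (2 * h ^ 3) * (grdDot v v x * lap ψ x + grdDot (grdDot v v) ψ x)
      + (-2 * h) * ((grdDot ψ ψ x * (v x * v x)) * lap ψ x
        + grdDot (fun y => grdDot ψ ψ y * (v y * v y)) ψ x) := by
  rw [grdDot_comm (grdDot ψ v), grdDot_comm (fun y => lap ψ y * v y), grdDot_comm (grdDot v v),
    grdDot_comm (fun y => grdDot ψ ψ y * (v y * v y)), grdDot_grdDot hψ hv, grdDot_grdDot hv hv,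
    grdDot_mul_right (contDiff_lap hψ) hv, grdDot_mul_right (contDiff_grdDot hψ hψ) (hv.mul hv),
    grdDot_mul_right hv hv, grdDot_grdDot hψ hψ, hessForm_comm hv x (grd ψ x) (grd v x)]
  simp only [symPart, skewPart, commDensity]
  ring

lemma integral_add_of_integral_eq_zero {f g : Rn n → ℝ} (hf : Integrable f) (hg : Integrable g)
    (h0 : ∫ x, g x = 0) :
    Integrable (fun x => f x + g x) ∧ ∫ x, (f x + g x) = ∫ x, f x :=
  ⟨hf.add hg, by rw [integral_add hf hg, h0, add_zero]⟩

lemma integral_two_mul_symPart_mul_skewPart (h : ℝ) (hψ : ContDiff ℝ ∞ ψ) (hv : ContDiff ℝ ∞ v)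
    (hc : HasCompactSupport v) :
    Integrable (commDensity h ψ v) ∧
    ∫ x, 2 * symPart h ψ v x * skewPart h ψ v x = ∫ x, commDensity h ψ v x := by
  have hψv := contDiff_grdDot hψ hv
  have hvv := contDiff_grdDot hv hv
  have hLv := (contDiff_lap hψ).mul hv
  have hQ := (contDiff_grdDot hψ hψ).mul (hv.mul hv)
  have hcQ : HasCompactSupport fun y => grdDot ψ ψ y * (v y * v y) :=
    (hc.mul_right (f' := v)).mul_left (f := grdDot ψ ψ)
  have hcv := Or.inl (b := HasCompactSupport ψ) (hasCompactSupport_grdDot_left hc v)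
  have i1 := (integrable_green hψv hv (.inr hc)).const_mul (-4 * h ^ 3)
  have i2 := (integrable_green hLv hv (.inr hc)).const_mul (-2 * h ^ 3)
  have i3 := (integrable_green hvv hψ hcv).const_mul (2 * h ^ 3)
  have i4 := (integrable_green hQ hψ (.inl hcQ)).const_mul (-2 * h)
  have i5 : Integrable fun x => 2 * symPart h ψ v x * skewPart h ψ v x :=
    ((contDiff_const.mul (contDiff_symPart h hψ hv)).mul
      (contDiff_skewPart h hψ hv)).continuous.integrable_of_hasCompactSupport
      ((hasCompactSupport_skewPart h ψ hc).mul_left)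
  have i0 : Integrable (commDensity h ψ v) := by
    refine ((((i5.sub i1).sub i2).sub i3).sub i4).congr (.of_forall fun x => ?_)
    simp only [Pi.sub_apply]
    linarith [two_mul_symPart_mul_skewPart h hψ hv x]
  refine ⟨i0, ?_⟩
  simp_rw [two_mul_symPart_mul_skewPart h hψ hv]
  have z {f g : Rn n → ℝ} (c : ℝ) (hfg : ∫ x, (f x * lap g x + grdDot f g x) = 0) :
      ∫ x, c * (f x * lap g x + grdDot f g x) = 0 := by
    rw [integral_const_mul, hfg, mul_zero]
  have s1 := integral_add_of_integral_eq_zero i0 i1 (z _ (integral_green hψv hv (.inr hc)))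
  have s2 := integral_add_of_integral_eq_zero s1.1 i2 (z _ (integral_green hLv hv (.inr hc)))
  have s3 := integral_add_of_integral_eq_zero s2.1 i3 (z _ (integral_green hvv hψ hcv))
  have s4 := integral_add_of_integral_eq_zero s3.1 i4 (z _ (integral_green hQ hψ (.inl hcQ)))
  exact s4.2.trans (s3.2.trans (s2.2.trans s1.2))

/-- Green's formula for `m v` and `v`. It is used twice: with the multiplier `m` that removes the
signless part of the commutator, and with `m = 1` to control `∇v` by `v` and the symmetric part. -/
lemma integral_weighted_energy (h : ℝ) (ψ : Rn n → ℝ) (hv : ContDiff ℝ ∞ v)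
    (hc : HasCompactSupport v) (hm : ContDiff ℝ ∞ m) :
    (Integrable fun x => m x * (h ^ 2 * grdDot v v x - grdDot ψ ψ x * v x ^ 2)
      - m x * v x * symPart h ψ v x + h ^ 2 * (v x * grdDot m v x)) ∧
    ∫ x, (m x * (h ^ 2 * grdDot v v x - grdDot ψ ψ x * v x ^ 2)
      - m x * v x * symPart h ψ v x + h ^ 2 * (v x * grdDot m v x)) = 0 := by
  have key (x : Rn n) : m x * (h ^ 2 * grdDot v v x - grdDot ψ ψ x * v x ^ 2)
      - m x * v x * symPart h ψ v x + h ^ 2 * (v x * grdDot m v x)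
      = h ^ 2 * ((m x * v x) * lap v x + grdDot (fun y => m y * v y) v x) := by
    rw [grdDot_comm (fun y => m y * v y), grdDot_mul_right hm hv, grdDot_comm m v]
    simp only [symPart]
    ring
  simp_rw [key]
  refine ⟨(integrable_green (hm.mul hv) hv (.inr hc)).const_mul _, ?_⟩
  rw [integral_const_mul, integral_green (hm.mul hv) hv (.inr hc), mul_zero]

end Identities

/-! ### Convexified weights -/

/-- The weight `φ + τ φ² / 2`. -/
def convexified (φ : Rn n → ℝ) (τ : ℝ) (x : Rn n) : ℝ := φ x + τ * (φ x * φ x / 2)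

section Convexified

variable {φ a b : Rn n → ℝ}

lemma partialDeriv_add_const_mul (ha : ContDiff ℝ ∞ a) (hb : ContDiff ℝ ∞ b) (τ : ℝ) (j : Fin n)
    (x : Rn n) : partialDeriv j (fun y => a y + τ * b y) x
      = partialDeriv j a x + τ * partialDeriv j b x := by
  rw [partialDeriv_add (ContDiff.differentiableAt_infty ha x)
    (ContDiff.differentiableAt_infty (contDiff_const.mul hb) x),
    partialDeriv_const_mul (ContDiff.differentiableAt_infty hb x)]

lemma contDiff_convexified (hφ : ContDiff ℝ ∞ φ) (τ : ℝ) : ContDiff ℝ ∞ (convexified φ τ) :=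
  hφ.add (contDiff_const.mul ((hφ.mul hφ).div_const 2))

lemma partialDeriv_convexified (hφ : ContDiff ℝ ∞ φ) (τ : ℝ) (j : Fin n) (x : Rn n) :
    partialDeriv j (convexified φ τ) x = (1 + τ * φ x) * partialDeriv j φ x := by
  have h2 : (fun y => φ y * φ y / 2) = fun y => (1 / 2 : ℝ) * (φ y * φ y) := by
    ext y; ring
  unfold convexified
  rw [partialDeriv_add_const_mul hφ ((hφ.mul hφ).div_const 2), h2,
    partialDeriv_const_mul (ContDiff.differentiableAt_infty (hφ.mul hφ) x),
    partialDeriv_mul (ContDiff.differentiableAt_infty hφ x)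
      (ContDiff.differentiableAt_infty hφ x)]
  ring

lemma grd_convexified (hφ : ContDiff ℝ ∞ φ) (τ : ℝ) (x : Rn n) :
    grd (convexified φ τ) x = fun k => (1 + τ * φ x) * grd φ x k :=
  funext fun k => partialDeriv_convexified hφ τ k x

lemma grdDot_convexified_left (hφ : ContDiff ℝ ∞ φ) (τ : ℝ) (v : Rn n → ℝ) (x : Rn n) :
    grdDot (convexified φ τ) v x = (1 + τ * φ x) * grdDot φ v x := by
  simp only [grdDot, partialDeriv_convexified hφ, Finset.mul_sum, mul_assoc]

lemma grdDot_convexified_self (hφ : ContDiff ℝ ∞ φ) (τ : ℝ) (x : Rn n) :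
    grdDot (convexified φ τ) (convexified φ τ) x = (1 + τ * φ x) ^ 2 * grdDot φ φ x := by
  rw [grdDot_convexified_left hφ, grdDot_comm, grdDot_convexified_left hφ]; ring

lemma partialDeriv_partialDeriv_convexified (hφ : ContDiff ℝ ∞ φ) (τ : ℝ) (j k : Fin n)
    (x : Rn n) : partialDeriv j (partialDeriv k (convexified φ τ)) x
      = (1 + τ * φ x) * partialDeriv j (partialDeriv k φ) x
        + τ * (partialDeriv j φ x * partialDeriv k φ x) := by
  rw [show partialDeriv k (convexified φ τ)
    = fun y => partialDeriv k φ y + τ * (φ y * partialDeriv k φ y) from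
      funext fun y => by rw [partialDeriv_convexified hφ]; ring,
    partialDeriv_add_const_mul (contDiff_partialDeriv hφ k)
      (hφ.mul (contDiff_partialDeriv hφ k)),
    partialDeriv_mul (ContDiff.differentiableAt_infty hφ x)
      (ContDiff.differentiableAt_infty (contDiff_partialDeriv hφ k) x)]
  ring

lemma lap_convexified (hφ : ContDiff ℝ ∞ φ) (τ : ℝ) (x : Rn n) :
    lap (convexified φ τ) x = lap φ x + τ * (φ x * lap φ x + grdDot φ φ x) := by
  simp only [lap, partialDeriv_partialDeriv_convexified hφ, Finset.sum_add_distrib,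
    ← Finset.mul_sum, grdDot]
  ring

/-- The rank one term `τ ∇φ ⊗ ∇φ` is the only source of positivity in the commutator. -/
lemma hessForm_convexified (hφ : ContDiff ℝ ∞ φ) (τ : ℝ) (x : Rn n) (a b : Fin n → ℝ) :
    hessForm (convexified φ τ) x a b = (1 + τ * φ x) * hessForm φ x a b
      + τ * ((∑ j, grd φ x j * a j) * ∑ k, grd φ x k * b k) := by
  rw [Finset.sum_mul_sum]
  simp only [hessForm, partialDeriv_partialDeriv_convexified hφ,
    Finset.mul_sum, ← Finset.sum_add_distrib, grd]
  exact Finset.sum_congr rfl fun j _ => Finset.sum_congr rfl fun k _ => by ring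

lemma grdDot_add_const_mul_self (ha : ContDiff ℝ ∞ a) (hb : ContDiff ℝ ∞ b) (τ : ℝ) (x : Rn n) :
    grdDot (fun y => a y + τ * b y) (fun y => a y + τ * b y) x
      = grdDot a a x + τ * (2 * grdDot a b x) + τ ^ 2 * grdDot b b x := by
  simp only [grdDot, partialDeriv_add_const_mul ha hb, Finset.mul_sum, ← Finset.sum_add_distrib]
  exact Finset.sum_congr rfl fun j _ => by ring

lemma exists_forall_abs_le {f : Rn n → ℝ} (hf : Continuous f) (hc : HasCompactSupport f) :
    ∃ M, ∀ x, |f x| ≤ M := by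
  obtain ⟨M, hM⟩ := hf.bounded_above_of_compact_support hc
  exact ⟨M, hM⟩

/-- A function depending affinely on `τ ∈ [0, 1]` is bounded together with its gradient,
uniformly in `τ`. -/
lemma exists_uniform_bound (ha : ContDiff ℝ ∞ a) (hb : ContDiff ℝ ∞ b)
    (hac : HasCompactSupport a) (hbc : HasCompactSupport b) :
    ∃ M₀, ∀ M, M₀ ≤ M → ∀ τ, 0 ≤ τ → τ ≤ 1 → ∀ x, |a x + τ * b x| ≤ M ∧
      grdDot (fun y => a y + τ * b y) (fun y => a y + τ * b y) x ≤ M := by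
  obtain ⟨M1, h1⟩ := exists_forall_abs_le ha.continuous hac
  obtain ⟨M2, h2⟩ := exists_forall_abs_le hb.continuous hbc
  obtain ⟨M3, h3⟩ := exists_forall_abs_le (contDiff_grdDot ha ha).continuous
    (hasCompactSupport_grdDot_right a hac)
  obtain ⟨M4, h4⟩ := exists_forall_abs_le (contDiff_grdDot ha hb).continuous
    (hasCompactSupport_grdDot_right a hbc)
  obtain ⟨M5, h5⟩ := exists_forall_abs_le (contDiff_grdDot hb hb).continuous
    (hasCompactSupport_grdDot_right b hbc)
  have p1 := (abs_nonneg _).trans (h1 0)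
  have p2 := (abs_nonneg _).trans (h2 0)
  have p3 := (abs_nonneg _).trans (h3 0)
  have p4 := (abs_nonneg _).trans (h4 0)
  have p5 := (abs_nonneg _).trans (h5 0)
  -- Every larger `M` serves as well, so one constant can later replace several bounds of this kind.
  refine ⟨M1 + M2 + M3 + 2 * M4 + M5, fun M hM τ h0 hτ x => ⟨?_, ?_⟩⟩
  · have : |a x + τ * b x| ≤ |a x| + τ * |b x| := by
      refine (abs_add_le _ _).trans ?_
      rw [abs_mul, abs_of_nonneg h0]
    nlinarith [h1 x, h2 x, abs_nonneg (b x)]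
  · rw [grdDot_add_const_mul_self ha hb]
    have e3 := (le_abs_self _).trans (h3 x)
    have e4 := (le_abs_self _).trans (h4 x)
    have e5 := (le_abs_self _).trans (h5 x)
    have e6 : τ * (2 * grdDot a b x) ≤ 1 * (2 * M4) :=
      (mul_le_mul_of_nonneg_left (by linarith) h0).trans
        (mul_le_mul_of_nonneg_right hτ (by linarith))
    have e7 : τ ^ 2 * grdDot b b x ≤ 1 * M5 :=
      (mul_le_mul_of_nonneg_left e5 (by positivity)).trans
        (mul_le_mul_of_nonneg_right (by nlinarith) p5)
    linarith

end Convexified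

/-! ### The Carleman estimate in `L²` -/

/-- The data of a global smooth function `φ` with compact support that is a limiting Carleman
weight in `V`, together with a smooth extension `ρ` of `|∇φ|⁻²`. The Hessian identity is the
algebraic form of the vanishing of the Poisson bracket on the characteristic set. -/
structure IsWeightOn (φ ρ : Rn n → ℝ) (V : Set (Rn n)) : Prop where
  smooth : ContDiff ℝ ∞ φ
  compact : HasCompactSupport φ
  smooth_inv : ContDiff ℝ ∞ ρ
  compact_inv : HasCompactSupport ρ
  mul_eq_one : ∀ x ∈ V, ρ x * grdDot φ φ x = 1
  hess : ∀ x ∈ V, ∀ X : Fin n → ℝ, hessForm φ x X X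
    = -(ρ x / 2 * grdDot φ (grdDot φ φ) x) * (∑ k, X k * X k)
      + ρ x * (∑ k, grd φ x k * X k) * ∑ k, grd (grdDot φ φ) x k * X k

/-- The pointwise algebra of the `L²` estimate, with `w = ∇|∇φ|²·∇v`, `mv = ∇m·∇v`, `l = Δψ`, `lv =
∇Δψ·∇v`, `κ = 1 + τφ`, `q = |∇φ|²`, `t = ∇φ·∇v` and `N = |∇v|²`. Young's inequality absorbs the
cross terms into half of `S² + K²`. The term `τ κ² q² v²` survives because `q ≥ 1/M` and `κ ≥ 1/2`.
-/
lemma commutator_lower_bound {M h τ ρ w m mv l lv κ q t S K v N : ℝ} (hM : 1 ≤ M) (hh : 0 < h)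
    (hτ : 0 < τ) (hρ : |ρ| ≤ M) (hw : w ^ 2 ≤ M * N) (hm : |m| ≤ M) (hmv : mv ^ 2 ≤ M * N)
    (hl : |l| ≤ M) (hlv : lv ^ 2 ≤ M * N) (hκ : 1 / 2 ≤ κ) (hq : ρ * q = 1) :
    S ^ 2 / 2 + K ^ 2 / 2 - 12 * M ^ 3 * h ^ 2 * (v ^ 2 + h ^ 2 * N) + h * τ / M ^ 2 * v ^ 2 ≤
      S ^ 2 + K ^ 2 + (2 * h ^ 2 * ρ * w * (K - h * l * v)
        + 4 * h * (h ^ 2 * (τ * t ^ 2) + τ * κ ^ 2 * q ^ 2 * v ^ 2 - m * v * S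
          + h ^ 2 * (v * mv)) + 2 * h ^ 3 * (v * lv)) := by
  have hM0 : 0 < M := by linarith
  have hρ2 : ρ ^ 2 ≤ M ^ 2 := sq_le_sq' (abs_le.1 hρ).1 (abs_le.1 hρ).2
  have hm2 : m ^ 2 ≤ M ^ 2 := sq_le_sq' (abs_le.1 hm).1 (abs_le.1 hm).2
  have hl2 : l ^ 2 ≤ M ^ 2 := sq_le_sq' (abs_le.1 hl).1 (abs_le.1 hl).2
  have hN : 0 ≤ N := nonneg_of_mul_nonneg_right ((sq_nonneg w).trans hw) hM0
  have hρw : (ρ * w) ^ 2 ≤ M ^ 3 * N := by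
    rw [mul_pow]
    calc ρ ^ 2 * w ^ 2 ≤ M ^ 2 * (M * N) := mul_le_mul hρ2 hw (sq_nonneg _) (by positivity)
      _ = M ^ 3 * N := by ring
  have hlv' : (l * v) ^ 2 ≤ M ^ 2 * v ^ 2 := by
    rw [mul_pow]; exact mul_le_mul_of_nonneg_right hl2 (sq_nonneg _)
  have hmv' : (m * v) ^ 2 ≤ M ^ 2 * v ^ 2 := by
    rw [mul_pow]; exact mul_le_mul_of_nonneg_right hm2 (sq_nonneg _)
  have b1 : -(K ^ 2 / 2) - 2 * h ^ 4 * (M ^ 3 * N) ≤ 2 * h ^ 2 * ρ * w * K := by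
    linarith [sq_nonneg (K + 2 * h ^ 2 * (ρ * w)),
      mul_le_mul_of_nonneg_left hρw (by positivity : 0 ≤ 2 * h ^ 4)]
  have b2 : -(h ^ 2 * (h ^ 2 * (M ^ 3 * N) + M ^ 2 * v ^ 2)) ≤ -2 * h ^ 3 * ρ * w * l * v := by
    linarith [mul_nonneg (sq_nonneg h) (sq_nonneg (h * (ρ * w) - l * v)),
      mul_le_mul_of_nonneg_left hρw (by positivity : 0 ≤ h ^ 4),
      mul_le_mul_of_nonneg_left hlv' (by positivity : 0 ≤ h ^ 2)]
  have b3 : -(S ^ 2 / 2) - 8 * h ^ 2 * (M ^ 2 * v ^ 2) ≤ -4 * h * (m * v * S) := by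
    linarith [sq_nonneg (S - 4 * h * (m * v)),
      mul_le_mul_of_nonneg_left hmv' (by positivity : 0 ≤ 8 * h ^ 2)]
  have b4 : -(2 * h ^ 2 * (v ^ 2 + h ^ 2 * (M * N))) ≤ 4 * h ^ 3 * (v * mv) := by
    linarith [mul_nonneg (sq_nonneg h) (sq_nonneg (v + h * mv)),
      mul_le_mul_of_nonneg_left hmv (by positivity : 0 ≤ 2 * h ^ 4)]
  have b5 : -(h ^ 2 * (v ^ 2 + h ^ 2 * (M * N))) ≤ 2 * h ^ 3 * (v * lv) := by
    linarith [mul_nonneg (sq_nonneg h) (sq_nonneg (v + h * lv)),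
      mul_le_mul_of_nonneg_left hlv (by positivity : 0 ≤ h ^ 4)]
  have b6 : 0 ≤ 4 * h * (h ^ 2 * (τ * t ^ 2)) := by positivity
  have b7 : h * τ / M ^ 2 * v ^ 2 ≤ 4 * h * (τ * κ ^ 2 * q ^ 2 * v ^ 2) := by
    have hq2 : 1 / M ^ 2 ≤ q ^ 2 := by
      rw [div_le_iff₀ (by positivity)]
      calc (1 : ℝ) = ρ ^ 2 * q ^ 2 := by rw [← mul_pow, hq, one_pow]
        _ ≤ M ^ 2 * q ^ 2 := mul_le_mul_of_nonneg_right hρ2 (sq_nonneg _)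
        _ = q ^ 2 * M ^ 2 := mul_comm _ _
    have hκ2 : 1 ≤ 4 * κ ^ 2 := by
      have := mul_le_mul hκ hκ (by norm_num) (by linarith)
      linarith
    have : 1 / M ^ 2 ≤ 4 * κ ^ 2 * q ^ 2 :=
      hq2.trans (le_mul_of_one_le_left (sq_nonneg q) hκ2)
    calc h * τ / M ^ 2 * v ^ 2 = h * τ * v ^ 2 * (1 / M ^ 2) := by ring
      _ ≤ h * τ * v ^ 2 * (4 * κ ^ 2 * q ^ 2) := mul_le_mul_of_nonneg_left this (by positivity)
      _ = _ := by ring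
  -- The errors add up to `h² v² (9 M² + 3)` and `h⁴ N (3 M³ + 3 M)`, whence the constant `12 M³`.
  have c1 : M ^ 2 ≤ M ^ 3 := pow_le_pow_right₀ hM (by norm_num)
  have c2 : M ≤ M ^ 3 := by simpa using pow_le_pow_right₀ hM (by norm_num : 1 ≤ 3)
  have c3 : 1 ≤ M ^ 3 := one_le_pow₀ hM
  have d1 : h ^ 4 * N * M ≤ h ^ 4 * N * M ^ 3 := mul_le_mul_of_nonneg_left c2 (by positivity)
  have d2 : h ^ 2 * v ^ 2 * M ^ 2 ≤ h ^ 2 * v ^ 2 * M ^ 3 :=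
    mul_le_mul_of_nonneg_left c1 (by positivity)
  have d3 : h ^ 2 * v ^ 2 * 1 ≤ h ^ 2 * v ^ 2 * M ^ 3 :=
    mul_le_mul_of_nonneg_left c3 (by positivity)
  have d4 : 0 ≤ h ^ 4 * N * M ^ 3 := by positivity
  linarith

/-- Here `a`, `b`, `c`, `e` stand for the integrals of `S²`, `K²`, `v²` and `h²|∇v|²`. The gain `hτ
c` has one factor `τ` where the error has `h`, so the error is absorbed when `h` is small relative
to `τ`. -/
lemma absorb_energy {M h τ a b c e I : ℝ} (hM : 1 ≤ M) (hh : 0 < h) (hτ : 0 < τ) (hτ1 : τ ≤ 1)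
    (hsmall : h ≤ τ / (48 * M ^ 6)) (ha : 0 ≤ a) (hb : 0 ≤ b) (hc : 0 ≤ c)
    (he : e ≤ a / 2 + (1 / 2 + M) * c)
    (hI : a / 2 + b / 2 - 12 * M ^ 3 * h ^ 2 * (c + e) + h * τ / M ^ 2 * c ≤ I) :
    h * τ * (c + e) ≤ 16 * M ^ 3 * I := by
  have hM0 : 0 < M := by linarith
  have e1 : c + e ≤ a / 2 + 3 * M * c := by
    have := mul_le_mul_of_nonneg_right hM hc
    linarith
  have s1 : h * (48 * M ^ 6) ≤ τ := (le_div_iff₀ (by positivity)).1 hsmall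
  have p6 : 1 ≤ M ^ 6 := one_le_pow₀ hM
  have hle : h ≤ 1 := by
    have := mul_le_mul_of_nonneg_left p6 hh.le
    linarith
  have t1 : 12 * M ^ 3 * h ^ 2 * (c + e) ≤ 12 * M ^ 3 * h ^ 2 * (a / 2 + 3 * M * c) :=
    mul_le_mul_of_nonneg_left e1 (by positivity)
  have t2 : 12 * M ^ 3 * h ^ 2 * (a / 2) ≤ a / 4 := by
    have p36 : M ^ 3 ≤ M ^ 6 := pow_le_pow_right₀ hM (by norm_num)
    have : 24 * (M ^ 3 * h ^ 2) ≤ 1 := by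
      have : M ^ 3 * h ^ 2 ≤ M ^ 6 * h := by
        calc M ^ 3 * h ^ 2 = M ^ 3 * h * h := by ring
          _ ≤ M ^ 6 * h * 1 := by gcongr
          _ = _ := mul_one _
      linarith
    have := mul_le_mul_of_nonneg_right this ha
    linarith
  -- The constant 48 in `hsmall` is chosen for this line: `36 M⁴ h ≤ (3/4) τ / M²` means `48 M⁶ h ≤
  -- τ`.
  have t3 : 12 * M ^ 3 * h ^ 2 * (3 * M * c) ≤ 3 / 4 * (h * τ / M ^ 2 * c) := by
    have : h * (h * (48 * M ^ 6)) * c ≤ h * τ * c := by gcongr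
    have e2 : 12 * M ^ 3 * h ^ 2 * (3 * M * c)
        = 3 / 4 * (h * (h * (48 * M ^ 6)) * c / M ^ 2) := by field_simp; ring
    have e3 : 3 / 4 * (h * τ / M ^ 2 * c) = 3 / 4 * (h * τ * c / M ^ 2) := by ring
    rw [e2, e3]
    gcongr
  have t4 : a / 4 + h * τ / M ^ 2 * c / 4 ≤ I := by
    have : 0 ≤ h * τ / M ^ 2 * c := by positivity
    rw [mul_add] at t1
    linarith
  have hhτ : h * τ ≤ 1 := mul_le_one₀ hle hτ.le hτ1
  have t5 : h * τ * (c + e) ≤ h * τ * (a / 2 + 3 * M * c) :=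
    mul_le_mul_of_nonneg_left e1 (by positivity)
  have t6 : 16 * M ^ 3 * (a / 4 + h * τ / M ^ 2 * c / 4) = 4 * M ^ 3 * a + 4 * M * (h * τ * c) := by
    field_simp; ring
  have t7 : 16 * M ^ 3 * (a / 4 + h * τ / M ^ 2 * c / 4) ≤ 16 * M ^ 3 * I :=
    mul_le_mul_of_nonneg_left t4 (by positivity)
  have t8 : 1 ≤ M ^ 3 := one_le_pow₀ hM
  have t9 : h * τ * a ≤ M ^ 3 * a := mul_le_mul_of_nonneg_right (hhτ.trans t8) ha
  have t10 : 0 ≤ M * (h * τ * c) := by positivity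
  have t11 : 0 ≤ M ^ 3 * a := by positivity
  calc h * τ * (c + e) ≤ h * τ * (a / 2 + 3 * M * c) := t5
    _ = h * τ * a / 2 + 3 * (M * (h * τ * c)) := by ring
    _ ≤ 4 * M ^ 3 * a + 4 * M * (h * τ * c) := by linarith
    _ ≤ 16 * M ^ 3 * I := t6 ▸ t7

section L2

variable {φ ρ : Rn n → ℝ} {V : Set (Rn n)}

lemma integral_add_eq {f g : Rn n → ℝ} {a b : ℝ} (hf : Integrable f ∧ ∫ x, f x = a)
    (hg : Integrable g ∧ ∫ x, g x = b) :
    Integrable (fun x => f x + g x) ∧ ∫ x, (f x + g x) = a + b :=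
  ⟨hf.1.add hg.1, by rw [integral_add hf.1 hg.1, hf.2, hg.2]⟩

lemma integral_sub_eq {f g : Rn n → ℝ} {a b : ℝ} (hf : Integrable f ∧ ∫ x, f x = a)
    (hg : Integrable g ∧ ∫ x, g x = b) :
    Integrable (fun x => f x - g x) ∧ ∫ x, (f x - g x) = a - b :=
  ⟨hf.1.sub hg.1, by rw [integral_sub hf.1 hg.1, hf.2, hg.2]⟩

lemma integral_const_mul_eq {f : Rn n → ℝ} {a : ℝ} (c : ℝ) (hf : Integrable f ∧ ∫ x, f x = a) :
    Integrable (fun x => c * f x) ∧ ∫ x, c * f x = c * a :=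
  ⟨hf.1.const_mul c, by rw [integral_const_mul, hf.2]⟩

lemma integral_div_eq {f : Rn n → ℝ} {a : ℝ} (c : ℝ) (hf : Integrable f ∧ ∫ x, f x = a) :
    Integrable (fun x => f x / c) ∧ ∫ x, f x / c = a / c :=
  ⟨hf.1.div_const c, by rw [integral_div, hf.2]⟩

/-- The multiplier whose product with the symmetric part corrects the commutator. -/
def bracketCoeff (φ ρ : Rn n → ℝ) (x : Rn n) : ℝ := ρ x / 2 * grdDot φ (grdDot φ φ) x

/-- One multiplier cancels both signless Hessian terms, the one in `|∇v|²` and the one in `v²`; the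
latter needs `ρ|∇φ|² = 1`. The remaining mixed Hessian term contains `∇ψ·∇v`, which is expressed by
the antisymmetric part. What is left carries the factor `τ` and a sign, or is of lower order. -/
lemma commDensity_add_eq (H : IsWeightOn φ ρ V) {v : Rn n → ℝ} (h τ : ℝ)
    {x : Rn n} (hx : x ∈ V) :
    commDensity h (convexified φ τ) v x + 4 * h * (((1 + τ * φ x) * bracketCoeff φ ρ x)
        * (h ^ 2 * grdDot v v x - grdDot (convexified φ τ) (convexified φ τ) x * v x ^ 2))
      = 2 * h ^ 2 * ρ x * grdDot (grdDot φ φ) v x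
          * (skewPart h (convexified φ τ) v x - h * lap (convexified φ τ) x * v x)
        + 4 * h * (h ^ 2 * (τ * grdDot φ v x ^ 2)
          + τ * (1 + τ * φ x) ^ 2 * grdDot φ φ x ^ 2 * v x ^ 2)
        + 2 * h ^ 3 * (v x * grdDot (lap (convexified φ τ)) v x) := by
  have hone := H.mul_eq_one x hx
  have h1 : hessForm (convexified φ τ) x (grd v x) (grd v x)
      = (1 + τ * φ x) * (-bracketCoeff φ ρ x * grdDot v v x
        + ρ x * grdDot φ v x * grdDot (grdDot φ φ) v x) + τ * (grdDot φ v x * grdDot φ v x) := by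
    rw [hessForm_convexified H.smooth, H.hess x hx]; rfl
  have h2 : hessForm φ x (grd φ x) (grd φ x) = 1 / 2 * grdDot φ (grdDot φ φ) x := by
    rw [grdDot_grdDot H.smooth H.smooth]; ring
  have h3 : hessForm (convexified φ τ) x (grd (convexified φ τ) x) (grd (convexified φ τ) x)
      = (1 + τ * φ x) ^ 3 * (1 / 2 * grdDot φ (grdDot φ φ) x)
        + τ * (1 + τ * φ x) ^ 2 * grdDot φ φ x ^ 2 := by
    rw [hessForm_convexified H.smooth, grd_convexified H.smooth, ← h2]
    have e1 : ∑ j, grd φ x j * ((1 + τ * φ x) * grd φ x j) = (1 + τ * φ x) * grdDot φ φ x := by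
      rw [grdDot, Finset.mul_sum]; exact Finset.sum_congr rfl fun _ _ => by simp only [grd]; ring
    have e2 : hessForm φ x (fun k => (1 + τ * φ x) * grd φ x k)
        (fun k => (1 + τ * φ x) * grd φ x k)
        = (1 + τ * φ x) ^ 2 * hessForm φ x (grd φ x) (grd φ x) := by
      simp only [hessForm, Finset.mul_sum]
      exact Finset.sum_congr rfl fun _ _ => Finset.sum_congr rfl fun _ _ => by ring
    rw [e1, e2]; ring
  simp only [commDensity, h1, h3, skewPart, grdDot_convexified_left H.smooth τ v,
    grdDot_convexified_self H.smooth, grdDot_comm v (lap (convexified φ τ)), bracketCoeff]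
  linear_combination (-4 * h * (1 + τ * φ x) ^ 3 * v x ^ 2 * (1 / 2 * grdDot φ (grdDot φ φ) x))
    * hone

lemma contDiff_bracketCoeff (H : IsWeightOn φ ρ V) : ContDiff ℝ ∞ (bracketCoeff φ ρ) :=
  (H.smooth_inv.div_const 2).mul (contDiff_grdDot H.smooth (contDiff_grdDot H.smooth H.smooth))

lemma hasCompactSupport_bracketCoeff (H : IsWeightOn φ ρ V) :
    HasCompactSupport (bracketCoeff φ ρ) :=
  (hasCompactSupport_grdDot_left H.compact _).mul_left (f := fun x => ρ x / 2)

set_option maxHeartbeats 1000000 in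
/-- `L²` Carleman estimate for the convexified weight, with constants independent of the
convexification parameter. -/
theorem carleman_L2 (H : IsWeightOn φ ρ V) :
    ∃ M, 1 ≤ M ∧ ∀ h τ, 0 < h → 0 < τ → τ ≤ 1 / M → h ≤ τ / M →
      ∀ v : Rn n → ℝ, ContDiff ℝ ∞ v → HasCompactSupport v → tsupport v ⊆ V →
        h * τ * ∫ x, (v x ^ 2 + h ^ 2 * grdDot v v x)
          ≤ M * ∫ x, conjLaplacian h (convexified φ τ) v x ^ 2 := by
  have hφ := H.smooth
  have hq := contDiff_grdDot hφ hφ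
  have hqc := hasCompactSupport_grdDot_left H.compact φ
  have hm := contDiff_bracketCoeff H
  have hmc := hasCompactSupport_bracketCoeff H
  have hl := contDiff_lap hφ
  have hlc := hasCompactSupport_lap H.compact
  -- With zero as second function, the uniform bound also covers functions that do not depend on
  -- `τ`.
  have h0 : ContDiff ℝ ∞ (fun _ : Rn n => (0 : ℝ)) := contDiff_const
  have h0c : HasCompactSupport (fun _ : Rn n => (0 : ℝ)) := HasCompactSupport.zero
  obtain ⟨M1, b1⟩ := exists_uniform_bound hφ ((hφ.mul hφ).div_const 2) H.compact
    ((H.compact.mul_right (f' := φ)).mul_right (f' := fun _ => (2 : ℝ)⁻¹))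
  obtain ⟨M2, b2⟩ := exists_uniform_bound hl ((hφ.mul hl).add hq) hlc
    ((hlc.mul_left (f := φ)).add hqc)
  obtain ⟨M3, b3⟩ := exists_uniform_bound hm (hφ.mul hm) hmc (hmc.mul_left (f := φ))
  obtain ⟨M4, b4⟩ := exists_uniform_bound hq h0 hqc h0c
  obtain ⟨M5, b5⟩ := exists_uniform_bound H.smooth_inv h0 H.compact_inv h0c
  obtain ⟨M6, b6⟩ := exists_uniform_bound hφ h0 H.compact h0c
  obtain ⟨M, hM, k1, k2, k3, k4, k5, k6⟩ : ∃ M, 1 ≤ M ∧ M1 ≤ M ∧ M2 ≤ M ∧ M3 ≤ M ∧ M4 ≤ M ∧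
      M5 ≤ M ∧ M6 ≤ M :=
    ⟨1 + |M1| + |M2| + |M3| + |M4| + |M5| + |M6|, by
      have := le_abs_self M1
      have := le_abs_self M2
      have := le_abs_self M3
      have := le_abs_self M4
      have := le_abs_self M5
      have := le_abs_self M6
      have := abs_nonneg M1
      have := abs_nonneg M2
      have := abs_nonneg M3
      have := abs_nonneg M4
      have := abs_nonneg M5
      have := abs_nonneg M6
      refine ⟨?_, ?_, ?_, ?_, ?_, ?_, ?_⟩ <;> linarith⟩
  have hM0 : 0 < M := by linarith
  have p6 : M ≤ M ^ 6 := by simpa using pow_le_pow_right₀ hM (by norm_num : 1 ≤ 6)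
  have p3 : M ^ 3 ≤ M ^ 6 := pow_le_pow_right₀ hM (by norm_num)
  refine ⟨48 * M ^ 6, by linarith, fun h τ hh hτ hτ1 hhτ v hv hc hs => ?_⟩
  have hτM : τ * (48 * M ^ 6) ≤ 1 := (le_div_iff₀ (by positivity)).1 hτ1
  have hτle : τ ≤ 1 := by
    have := mul_le_mul_of_nonneg_left (hM.trans p6) hτ.le
    linarith
  obtain ⟨ψ, hψdef⟩ : ∃ ψ, ψ = convexified φ τ := ⟨_, rfl⟩
  rw [← hψdef]
  have hψ : ContDiff ℝ ∞ ψ := hψdef ▸ contDiff_convexified hφ τ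
  set m : Rn n → ℝ := fun x => bracketCoeff φ ρ x + τ * (φ x * bracketCoeff φ ρ x) with hmdef
  have hmsm : ContDiff ℝ ∞ m := hm.add (contDiff_const.mul (hφ.mul hm))
  have hlapψ : lap ψ = fun x => lap φ x + τ * (φ x * lap φ x + grdDot φ φ x) :=
    hψdef ▸ funext fun x => lap_convexified hφ τ x
  -- integrability
  have iS : Integrable fun x => symPart h ψ v x ^ 2 :=
    ((contDiff_symPart h hψ hv).pow 2).continuous.integrable_of_hasCompactSupport
      ((hasCompactSupport_symPart h ψ hc).comp_left (g := fun t : ℝ => t ^ 2) (by simp))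
  have iK : Integrable fun x => skewPart h ψ v x ^ 2 :=
    ((contDiff_skewPart h hψ hv).pow 2).continuous.integrable_of_hasCompactSupport
      ((hasCompactSupport_skewPart h ψ hc).comp_left (g := fun t : ℝ => t ^ 2) (by simp))
  have iv : Integrable fun x => v x ^ 2 :=
    (hv.pow 2).continuous.integrable_of_hasCompactSupport
      (hc.comp_left (g := fun t : ℝ => t ^ 2) (by simp))
  have iN : Integrable fun x => h ^ 2 * grdDot v v x :=
    ((contDiff_grdDot hv hv).continuous.integrable_of_hasCompactSupport
      (hasCompactSupport_grdDot_left hc v)).const_mul _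
  obtain ⟨iC, eC⟩ := integral_two_mul_symPart_mul_skewPart h hψ hv hc
  obtain ⟨iE, eE⟩ := integral_weighted_energy h ψ hv hc hmsm
  obtain ⟨iF, eF⟩ := integral_weighted_energy h ψ hv hc (contDiff_const (c := (1 : ℝ)))
  have iSK : Integrable fun x => 2 * symPart h ψ v x * skewPart h ψ v x :=
    ((contDiff_const.mul (contDiff_symPart h hψ hv)).mul
      (contDiff_skewPart h hψ hv)).continuous.integrable_of_hasCompactSupport
      ((hasCompactSupport_skewPart h ψ hc).mul_left)
  -- the square of the operator
  have hSK := integral_add_eq ⟨iS, rfl⟩ ⟨iK, rfl⟩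
  -- The weighted energy identity has integral zero, so `4h` times its density may be added. This
  -- makes a pointwise lower bound possible.
  have eP : ∫ x, conjLaplacian h ψ v x ^ 2 = ∫ x, (symPart h ψ v x ^ 2 + skewPart h ψ v x ^ 2
      + (commDensity h ψ v x + 4 * h * (m x * (h ^ 2 * grdDot v v x - grdDot ψ ψ x * v x ^ 2)
        - m x * v x * symPart h ψ v x + h ^ 2 * (v x * grdDot m v x)))) := by
    have : ∫ x, conjLaplacian h ψ v x ^ 2 = ∫ x, (symPart h ψ v x ^ 2 + skewPart h ψ v x ^ 2
        + 2 * symPart h ψ v x * skewPart h ψ v x) :=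
      integral_congr_ae (.of_forall fun x => by simp only [conjLaplacian]; ring)
    rw [this, (integral_add_eq hSK ⟨iSK, eC⟩).2,
      (integral_add_eq hSK (integral_add_eq ⟨iC, rfl⟩ (integral_const_mul_eq _ ⟨iE, eE⟩))).2,
      mul_zero, add_zero]
  have hlow : ∫ x, (symPart h ψ v x ^ 2 / 2 + skewPart h ψ v x ^ 2 / 2
      - 12 * M ^ 3 * h ^ 2 * (v x ^ 2 + h ^ 2 * grdDot v v x) + h * τ / M ^ 2 * v x ^ 2)
      ≤ ∫ x, conjLaplacian h ψ v x ^ 2 := by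
    rw [eP]
    refine integral_mono ((((iS.div_const 2).add (iK.div_const 2)).sub
      ((iv.add iN).const_mul _)).add (iv.const_mul _))
      ((iS.add iK).add (iC.add (iE.const_mul _))) fun x => ?_
    -- The Hessian identity holds only in `V`; off the support of `v` every term vanishes.
    by_cases hx : x ∈ tsupport v
    · have hxV := hs hx
      have hkey := commDensity_add_eq H (v := v) h τ hxV
      rw [← hψdef] at hkey
      have hmx : m x = (1 + τ * φ x) * bracketCoeff φ ρ x := by simp only [hmdef]; ring
      have hφb : |φ x| ≤ M := by
        have := (b6 M k6 τ hτ.le hτle x).1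
        simpa using this
      -- Smallness of `τ` keeps `1 + τφ` away from zero, so that `ψ` inherits the nonvanishing
      -- gradient of `φ` on `V`.
      have hκ : 1 / 2 ≤ 1 + τ * φ x := by
        have : |τ * φ x| ≤ τ * M := by rw [abs_mul, abs_of_pos hτ]; gcongr
        have h5 := mul_le_mul_of_nonneg_left p6 hτ.le
        linarith [(abs_le.1 this).1]
      have bnd := commutator_lower_bound (M := M) (h := h) (τ := τ) (ρ := ρ x)
        (w := grdDot (grdDot φ φ) v x) (m := m x) (mv := grdDot m v x) (l := lap ψ x)
        (lv := grdDot (lap ψ) v x) (κ := 1 + τ * φ x) (q := grdDot φ φ x) (t := grdDot φ v x)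
        (S := symPart h ψ v x) (K := skewPart h ψ v x) (v := v x) (N := grdDot v v x) hM hh hτ
        (by simpa using (b5 M k5 τ hτ.le hτle x).1)
        ((grdDot_sq_le _ _ _).trans (mul_le_mul_of_nonneg_right
          (by simpa using (b4 M k4 τ hτ.le hτle x).2) (grdDot_self_nonneg _ _)))
        (b3 M k3 τ hτ.le hτle x).1
        ((grdDot_sq_le _ _ _).trans (mul_le_mul_of_nonneg_right
          (b3 M k3 τ hτ.le hτle x).2 (grdDot_self_nonneg _ _)))
        (by rw [hlapψ]; exact (b2 M k2 τ hτ.le hτle x).1)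
        ((grdDot_sq_le _ _ _).trans (mul_le_mul_of_nonneg_right
          (by rw [hlapψ]; exact (b2 M k2 τ hτ.le hτle x).2) (grdDot_self_nonneg _ _)))
        hκ (H.mul_eq_one x hxV)
      refine bnd.trans (le_of_eq ?_)
      rw [← hmx] at hkey
      linear_combination -hkey
    · have hev : v =ᶠ[nhds x] fun _ => 0 := notMem_tsupport_iff_eventuallyEq.1 hx
      have hv0 : v x = 0 := hev.eq_of_nhds
      have hd (j : Fin n) : partialDeriv j v x = 0 := by
        rw [partialDeriv_congr hev, partialDeriv_const]
      have hl0 : lap v x = 0 := image_eq_zero_of_notMem_tsupport fun h' =>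
        hx (tsupport_lap_subset v h')
      simp [symPart, skewPart, commDensity, hessForm, grdDot, grd, hv0, hd, hl0]
  -- The energy identity with `m = 1` and `|∇ψ|² ≤ M`: the gradient is controlled by the symmetric
  -- part and `v`.
  have hen : ∫ x, h ^ 2 * grdDot v v x ≤ (∫ x, symPart h ψ v x ^ 2) / 2
      + (1 / 2 + M) * ∫ x, v x ^ 2 := by
    have : ∫ x, h ^ 2 * grdDot v v x = ∫ x, (h ^ 2 * grdDot v v x
      - (1 * (h ^ 2 * grdDot v v x - grdDot ψ ψ x * v x ^ 2)
      - 1 * v x * symPart h ψ v x + h ^ 2 * (v x * grdDot (fun _ => 1) v x))) := by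
      rw [integral_sub iN iF, eF, sub_zero]
    rw [this, ← integral_div, ← integral_const_mul, ← integral_add (iS.div_const 2)
      (iv.const_mul _)]
    refine integral_mono (iN.sub iF) ((iS.div_const 2).add (iv.const_mul _)) fun x => ?_
    have hQ := (b1 M k1 τ hτ.le hτle x).2
    have hQ' : grdDot ψ ψ x ≤ M := hψdef ▸ hQ
    have hz : grdDot (fun _ => (1 : ℝ)) v x = 0 := by simp [grdDot, partialDeriv_const]
    simp only [hz]
    linarith [sq_nonneg (symPart h ψ v x - v x),
      mul_le_mul_of_nonneg_right hQ' (sq_nonneg (v x))]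
  have hsplit : ∫ x, (symPart h ψ v x ^ 2 / 2 + skewPart h ψ v x ^ 2 / 2
      - 12 * M ^ 3 * h ^ 2 * (v x ^ 2 + h ^ 2 * grdDot v v x) + h * τ / M ^ 2 * v x ^ 2)
      = (∫ x, symPart h ψ v x ^ 2) / 2 + (∫ x, skewPart h ψ v x ^ 2) / 2
      - 12 * M ^ 3 * h ^ 2 * ((∫ x, v x ^ 2) + ∫ x, h ^ 2 * grdDot v v x)
      + h * τ / M ^ 2 * ∫ x, v x ^ 2 := by
    exact (integral_add_eq (integral_sub_eq (integral_add_eq (integral_div_eq 2 ⟨iS, rfl⟩)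
      (integral_div_eq 2 ⟨iK, rfl⟩)) (integral_const_mul_eq _ (integral_add_eq ⟨iv, rfl⟩
      ⟨iN, rfl⟩))) (integral_const_mul_eq _ ⟨iv, rfl⟩)).2
  rw [hsplit] at hlow
  rw [(integral_add_eq ⟨iv, rfl⟩ ⟨iN, rfl⟩).2]
  have hnn : 0 ≤ ∫ x, conjLaplacian h ψ v x ^ 2 := integral_nonneg fun _ => sq_nonneg _
  refine (absorb_energy hM hh hτ hτle hhτ (integral_nonneg fun _ => sq_nonneg _)
    (integral_nonneg fun _ => sq_nonneg _) (integral_nonneg fun _ => sq_nonneg _) hen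
    hlow).trans (mul_le_mul_of_nonneg_right (by linarith [pow_pos hM0 6]) hnn)

end L2

/-! ### Shifting the estimate to `H⁻¹` -/

section Shift

variable {φ ρ χ ψ g w : Rn n → ℝ} {V : Set (Rn n)}

lemma conjLaplacian_sub (h : ℝ) (ψ : Rn n → ℝ) (hw : ContDiff ℝ ∞ w) (hg : ContDiff ℝ ∞ g)
    (x : Rn n) : conjLaplacian h ψ (fun y => w y - g y) x
      = conjLaplacian h ψ w x - conjLaplacian h ψ g x := by
  simp only [conjLaplacian, symPart, skewPart, lap_sub hw hg, grdDot_sub_right hw hg]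
  ring

/-- The commutator with `χ` is of first order in `g`, which is all that the `H¹` norm of `g`
controls. -/
lemma conjLaplacian_mul (h : ℝ) (ψ : Rn n → ℝ) (hχ : ContDiff ℝ ∞ χ) (hg : ContDiff ℝ ∞ g)
    (x : Rn n) : conjLaplacian h ψ (fun y => χ y * g y) x
      = χ x * conjLaplacian h ψ g x - 2 * h ^ 2 * grdDot χ g x
        + (2 * h * grdDot ψ χ x - h ^ 2 * lap χ x) * g x := by
  simp only [conjLaplacian, symPart, skewPart, lap_mul hχ hg, grdDot_mul_right hχ hg]
  ring

lemma tsupport_conjLaplacian_subset (h : ℝ) (ψ w : Rn n → ℝ) :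
    tsupport (conjLaplacian h ψ w) ⊆ tsupport w := by
  refine closure_minimal (fun x hx => ?_) (isClosed_tsupport w)
  by_contra hn
  have h1 : w x = 0 := image_eq_zero_of_notMem_tsupport hn
  have h2 : lap w x = 0 := image_eq_zero_of_notMem_tsupport fun h' => hn (tsupport_lap_subset w h')
  have h3 : grdDot ψ w x = 0 :=
    image_eq_zero_of_notMem_tsupport fun h' => hn (tsupport_grdDot_subset_right ψ w h')
  exact hx (by simp [conjLaplacian, symPart, skewPart, h1, h2, h3])

/-- The left side is the square of `P(w - χg)` at a point, with `Q = |∇ψ|²`, `l = Δψ`, `lχ = Δχ`,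
`pχ = ∇ψ·∇χ`, `pg = ∇ψ·∇g`, `cg = ∇χ·∇g` and `N = |∇g|²`. Three summands and the bound `6 M²` for
the coefficient of `g` give `108 = 3 · 36`. -/
lemma shift_pointwise_bound {M h g χ Q l lχ pχ pg cg N : ℝ} (hM : 1 ≤ M) (hh : 0 < h)
    (hh1 : h ≤ 1) (hχ : |χ| ≤ M) (hQ : |Q| ≤ M) (hl : |l| ≤ M) (hlχ : |lχ| ≤ M)
    (hpχ : |pχ| ≤ M) (hpg : pg ^ 2 ≤ M * N) (hcg : cg ^ 2 ≤ M * N) (hN : 0 ≤ N) :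
    (g * (χ * (1 + Q - h * l) + h ^ 2 * lχ - 2 * h * pχ) - 2 * h * χ * pg
      + 2 * h ^ 2 * cg) ^ 2 ≤ 108 * M ^ 4 * (g ^ 2 + h ^ 2 * N) := by
  have hM0 : 0 < M := by linarith
  have hh2 : h ^ 2 ≤ 1 := pow_le_one₀ hh.le hh1
  have c1 : |χ * (1 + Q - h * l) + h ^ 2 * lχ - 2 * h * pχ| ≤ 6 * M ^ 2 := by
    have e1 : |1 + Q - h * l| ≤ 1 + M + M := by
      refine (abs_sub _ _).trans (add_le_add ((abs_add_le _ _).trans ?_) ?_)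
      · rw [abs_one]; linarith
      · rw [abs_mul, abs_of_pos hh]
        exact (mul_le_of_le_one_left (abs_nonneg _) hh1).trans hl
    have e2 : |χ * (1 + Q - h * l)| ≤ M * (1 + M + M) := by
      rw [abs_mul]; exact mul_le_mul hχ e1 (abs_nonneg _) hM0.le
    have e3 : |h ^ 2 * lχ| ≤ M := by
      rw [abs_mul, abs_of_nonneg (sq_nonneg h)]
      exact (mul_le_of_le_one_left (abs_nonneg _) hh2).trans hlχ
    have e4 : |2 * h * pχ| ≤ 2 * M := by
      rw [mul_assoc, abs_mul, abs_mul, abs_of_pos hh, abs_two]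
      exact mul_le_mul_of_nonneg_left
        ((mul_le_of_le_one_left (abs_nonneg _) hh1).trans hpχ) two_pos.le
    have e5 := (abs_sub (χ * (1 + Q - h * l) + h ^ 2 * lχ) (2 * h * pχ)).trans
      (add_le_add_left (abs_add_le _ _) _)
    have : M ≤ M ^ 2 := by simpa using pow_le_pow_right₀ hM (by norm_num : 1 ≤ 2)
    linarith
  set A := χ * (1 + Q - h * l) + h ^ 2 * lχ - 2 * h * pχ
  have d1 : (g * A) ^ 2 ≤ 36 * M ^ 4 * g ^ 2 := by
    have : A ^ 2 ≤ (6 * M ^ 2) ^ 2 := sq_le_sq' (abs_le.1 c1).1 (abs_le.1 c1).2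
    rw [mul_pow]
    linarith [mul_le_mul_of_nonneg_left this (sq_nonneg g)]
  have hχ2 : χ ^ 2 ≤ M ^ 2 := sq_le_sq' (abs_le.1 hχ).1 (abs_le.1 hχ).2
  have d2 : (2 * h * χ * pg) ^ 2 ≤ 4 * h ^ 2 * (M ^ 3 * N) := by
    have := mul_le_mul hχ2 hpg (sq_nonneg _) (sq_nonneg M)
    calc (2 * h * χ * pg) ^ 2 = 4 * h ^ 2 * (χ ^ 2 * pg ^ 2) := by ring
      _ ≤ 4 * h ^ 2 * (M ^ 2 * (M * N)) := mul_le_mul_of_nonneg_left this (by positivity)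
      _ = _ := by ring
  have d3 : (2 * h ^ 2 * cg) ^ 2 ≤ 4 * h ^ 2 * (M * N) := by
    calc (2 * h ^ 2 * cg) ^ 2 = 4 * h ^ 2 * (h ^ 2 * cg ^ 2) := by ring
      _ ≤ 4 * h ^ 2 * (M * N) := mul_le_mul_of_nonneg_left
        ((mul_le_of_le_one_left (sq_nonneg _) hh2).trans hcg) (by positivity)
  have d4 : (g * A - 2 * h * χ * pg + 2 * h ^ 2 * cg) ^ 2
      ≤ 3 * ((g * A) ^ 2 + (2 * h * χ * pg) ^ 2 + (2 * h ^ 2 * cg) ^ 2) := by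
    linarith [sq_nonneg (g * A + 2 * h * χ * pg), sq_nonneg (g * A - 2 * h ^ 2 * cg),
      sq_nonneg (2 * h * χ * pg + 2 * h ^ 2 * cg)]
  have p1 : M ^ 3 ≤ M ^ 4 := pow_le_pow_right₀ hM (by norm_num)
  have p2 : M ≤ M ^ 4 := by simpa using pow_le_pow_right₀ hM (by norm_num : 1 ≤ 4)
  have q1 := mul_le_mul_of_nonneg_right p1 (by positivity : 0 ≤ h ^ 2 * N)
  have q2 := mul_le_mul_of_nonneg_right p2 (by positivity : 0 ≤ h ^ 2 * N)
  have q3 : 0 ≤ M ^ 4 * (h ^ 2 * N) := by positivity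
  linarith

lemma grdDot_mul_self_le (hχ : ContDiff ℝ ∞ χ) (hg : ContDiff ℝ ∞ g) (x : Rn n) :
    grdDot (fun y => χ y * g y) (fun y => χ y * g y) x
      ≤ 2 * χ x ^ 2 * grdDot g g x + 2 * g x ^ 2 * grdDot χ χ x := by
  simp only [grdDot, Finset.mul_sum, ← Finset.sum_add_distrib]
  refine Finset.sum_le_sum fun k _ => ?_
  rw [partialDeriv_mul (ContDiff.differentiableAt_infty hχ x)
    (ContDiff.differentiableAt_infty hg x)]
  linarith [sq_nonneg (χ x * partialDeriv k g x - partialDeriv k χ x * g x)]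

lemma grdDot_add_self_le (hw : ContDiff ℝ ∞ w) (hg : ContDiff ℝ ∞ g) (x : Rn n) :
    grdDot (fun y => w y + g y) (fun y => w y + g y) x
      ≤ 2 * grdDot w w x + 2 * grdDot g g x := by
  simp only [grdDot, Finset.mul_sum, ← Finset.sum_add_distrib]
  refine Finset.sum_le_sum fun k _ => ?_
  rw [partialDeriv_add (ContDiff.differentiableAt_infty hw x)
    (ContDiff.differentiableAt_infty hg x)]
  linarith [sq_nonneg (partialDeriv k w x - partialDeriv k g x)]

/-- The energy form of `w = v + χg`, where `ww`, `vv`, `cc`, `c`, `N` are the squared gradients of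
`w`, `v`, `χg`, `χ`, `g`. -/
lemma shift_energy_bound {M h v vv g N χ c ww cc : ℝ} (hM : 1 ≤ M) (hh : 0 < h)
    (hh1 : h ≤ 1) (hχ : |χ| ≤ M) (hc : c ≤ M) (hN : 0 ≤ N)
    (hww : ww ≤ 2 * vv + 2 * cc) (hcc : cc ≤ 2 * χ ^ 2 * N + 2 * g ^ 2 * c) :
    (v + χ * g) ^ 2 + h ^ 2 * ww ≤ 2 * (v ^ 2 + h ^ 2 * vv) + 6 * M ^ 2 * (g ^ 2 + h ^ 2 * N) := by
  have hχ2 : χ ^ 2 ≤ M ^ 2 := sq_le_sq' (abs_le.1 hχ).1 (abs_le.1 hχ).2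
  have hh2 : h ^ 2 ≤ 1 := pow_le_one₀ hh.le hh1
  have hM0 : 0 < M := by linarith
  have p : M ≤ M ^ 2 := by simpa using pow_le_pow_right₀ hM (by norm_num : 1 ≤ 2)
  have a1 := mul_le_mul_of_nonneg_right hχ2 (sq_nonneg g)
  have a2 := mul_le_mul_of_nonneg_right hχ2 (by positivity : 0 ≤ h ^ 2 * N)
  have a3 : h ^ 2 * (g ^ 2 * c) ≤ M ^ 2 * g ^ 2 := by
    calc h ^ 2 * (g ^ 2 * c) ≤ h ^ 2 * (g ^ 2 * M ^ 2) := by gcongr; linarith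
      _ ≤ 1 * (g ^ 2 * M ^ 2) := by gcongr
      _ = _ := by ring
  have a4 := mul_le_mul_of_nonneg_left hww (sq_nonneg h)
  have a5 := mul_le_mul_of_nonneg_left hcc (sq_nonneg h)
  have a6 : (v + χ * g) ^ 2 ≤ 2 * v ^ 2 + 2 * (χ ^ 2 * g ^ 2) := by
    linarith [sq_nonneg (v - χ * g)]
  have a7 : 0 ≤ M ^ 2 * (h ^ 2 * N) := by positivity
  linarith

/-- Carleman estimate with a loss of two derivatives, for real functions: `g` stands for
`(1 - h² Δ)⁻¹` applied to the conjugated Laplacian of `w`. -/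
theorem carleman_shift (H : IsWeightOn φ ρ V) (hχ : ContDiff ℝ ∞ χ) (hχc : HasCompactSupport χ)
    (hχV : tsupport χ ⊆ V) :
    ∃ M, 1 ≤ M ∧ ∀ h τ, 0 < h → 0 < τ → τ ≤ 1 / M → h ≤ τ / M →
      ∀ w : Rn n → ℝ, ContDiff ℝ ∞ w → HasCompactSupport w → (∀ x ∈ tsupport w, χ x = 1) →
      ∀ g : Rn n → ℝ, ContDiff ℝ ∞ g →
        (∀ x, g x - h ^ 2 * lap g x = conjLaplacian h (convexified φ τ) w x) →
        Integrable (fun x => g x ^ 2 + h ^ 2 * grdDot g g x) →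
        h * τ * ∫ x, (w x ^ 2 + h ^ 2 * grdDot w w x)
          ≤ M * ∫ x, (g x ^ 2 + h ^ 2 * grdDot g g x) := by
  obtain ⟨M0, hM0, hL2⟩ := carleman_L2 H
  have hφ := H.smooth
  have h0 : ContDiff ℝ ∞ (fun _ : Rn n => (0 : ℝ)) := contDiff_const
  have h0c : HasCompactSupport (fun _ : Rn n => (0 : ℝ)) := HasCompactSupport.zero
  have hl := contDiff_lap hφ
  have hlc := hasCompactSupport_lap H.compact
  obtain ⟨M1, b1⟩ := exists_uniform_bound hφ ((hφ.mul hφ).div_const 2) H.compact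
    ((H.compact.mul_right (f' := φ)).mul_right (f' := fun _ => (2 : ℝ)⁻¹))
  obtain ⟨M2, b2⟩ := exists_uniform_bound hl ((hφ.mul hl).add (contDiff_grdDot hφ hφ)) hlc
    ((hlc.mul_left (f := φ)).add (hasCompactSupport_grdDot_left H.compact φ))
  obtain ⟨M3, b3⟩ := exists_uniform_bound hχ h0 hχc h0c
  obtain ⟨M4, b4⟩ := exists_uniform_bound (contDiff_lap hχ) h0 (hasCompactSupport_lap hχc) h0c
  obtain ⟨M, hM, k0, k1, k2, k3, k4⟩ : ∃ M, 1 ≤ M ∧ M0 ≤ M ∧ M1 ≤ M ∧ M2 ≤ M ∧ M3 ≤ M ∧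
      M4 ≤ M :=
    ⟨1 + M0 + |M1| + |M2| + |M3| + |M4|, by
      have := le_abs_self M1
      have := le_abs_self M2
      have := le_abs_self M3
      have := le_abs_self M4
      have := abs_nonneg M1
      have := abs_nonneg M2
      have := abs_nonneg M3
      have := abs_nonneg M4
      refine ⟨?_, ?_, ?_, ?_, ?_, ?_⟩ <;> linarith⟩
  have hMpos : 0 < M := by linarith
  have p5 : M ≤ M ^ 5 := by simpa using pow_le_pow_right₀ hM (by norm_num : 1 ≤ 5)
  have hMM : M0 ≤ 222 * M ^ 5 := by linarith
  -- `222 = 2 · 108 + 6`, from the bounds `s1` and `s2` below.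
  refine ⟨222 * M ^ 5, by linarith, fun h τ hh hτ hτ1 hhτ w hw hwc hχw g hg hgw hgi => ?_⟩
  have hτle : τ ≤ 1 := hτ1.trans (by rw [div_le_one (by positivity)]; linarith)
  have hh1 : h ≤ 1 := hhτ.trans ((div_le_one (by positivity)).2 (by linarith))
  have hχg := hχ.mul hg
  have hχgc : HasCompactSupport fun x => χ x * g x := hχc.mul_right
  have hχw' (x : Rn n) (hx : x ∈ tsupport w) : x ∈ tsupport χ :=
    subset_tsupport χ (by rw [Function.mem_support, hχw x hx]; exact one_ne_zero)
  -- The resolvent `g` is not supported in `V`, so it is cut off before the `L²` estimate is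
  -- applied.
  obtain ⟨v, hvdef⟩ : ∃ v : Rn n → ℝ, v = fun x => w x - χ x * g x := ⟨_, rfl⟩
  have hv : ContDiff ℝ ∞ v := hvdef ▸ hw.sub hχg
  have hvc : HasCompactSupport v := hvdef ▸ hwc.sub hχgc
  have hvV : tsupport v ⊆ V := by
    refine (closure_minimal (fun x hx => ?_) (isClosed_tsupport χ)).trans hχV
    by_contra hn
    refine hx ?_
    rw [hvdef]
    simp [image_eq_zero_of_notMem_tsupport hn,
      image_eq_zero_of_notMem_tsupport fun h' => hn (hχw' x h')]
  obtain ⟨ψ, hψdef⟩ : ∃ ψ, ψ = convexified φ τ := ⟨_, rfl⟩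
  have hψ : ContDiff ℝ ∞ ψ := hψdef ▸ contDiff_convexified hφ τ
  have hmain := hL2 h τ hh hτ
    (hτ1.trans (one_div_le_one_div_of_le (by linarith) hMM))
    (hhτ.trans (div_le_div_of_nonneg_left hτ.le (by linarith) hMM)) v hv hvc hvV
  rw [← hψdef] at hmain hgw
  -- Since `χ = 1` on the support of `w`, `Pw = χPw = χ(g - h²Δg)`. The term `-h²χΔg` cancels
  -- against the leading term of `P(χg)`, and only first derivatives of `g` remain.
  have hPv (x : Rn n) : conjLaplacian h ψ v x
      = g x * (χ x * (1 + grdDot ψ ψ x - h * lap ψ x) + h ^ 2 * lap χ x - 2 * h * grdDot ψ χ x)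
        - 2 * h * χ x * grdDot ψ g x + 2 * h ^ 2 * grdDot χ g x := by
    have e1 : χ x * conjLaplacian h ψ w x = conjLaplacian h ψ w x := by
      by_cases hx : x ∈ tsupport w
      · rw [hχw x hx, one_mul]
      · rw [image_eq_zero_of_notMem_tsupport
          fun h' => hx (tsupport_conjLaplacian_subset h ψ w h'), mul_zero]
    rw [hvdef, conjLaplacian_sub h ψ hw hχg, conjLaplacian_mul h ψ hχ hg, ← e1, ← hgw x]
    simp only [conjLaplacian, symPart, skewPart]
    ring
  have iG := hgi
  have iv : Integrable fun x => v x ^ 2 + h ^ 2 * grdDot v v x :=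
    ((hv.pow 2).add (contDiff_const.mul
      (contDiff_grdDot hv hv))).continuous.integrable_of_hasCompactSupport
      ((hvc.comp_left (g := fun t : ℝ => t ^ 2) (by simp)).add
        ((hasCompactSupport_grdDot_left hvc v).mul_left (f := fun _ => h ^ 2)))
  have iw : Integrable fun x => w x ^ 2 + h ^ 2 * grdDot w w x :=
    ((hw.pow 2).add (contDiff_const.mul
      (contDiff_grdDot hw hw))).continuous.integrable_of_hasCompactSupport
      ((hwc.comp_left (g := fun t : ℝ => t ^ 2) (by simp)).add
        ((hasCompactSupport_grdDot_left hwc w).mul_left (f := fun _ => h ^ 2)))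
  have iP : Integrable fun x => conjLaplacian h ψ v x ^ 2 :=
    ((contDiff_conjLaplacian h hψ hv).pow 2).continuous.integrable_of_hasCompactSupport
      ((hasCompactSupport_conjLaplacian h ψ hvc).comp_left (g := fun t : ℝ => t ^ 2) (by simp))
  have s1 : ∫ x, conjLaplacian h ψ v x ^ 2
      ≤ 108 * M ^ 4 * ∫ x, (g x ^ 2 + h ^ 2 * grdDot g g x) := by
    rw [← integral_const_mul]
    refine integral_mono iP (iG.const_mul _) fun x => ?_
    have c1 := (b1 M k1 τ hτ.le hτle x).2
    have c3 := b3 M k3 τ hτ.le hτle x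
    simp only [mul_zero, add_zero] at c3
    have hQ : grdDot ψ ψ x ≤ M := hψdef ▸ c1
    have hψχ : |grdDot ψ χ x| ≤ M := abs_le_of_sq_le_sq ((grdDot_sq_le ψ χ x).trans (by
      rw [sq]
      exact mul_le_mul hQ c3.2 (grdDot_self_nonneg _ _) hMpos.le)) hMpos.le
    simp only [hPv]
    refine shift_pointwise_bound hM hh hh1 c3.1 ?_ ?_ ?_ hψχ ?_ ?_ (grdDot_self_nonneg g x)
    · rwa [abs_of_nonneg (grdDot_self_nonneg _ _)]
    · rw [hψdef, lap_convexified hφ]; exact (b2 M k2 τ hτ.le hτle x).1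
    · simpa using (b4 M k4 τ hτ.le hτle x).1
    · exact (grdDot_sq_le _ _ _).trans (mul_le_mul_of_nonneg_right hQ (grdDot_self_nonneg _ _))
    · exact (grdDot_sq_le _ _ _).trans (mul_le_mul_of_nonneg_right c3.2 (grdDot_self_nonneg _ _))
  have s2 : ∫ x, (w x ^ 2 + h ^ 2 * grdDot w w x)
      ≤ 2 * (∫ x, (v x ^ 2 + h ^ 2 * grdDot v v x))
        + 6 * M ^ 2 * ∫ x, (g x ^ 2 + h ^ 2 * grdDot g g x) := by
    rw [← integral_const_mul, ← integral_const_mul,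
      ← integral_add (iv.const_mul _) (iG.const_mul _)]
    refine integral_mono iw ((iv.const_mul _).add (iG.const_mul _)) fun x => ?_
    have c3 := b3 M k3 τ hτ.le hτle x
    simp only [mul_zero, add_zero] at c3
    have hwv : w = fun y => v y + χ y * g y := by rw [hvdef]; ext y; ring
    have e := grdDot_add_self_le hv hχg x
    rw [← hwv] at e
    have := shift_energy_bound (v := v x) hM hh hh1 c3.1 c3.2 (grdDot_self_nonneg g x) e
      (grdDot_mul_self_le hχ hg x)
    have hwx : w x = v x + χ x * g x := congrFun hwv x
    simpa only [hwx] using this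
  have hG0 : 0 ≤ ∫ x, (g x ^ 2 + h ^ 2 * grdDot g g x) := integral_nonneg fun x =>
    add_nonneg (sq_nonneg _) (mul_nonneg (sq_nonneg _) (grdDot_self_nonneg g x))
  obtain ⟨G, hGdef⟩ : ∃ G, G = ∫ x, (g x ^ 2 + h ^ 2 * grdDot g g x) := ⟨_, rfl⟩
  rw [← hGdef] at s1 s2 hG0 ⊢
  have hhτ1 : h * τ ≤ 1 := mul_le_one₀ hh1 hτ.le hτle
  have p25 : M ^ 2 ≤ M ^ 5 := pow_le_pow_right₀ hM (by norm_num)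
  have r1 := mul_le_mul_of_nonneg_left s2 (mul_pos hh hτ).le
  have r2 : M0 * ∫ x, conjLaplacian h ψ v x ^ 2 ≤ M * (108 * M ^ 4 * G) :=
    mul_le_mul k0 s1 (integral_nonneg fun _ => sq_nonneg _) hMpos.le
  have r3 : h * τ * (6 * M ^ 2 * G) ≤ 6 * M ^ 5 * G := by
    refine (mul_le_of_le_one_left (by positivity) hhτ1).trans ?_
    gcongr
  linarith

end Shift

/-! ### Complex valued functions -/

/-- The density `|f|² + h² |∇f|²` of the semiclassical energy. -/
def energyDensity (h : ℝ) (f : Rn n → ℂ) (x : Rn n) : ℝ :=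
  ‖f x‖ ^ 2 + h ^ 2 * ∑ k, ‖partialDeriv k f x‖ ^ 2

/-- The semiclassical energy `∫ |f|² + h² |∇f|²`. -/
def sclEnergy (h : ℝ) (f : Rn n → ℂ) : ℝ := ∫ x, energyDensity h f x

/-- The operator `e^{ψ/h} (-h² Δ) e^{-ψ/h}` on complex valued functions. -/
def conjLaplacianC (h : ℝ) (ψ : Rn n → ℝ) (w : Rn n → ℂ) (x : Rn n) : ℂ :=
  -(h : ℂ) ^ 2 * ∑ k, partialDeriv k (partialDeriv k w) x
    + 2 * h * ∑ k, ((partialDeriv k ψ x : ℝ) : ℂ) * partialDeriv k w x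
    + ((h * lap ψ x - grdDot ψ ψ x : ℝ) : ℂ) * w x

lemma energyDensity_nonneg (h : ℝ) (f : Rn n → ℂ) (x : Rn n) : 0 ≤ energyDensity h f x :=
  add_nonneg (sq_nonneg _) (mul_nonneg (sq_nonneg _) (Finset.sum_nonneg fun _ _ => sq_nonneg _))

lemma sclEnergy_nonneg (h : ℝ) (f : Rn n → ℂ) : 0 ≤ sclEnergy h f :=
  integral_nonneg (energyDensity_nonneg h f)

lemma partialDeriv_ofReal {g : Rn n → ℝ} (hg : ContDiff ℝ ∞ g) (k : Fin n) (x : Rn n) :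
    partialDeriv k (fun y => (g y : ℂ)) x = ((partialDeriv k g x : ℝ) : ℂ) :=
  partialDeriv_clm_comp Complex.ofRealCLM (ContDiff.differentiableAt_infty hg x) k

lemma contDiff_ofReal {g : Rn n → ℝ} (hg : ContDiff ℝ ∞ g) :
    ContDiff ℝ ∞ fun y => (g y : ℂ) :=
  Complex.ofRealCLM.contDiff.comp hg

/-! ### Reduction of complex valued functions to real and imaginary parts. -/

section ReIm

variable {f : Rn n → ℂ}

lemma partialDeriv_re (hf : ContDiff ℝ ∞ f) (k : Fin n) :
    partialDeriv k (fun y => (f y).re) = fun x => (partialDeriv k f x).re :=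
  funext fun x => partialDeriv_clm_comp Complex.reCLM (ContDiff.differentiableAt_infty hf x) k

lemma partialDeriv_im (hf : ContDiff ℝ ∞ f) (k : Fin n) :
    partialDeriv k (fun y => (f y).im) = fun x => (partialDeriv k f x).im :=
  funext fun x => partialDeriv_clm_comp Complex.imCLM (ContDiff.differentiableAt_infty hf x) k

lemma contDiff_re (hf : ContDiff ℝ ∞ f) : ContDiff ℝ ∞ fun y => (f y).re :=
  Complex.reCLM.contDiff.comp hf

lemma contDiff_im (hf : ContDiff ℝ ∞ f) : ContDiff ℝ ∞ fun y => (f y).im :=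
  Complex.imCLM.contDiff.comp hf

lemma lap_re (hf : ContDiff ℝ ∞ f) (x : Rn n) :
    lap (fun y => (f y).re) x = (∑ k, partialDeriv k (partialDeriv k f) x).re := by
  simp only [lap, Complex.re_sum, partialDeriv_re hf,
    partialDeriv_re (contDiff_partialDeriv hf _)]

lemma lap_im (hf : ContDiff ℝ ∞ f) (x : Rn n) :
    lap (fun y => (f y).im) x = (∑ k, partialDeriv k (partialDeriv k f) x).im := by
  simp only [lap, Complex.im_sum, partialDeriv_im hf,
    partialDeriv_im (contDiff_partialDeriv hf _)]

lemma conjLaplacian_re (h : ℝ) (ψ : Rn n → ℝ) (hf : ContDiff ℝ ∞ f) (x : Rn n) :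
    conjLaplacian h ψ (fun y => (f y).re) x = (conjLaplacianC h ψ f x).re := by
  have e1 : (2 * (h : ℂ) * ∑ k, ((partialDeriv k ψ x : ℝ) : ℂ) * partialDeriv k f x).re
      = 2 * h * ∑ k, partialDeriv k ψ x * (partialDeriv k f x).re := by
    rw [show (2 * (h : ℂ)) = ((2 * h : ℝ) : ℂ) by push_cast; ring, Complex.re_ofReal_mul,
      Complex.re_sum]
    simp only [Complex.re_ofReal_mul]
  simp only [conjLaplacianC, conjLaplacian, symPart, skewPart, lap_re hf, Complex.add_re, e1]
  rw [show (-(h : ℂ) ^ 2) = ((-h ^ 2 : ℝ) : ℂ) by push_cast; ring, Complex.re_ofReal_mul,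
    Complex.re_ofReal_mul]
  simp only [grdDot, partialDeriv_re hf]
  ring

lemma conjLaplacian_im (h : ℝ) (ψ : Rn n → ℝ) (hf : ContDiff ℝ ∞ f) (x : Rn n) :
    conjLaplacian h ψ (fun y => (f y).im) x = (conjLaplacianC h ψ f x).im := by
  have e1 : (2 * (h : ℂ) * ∑ k, ((partialDeriv k ψ x : ℝ) : ℂ) * partialDeriv k f x).im
      = 2 * h * ∑ k, partialDeriv k ψ x * (partialDeriv k f x).im := by
    rw [show (2 * (h : ℂ)) = ((2 * h : ℝ) : ℂ) by push_cast; ring, Complex.im_ofReal_mul,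
      Complex.im_sum]
    simp only [Complex.im_ofReal_mul]
  simp only [conjLaplacianC, conjLaplacian, symPart, skewPart, lap_im hf, Complex.add_im, e1]
  rw [show (-(h : ℂ) ^ 2) = ((-h ^ 2 : ℝ) : ℂ) by push_cast; ring, Complex.im_ofReal_mul,
    Complex.im_ofReal_mul]
  simp only [grdDot, partialDeriv_im hf]
  ring

lemma energyDensity_eq (h : ℝ) (hf : ContDiff ℝ ∞ f) (x : Rn n) :
    energyDensity h f x
      = ((f x).re ^ 2 + h ^ 2 * grdDot (fun y => (f y).re) (fun y => (f y).re) x)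
        + ((f x).im ^ 2 + h ^ 2 * grdDot (fun y => (f y).im) (fun y => (f y).im) x) := by
  have e (z : ℂ) : ‖z‖ ^ 2 = z.re * z.re + z.im * z.im := by
    rw [← Complex.normSq_eq_norm_sq, Complex.normSq_apply]
  simp only [energyDensity, grdDot, partialDeriv_re hf, partialDeriv_im hf, e,
    Finset.sum_add_distrib]
  ring

lemma contDiff_conjLaplacianC (h : ℝ) {ψ : Rn n → ℝ} (hψ : ContDiff ℝ ∞ ψ)
    (hf : ContDiff ℝ ∞ f) : ContDiff ℝ ∞ (conjLaplacianC h ψ f) := by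
  refine ((contDiff_const.mul (ContDiff.sum fun k _ =>
    contDiff_partialDeriv (contDiff_partialDeriv hf k) k)).add (contDiff_const.mul
      (ContDiff.sum fun k _ => (Complex.ofRealCLM.contDiff.comp
        (contDiff_partialDeriv hψ k)).mul (contDiff_partialDeriv hf k)))).add
    ((Complex.ofRealCLM.contDiff.comp ((contDiff_const.mul (contDiff_lap hψ)).sub
      (contDiff_grdDot hψ hψ))).mul hf)

lemma hasCompactSupport_conjLaplacianC (h : ℝ) (ψ : Rn n → ℝ) (hf : HasCompactSupport f) :
    HasCompactSupport (conjLaplacianC h ψ f) := by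
  refine HasCompactSupport.intro hf.isCompact fun x hx => ?_
  have h1 (k : Fin n) : partialDeriv k f x = 0 :=
    image_eq_zero_of_notMem_tsupport fun h' => hx (tsupport_partialDeriv_subset f k h')
  have h2 (k : Fin n) : partialDeriv k (partialDeriv k f) x = 0 :=
    image_eq_zero_of_notMem_tsupport fun h' =>
      hx (tsupport_partialDeriv_subset f k (tsupport_partialDeriv_subset _ k h'))
  simp [conjLaplacianC, h1, h2, image_eq_zero_of_notMem_tsupport hx]

end ReIm

section Schwartz

open LineDeriv

lemma partialDeriv_schwartz (f : 𝓢(Rn n, ℂ)) (k : Fin n) :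
    partialDeriv k f = ⇑(∂_{EuclideanSpace.single k (1 : ℝ)} f : 𝓢(Rn n, ℂ)) :=
  funext fun x => (SchwartzMap.lineDerivOp_apply_eq_fderiv _ f x).symm

lemma integrable_norm_sq_schwartz (f : 𝓢(Rn n, ℂ)) : Integrable fun x => ‖f x‖ ^ 2 := by
  simpa using (f.memLp 2).integrable_norm_pow (by simp)

lemma integrable_energyDensity (h : ℝ) (f : 𝓢(Rn n, ℂ)) : Integrable (energyDensity h f) := by
  refine (integrable_norm_sq_schwartz f).add (Integrable.const_mul
    (integrable_finsetSum _ fun k _ => ?_) _)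
  rw [partialDeriv_schwartz]
  exact integrable_norm_sq_schwartz _

/-- Carleman estimate with a loss of two derivatives for complex valued functions. -/
theorem carleman_shift_complex {φ ρ χ : Rn n → ℝ} {V : Set (Rn n)} (H : IsWeightOn φ ρ V)
    (hχ : ContDiff ℝ ∞ χ) (hχc : HasCompactSupport χ) (hχV : tsupport χ ⊆ V) :
    ∃ M : ℝ, 1 ≤ M ∧ ∀ h τ : ℝ, 0 < h → 0 < τ → τ ≤ 1 / M → h ≤ τ / M →
      ∀ w : 𝓢(Rn n, ℂ), HasCompactSupport w → (∀ x ∈ tsupport w, χ x = 1) →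
      ∀ g : 𝓢(Rn n, ℂ),
        (∀ x, g x - (h : ℂ) ^ 2 * ∑ k, partialDeriv k (partialDeriv k g) x
          = conjLaplacianC h (convexified φ τ) w x) →
        h * τ * sclEnergy h w ≤ M * sclEnergy h g := by
  obtain ⟨M, hM, hmain⟩ := carleman_shift H hχ hχc hχV
  refine ⟨M, hM, fun h τ hh hτ hτ1 hhτ w hwc hχw g hgw => ?_⟩
  have sw : ContDiff ℝ ∞ w := w.smooth'
  have sg : ContDiff ℝ ∞ g := g.smooth'
  have key {f : 𝓢(Rn n, ℂ)} (sf : ContDiff ℝ ∞ f) :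
      (Integrable fun x => (f x).re ^ 2 + h ^ 2 * grdDot (fun y => (f y).re)
        (fun y => (f y).re) x) ∧
      (Integrable fun x => (f x).im ^ 2 + h ^ 2 * grdDot (fun y => (f y).im)
        (fun y => (f y).im) x) := by
    have p (u : Rn n → ℝ) (x : Rn n) : 0 ≤ u x ^ 2 + h ^ 2 * grdDot u u x :=
      add_nonneg (sq_nonneg _) (mul_nonneg (sq_nonneg _) (grdDot_self_nonneg u x))
    have c {u : Rn n → ℝ} (hu : ContDiff ℝ ∞ u) :
        AEStronglyMeasurable (fun x => u x ^ 2 + h ^ 2 * grdDot u u x) volume :=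
      ((hu.pow 2).add (contDiff_const.mul
        (contDiff_grdDot hu hu))).continuous.aestronglyMeasurable
    constructor
    · refine (integrable_energyDensity h f).mono' (c (contDiff_re sf)) (.of_forall fun x => ?_)
      rw [Real.norm_of_nonneg (p (fun y => (f y).re) x), energyDensity_eq h sf]
      linarith [p (fun y => (f y).im) x]
    · refine (integrable_energyDensity h f).mono' (c (contDiff_im sf)) (.of_forall fun x => ?_)
      rw [Real.norm_of_nonneg (p (fun y => (f y).im) x), energyDensity_eq h sf]
      linarith [p (fun y => (f y).re) x]
  -- The operator has real coefficients, so real and imaginary parts satisfy the estimate separately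
  -- and the energies add.
  have r1 := hmain h τ hh hτ hτ1 hhτ (fun y => (w y).re) (contDiff_re sw)
    (hwc.comp_left (g := Complex.re) rfl)
    (fun x hx => hχw x (closure_mono (Function.support_comp_subset (g := Complex.re) rfl w) hx))
    (fun y => (g y).re) (contDiff_re sg) (fun x => by
      rw [conjLaplacian_re h _ sw, ← hgw x, lap_re sg, Complex.sub_re,
        show ((h : ℂ) ^ 2) = ((h ^ 2 : ℝ) : ℂ) by push_cast; ring, Complex.re_ofReal_mul])
    (key sg).1
  have r2 := hmain h τ hh hτ hτ1 hhτ (fun y => (w y).im) (contDiff_im sw)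
    (hwc.comp_left (g := Complex.im) rfl)
    (fun x hx => hχw x (closure_mono (Function.support_comp_subset (g := Complex.im) rfl w) hx))
    (fun y => (g y).im) (contDiff_im sg) (fun x => by
      rw [conjLaplacian_im h _ sw, ← hgw x, lap_im sg, Complex.sub_im,
        show ((h : ℂ) ^ 2) = ((h ^ 2 : ℝ) : ℂ) by push_cast; ring, Complex.im_ofReal_mul])
    (key sg).2
  simp only [sclEnergy, energyDensity_eq h sw, energyDensity_eq h sg]
  rw [integral_add (key sw).1 (key sw).2, integral_add (key sg).1 (key sg).2]
  linarith

end Schwartz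

/-! ### Multiplication by bounded smooth functions -/

lemma energyDensity_mul_le {M h : ℝ} (hh : 0 ≤ h) (hh1 : h ≤ 1) {E : Rn n → ℝ}
    {f : Rn n → ℂ} (hE : ContDiff ℝ ∞ E) (hf : ContDiff ℝ ∞ f) {x : Rn n} (hE2 : E x ^ 2 ≤ M)
    (hE' : grdDot E E x ≤ M) :
    energyDensity h (fun y => (E y : ℂ) * f y) x ≤ 3 * M * energyDensity h f x := by
  have hh2 : h ^ 2 ≤ 1 := pow_le_one₀ hh hh1
  have hEC := contDiff_ofReal hE
  have h1 : ∑ k, ‖partialDeriv k (fun y => (E y : ℂ) * f y) x‖ ^ 2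
      ≤ 2 * E x ^ 2 * (∑ k, ‖partialDeriv k f x‖ ^ 2) + 2 * ‖f x‖ ^ 2 * grdDot E E x := by
    simp only [grdDot, Finset.mul_sum, ← Finset.sum_add_distrib]
    refine Finset.sum_le_sum fun k _ => ?_
    rw [partialDeriv_mul (ContDiff.differentiableAt_infty hEC x)
      (ContDiff.differentiableAt_infty hf x),
      partialDeriv_ofReal hE]
    have e1 : ‖((partialDeriv k E x : ℝ) : ℂ) * f x‖ = |partialDeriv k E x| * ‖f x‖ := by
      simp
    have e2 : ‖(E x : ℂ) * partialDeriv k f x‖ = |E x| * ‖partialDeriv k f x‖ := by simp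
    have t := norm_add_le (((partialDeriv k E x : ℝ) : ℂ) * f x)
      ((E x : ℂ) * partialDeriv k f x)
    rw [e1, e2] at t
    have t2 := pow_le_pow_left₀ (norm_nonneg _) t 2
    have s1 := sq_abs (E x)
    have s2 := sq_abs (partialDeriv k E x)
    refine t2.trans ?_
    have q1 : (|partialDeriv k E x| * ‖f x‖) ^ 2
        = ‖f x‖ ^ 2 * (partialDeriv k E x * partialDeriv k E x) := by rw [mul_pow, s2]; ring
    have q2 : (|E x| * ‖partialDeriv k f x‖) ^ 2 = E x ^ 2 * ‖partialDeriv k f x‖ ^ 2 := by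
      rw [mul_pow, s1]
    linarith [sq_nonneg (|partialDeriv k E x| * ‖f x‖ - |E x| * ‖partialDeriv k f x‖)]
  have hM : 0 ≤ M := (sq_nonneg _).trans hE2
  obtain ⟨N, hN⟩ : ∃ N, N = ∑ k, ‖partialDeriv k f x‖ ^ 2 := ⟨_, rfl⟩
  have hN0 : 0 ≤ N := hN ▸ Finset.sum_nonneg fun _ _ => sq_nonneg _
  have h2 : ‖(E x : ℂ) * f x‖ ^ 2 = E x ^ 2 * ‖f x‖ ^ 2 := by simp [mul_pow]
  simp only [energyDensity, h2, ← hN] at h1 ⊢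
  have a1 := mul_le_mul_of_nonneg_right hE2 (sq_nonneg ‖f x‖)
  have a2 := mul_le_mul_of_nonneg_right hE2 (by positivity : 0 ≤ h ^ 2 * N)
  have a3 := mul_le_mul_of_nonneg_left h1 (sq_nonneg h)
  have a4 : h ^ 2 * (‖f x‖ ^ 2 * grdDot E E x) ≤ M * ‖f x‖ ^ 2 := by
    calc h ^ 2 * (‖f x‖ ^ 2 * grdDot E E x) ≤ h ^ 2 * (‖f x‖ ^ 2 * M) := by gcongr
      _ ≤ 1 * (‖f x‖ ^ 2 * M) := by gcongr
      _ = _ := by ring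
  have a5 : 0 ≤ M * (h ^ 2 * N) := by positivity
  linarith

/-- Cauchy-Schwarz for square roots of nonnegative integrable functions. -/
lemma integral_sqrt_mul_sqrt_le {f g : Rn n → ℝ} (hf0 : ∀ x, 0 ≤ f x) (hg0 : ∀ x, 0 ≤ g x)
    (hf : Integrable f) (hg : Integrable g) :
    (Integrable fun x => √(f x) * √(g x)) ∧
    ∫ x, √(f x) * √(g x) ≤ √(∫ x, f x) * √(∫ x, g x) := by
  have mf : MemLp (fun x => √(f x)) 2 volume := by
    rw [memLp_two_iff_integrable_sq
      (Real.continuous_sqrt.comp_aestronglyMeasurable hf.aestronglyMeasurable)]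
    exact hf.congr (.of_forall fun x => (Real.sq_sqrt (hf0 x)).symm)
  have mg : MemLp (fun x => √(g x)) 2 volume := by
    rw [memLp_two_iff_integrable_sq
      (Real.continuous_sqrt.comp_aestronglyMeasurable hg.aestronglyMeasurable)]
    exact hg.congr (.of_forall fun x => (Real.sq_sqrt (hg0 x)).symm)
  refine ⟨mf.integrable_mul mg, ?_⟩
  have := integral_mul_le_Lp_mul_Lq_of_nonneg (μ := volume) Real.HolderConjugate.two_two
    (.of_forall fun x => Real.sqrt_nonneg (f x)) (.of_forall fun x => Real.sqrt_nonneg (g x))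
    (by simpa using mf) (by simpa using mg)
  simpa only [Real.rpow_two, Real.sq_sqrt (hf0 _), Real.sq_sqrt (hg0 _), ← Real.sqrt_eq_rpow]
    using this

/-! ### Semiclassical Bessel multipliers -/

open FourierTransform LineDeriv

/-- The symbol `⟨2πhξ⟩^s`. -/
def besselSymbol (h s : ℝ) (ξ : Rn n) : ℝ := (1 + ‖(2 * Real.pi * h) • ξ‖ ^ 2) ^ (s / 2)

lemma besselSymbol_hasTemperateGrowth (h s : ℝ) :
    (besselSymbol (n := n) h s).HasTemperateGrowth := by
  have h1 := Function.hasTemperateGrowth_one_add_norm_sq_rpow (Rn n) (s / 2)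
  have h2 : Function.HasTemperateGrowth fun ξ : Rn n => (2 * Real.pi * h) • ξ :=
    ((2 * Real.pi * h) • ContinuousLinearMap.id ℝ (Rn n)).hasTemperateGrowth
  exact h1.comp h2

lemma besselSymbol_ofReal_hasTemperateGrowth (h s : ℝ) :
    (fun ξ : Rn n => ((besselSymbol h s ξ : ℝ) : ℂ)).HasTemperateGrowth :=
  Function.HasTemperateGrowth.comp Complex.ofRealCLM.hasTemperateGrowth (besselSymbol_hasTemperateGrowth h s)

lemma besselSymbol_base_pos (h : ℝ) (ξ : Rn n) : 0 < 1 + ‖(2 * Real.pi * h) • ξ‖ ^ 2 := by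
  positivity

lemma besselSymbol_mul (h s t : ℝ) (ξ : Rn n) :
    besselSymbol h s ξ * besselSymbol h t ξ = besselSymbol h (s + t) ξ := by
  unfold besselSymbol
  rw [← Real.rpow_add (besselSymbol_base_pos h ξ), add_div]

lemma besselSymbol_zero (h : ℝ) (ξ : Rn n) : besselSymbol h 0 ξ = 1 := by
  simp [besselSymbol]

lemma besselSymbol_two (h : ℝ) (ξ : Rn n) :
    besselSymbol h 2 ξ = 1 + (2 * Real.pi * h) ^ 2 * ‖ξ‖ ^ 2 := by
  rw [besselSymbol, div_self two_ne_zero, Real.rpow_one, norm_smul, mul_pow, Real.norm_eq_abs,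
    sq_abs]

lemma besselSymbol_one_sq (h : ℝ) (ξ : Rn n) :
    besselSymbol h 1 ξ ^ 2 = 1 + (2 * Real.pi * h) ^ 2 * ‖ξ‖ ^ 2 := by
  rw [sq, besselSymbol_mul, one_add_one_eq_two, besselSymbol_two]

lemma semiclassicalBessel_eq (h s : ℝ) : semiclassicalBessel (n := n) h s
    = TemperedDistribution.fourierMultiplierCLM ℂ
      (fun ξ : Rn n => ((besselSymbol h s ξ : ℝ) : ℂ)) := rfl

lemma semiclassicalBessel_comp (h s t : ℝ) (T : 𝓢'(Rn n, ℂ)) :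
    semiclassicalBessel h t (semiclassicalBessel h s T) = semiclassicalBessel h (s + t) T := by
  rw [semiclassicalBessel_eq, semiclassicalBessel_eq, semiclassicalBessel_eq,
    TemperedDistribution.fourierMultiplierCLM_fourierMultiplierCLM_apply
      (besselSymbol_ofReal_hasTemperateGrowth h s) (besselSymbol_ofReal_hasTemperateGrowth h t)]
  congr 2
  ext ξ
  simp only [Pi.mul_apply, ← besselSymbol_mul]
  push_cast
  rfl

lemma semiclassicalBessel_zero (h : ℝ) (T : 𝓢'(Rn n, ℂ)) : semiclassicalBessel h 0 T = T := by
  rw [semiclassicalBessel_eq]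
  simp [besselSymbol_zero]

lemma sum_partialDeriv_partialDeriv_schwartz (f : 𝓢(Rn n, ℂ)) (x : Rn n) :
    ∑ k, partialDeriv k (partialDeriv k f) x = (Laplacian.laplacian f : 𝓢(Rn n, ℂ)) x := by
  rw [SchwartzMap.laplacian_eq_sum (EuclideanSpace.basisFun (Fin n) ℝ) f, sum_apply]
  refine Finset.sum_congr rfl fun k _ => ?_
  rw [partialDeriv_schwartz, partialDeriv_schwartz]
  simp

lemma fourierMultiplierCLM_add {g₁ g₂ : Rn n → ℝ} (h₁ : g₁.HasTemperateGrowth)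
    (h₂ : g₂.HasTemperateGrowth) (f : 𝓢(Rn n, ℂ)) :
    SchwartzMap.fourierMultiplierCLM ℂ (g₁ + g₂) f
      = SchwartzMap.fourierMultiplierCLM ℂ g₁ f + SchwartzMap.fourierMultiplierCLM ℂ g₂ f := by
  simp only [SchwartzMap.fourierMultiplierCLM_apply, SchwartzMap.smulLeftCLM_add h₁ h₂, add_apply,
    FourierTransform.fourierInv_add]

/-- The equation `g - h² Δ g = f` is solvable in the Schwartz space. -/
lemma exists_schwartz_resolvent (h : ℝ) (f : 𝓢(Rn n, ℂ)) :
    ∃ g : 𝓢(Rn n, ℂ), ∀ x, g x - (h : ℂ) ^ 2 * ∑ k, partialDeriv k (partialDeriv k g) x = f x := by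
  have t2 := besselSymbol_hasTemperateGrowth (n := n) h (-2)
  have tn : Function.HasTemperateGrowth (fun ξ : Rn n => ‖ξ‖ ^ 2) := by fun_prop
  have tc : Function.HasTemperateGrowth (fun _ : Rn n => (1 : ℝ)) := by fun_prop
  have tm : Function.HasTemperateGrowth ((2 * Real.pi * h) ^ 2 • fun ξ : Rn n => ‖ξ‖ ^ 2) :=
    (Function.HasTemperateGrowth.const ((2 * Real.pi * h) ^ 2)).mul tn
  refine ⟨SchwartzMap.fourierMultiplierCLM ℂ (besselSymbol h (-2)) f, fun x => ?_⟩
  have e1 : SchwartzMap.fourierMultiplierCLM ℂ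
      ((fun _ : Rn n => (1 : ℝ)) + (2 * Real.pi * h) ^ 2 • fun ξ : Rn n => ‖ξ‖ ^ 2)
      (SchwartzMap.fourierMultiplierCLM ℂ (besselSymbol h (-2)) f) = f := by
    rw [SchwartzMap.fourierMultiplierCLM_fourierMultiplierCLM_apply (tc.add tm) t2]
    have : ((fun _ : Rn n => (1 : ℝ)) + (2 * Real.pi * h) ^ 2 • fun ξ : Rn n => ‖ξ‖ ^ 2)
        * besselSymbol h (-2) = fun _ => (1 : ℝ) := by
      ext ξ
      have := besselSymbol_mul h 2 (-2) ξ
      rw [besselSymbol_two, add_neg_cancel, besselSymbol_zero] at this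
      simpa using this
    rw [this]
    simp
  rw [fourierMultiplierCLM_add tc tm, SchwartzMap.fourierMultiplierCLM_smul tn] at e1
  have e2 := congrArg (fun F : 𝓢(Rn n, ℂ) => F x) e1
  simp only [SchwartzMap.fourierMultiplierCLM_const, add_apply, smul_apply, one_smul,
    ContinuousLinearMap.id_apply] at e2
  rw [sum_partialDeriv_partialDeriv_schwartz, SchwartzMap.laplacian_eq_fourierMultiplierCLM,
    smul_apply, ← e2, show ((‖·‖ ^ 2 : Rn n → ℝ)) = fun ξ : Rn n => ‖ξ‖ ^ 2 from rfl]
  simp only [Complex.real_smul]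
  push_cast
  ring_nf

lemma smulLeftCLM_inner_single (k : Fin n) (f : 𝓢(Rn n, ℂ)) (ξ : Rn n) :
    SchwartzMap.smulLeftCLM ℂ (inner ℝ · (EuclideanSpace.single k (1 : ℝ))) f ξ
      = (ξ k : ℝ) • f ξ := by
  have : (inner ℝ · (EuclideanSpace.single k (1 : ℝ)) : Rn n → ℝ).HasTemperateGrowth := by
    fun_prop
  rw [SchwartzMap.smulLeftCLM_apply_apply this]
  simp [EuclideanSpace.inner_single_right]

/-- Plancherel for `f` and each of its partial derivatives. It identifies the energy with the square
of the `H¹` norm. -/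
lemma sclEnergy_eq_fourier (h : ℝ) (f : 𝓢(Rn n, ℂ)) :
    sclEnergy h f = ∫ ξ, besselSymbol h 1 ξ ^ 2 * ‖𝓕 f ξ‖ ^ 2 := by
  have h1 (k : Fin n) : ∫ x, ‖partialDeriv k f x‖ ^ 2
      = ∫ ξ, (2 * Real.pi) ^ 2 * (ξ k ^ 2 * ‖𝓕 f ξ‖ ^ 2) := by
    rw [partialDeriv_schwartz, ← SchwartzMap.integral_norm_sq_fourier]
    refine integral_congr_ae (.of_forall fun ξ => ?_)
    simp only [SchwartzMap.fourier_lineDerivOp_eq, smul_apply, smulLeftCLM_inner_single]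
    simp [mul_pow]
  have i1 (k : Fin n) : Integrable fun ξ : Rn n => ξ k ^ 2 * ‖𝓕 f ξ‖ ^ 2 := by
    refine (integrable_norm_sq_schwartz (SchwartzMap.smulLeftCLM ℂ
      (inner ℝ · (EuclideanSpace.single k (1 : ℝ))) (𝓕 f))).congr (.of_forall fun ξ => ?_)
    simp only [smulLeftCLM_inner_single]
    simp [mul_pow]
  have i2 (k : Fin n) : Integrable fun x => ‖partialDeriv k f x‖ ^ 2 := by
    rw [partialDeriv_schwartz]; exact integrable_norm_sq_schwartz _
  have e (ξ : Rn n) : besselSymbol h 1 ξ ^ 2 * ‖𝓕 f ξ‖ ^ 2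
      = ‖𝓕 f ξ‖ ^ 2 + h ^ 2 * ∑ k, (2 * Real.pi) ^ 2 * (ξ k ^ 2 * ‖𝓕 f ξ‖ ^ 2) := by
    rw [besselSymbol_one_sq, EuclideanSpace.norm_sq_eq, ← Finset.mul_sum, ← Finset.sum_mul]
    simp only [Real.norm_eq_abs, sq_abs]
    ring
  simp only [e, sclEnergy, energyDensity]
  rw [integral_add (integrable_norm_sq_schwartz f)
      ((integrable_finsetSum _ fun k _ => i2 k).const_mul _),
    integral_add (integrable_norm_sq_schwartz (𝓕 f))
      ((integrable_finsetSum _ fun k _ => (i1 k).const_mul _).const_mul _),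
    integral_const_mul, integral_const_mul, integral_finsetSum _ fun k _ => i2 k,
    integral_finsetSum _ fun k _ => (i1 k).const_mul _, SchwartzMap.integral_norm_sq_fourier]
  simp only [h1]

lemma norm_Lp_two_eq (f : Lp ℂ 2 (volume : Measure (Rn n))) : ‖f‖ = √(∫ x, ‖f x‖ ^ 2) := by
  have h2 : (inner ℂ f f : ℂ) = ((∫ x, ‖f x‖ ^ 2 : ℝ) : ℂ) := by
    rw [L2.inner_def, ← integral_complex_ofReal]
    exact integral_congr_ae (.of_forall fun x => by simp [inner_self_eq_norm_sq_to_K])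
  rw [inner_self_eq_norm_sq_to_K] at h2
  have h3 : ‖f‖ ^ 2 = ∫ x, ‖f x‖ ^ 2 :=
    Complex.ofReal_injective (by rw [← h2]; push_cast; rfl)
  rw [← h3, Real.sqrt_sq (norm_nonneg f)]

lemma norm_toLp_two_eq (F : 𝓢(Rn n, ℂ)) : ‖F.toLp 2‖ = √(∫ x, ‖F x‖ ^ 2) := by
  rw [norm_Lp_two_eq]
  congr 1
  refine integral_congr_ae ?_
  filter_upwards [F.coeFn_toLp 2 volume] with x hx
  rw [hx]

lemma norm_sq_smulLeftCLM_besselSymbol (h : ℝ) (f : 𝓢(Rn n, ℂ)) (ξ : Rn n) :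
    ‖SchwartzMap.smulLeftCLM ℂ (fun ξ : Rn n => ((besselSymbol h 1 ξ : ℝ) : ℂ)) f ξ‖ ^ 2
      = besselSymbol h 1 ξ ^ 2 * ‖f ξ‖ ^ 2 := by
  rw [SchwartzMap.smulLeftCLM_apply_apply (besselSymbol_ofReal_hasTemperateGrowth h 1)]
  simp [mul_pow]

lemma semiclassicalNorm_one_le (h : ℝ) (u : 𝓢(Rn n, ℂ)) :
    semiclassicalNorm h 1 (u : 𝓢'(Rn n, ℂ)) ≤ ENNReal.ofReal √(sclEnergy h u) := by
  set F := SchwartzMap.fourierMultiplierCLM ℂ (fun ξ : Rn n => ((besselSymbol h 1 ξ : ℝ) : ℂ)) u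
    with hF
  refine le_trans (iInf₂_le (F.toLp 2 volume) ?_) (le_of_eq ?_)
  · rw [semiclassicalBessel_eq, Lp.toTemperedDistribution_toLp_eq,
      TemperedDistribution.fourierMultiplierCLM_toTemperedDistributionCLM_eq
        (besselSymbol_ofReal_hasTemperateGrowth h 1)]
  · rw [← ofReal_norm, norm_toLp_two_eq, sclEnergy_eq_fourier,
      ← SchwartzMap.integral_norm_sq_fourier]
    simp only [hF, SchwartzMap.fourierMultiplierCLM_apply, FourierTransform.fourier_fourierInv_eq,
      norm_sq_smulLeftCLM_besselSymbol]

/-- Functions in `L²` act on the image of a test function under `⟨hD⟩` as elements of `H⁻¹`. -/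
lemma norm_apply_le_of_semiclassicalBessel_eq {h : ℝ} {T : 𝓢'(Rn n, ℂ)}
    {f : Lp ℂ 2 (volume : Measure (Rn n))}
    (hf : semiclassicalBessel h (-1) T = (f : 𝓢'(Rn n, ℂ))) (θ : 𝓢(Rn n, ℂ)) :
    ‖T θ‖ ≤ ‖f‖ * √(sclEnergy h θ) := by
  have h1 : T = semiclassicalBessel h 1 (f : 𝓢'(Rn n, ℂ)) := by
    rw [← hf, semiclassicalBessel_comp, neg_add_cancel, semiclassicalBessel_zero]
  set G := SchwartzMap.smulLeftCLM ℂ (fun ξ : Rn n => ((besselSymbol h 1 ξ : ℝ) : ℂ)) (𝓕⁻ θ)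
    with hG
  have h2 : T θ = ∫ x, (𝓕 G) x • f x := by
    rw [h1, semiclassicalBessel_eq, TemperedDistribution.fourierMultiplierCLM_apply_apply,
      Lp.toTemperedDistribution_apply]
  have h3 : ∫ x, ‖(𝓕 G) x‖ ^ 2 = sclEnergy h θ := by
    -- The transform and its inverse differ by the reflection `ξ ↦ -ξ`, under which the symbol is
    -- invariant.
    rw [SchwartzMap.integral_norm_sq_fourier, sclEnergy_eq_fourier, ← integral_neg_eq_self]
    refine integral_congr_ae (.of_forall fun ξ => ?_)
    simp only [hG, norm_sq_smulLeftCLM_besselSymbol]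
    congr 1
    · simp [besselSymbol]
    · rw [SchwartzMap.fourierInv_coe, SchwartzMap.fourier_coe, Real.fourierInv_eq_fourier_neg,
        neg_neg]
  have i1 := integrable_norm_sq_schwartz (𝓕 G)
  have i2 : Integrable fun x => ‖f x‖ ^ 2 := by
    simpa using (Lp.memLp f).integrable_norm_pow (by simp)
  have cs := integral_sqrt_mul_sqrt_le (fun x => sq_nonneg ‖(𝓕 G) x‖) (fun x => sq_nonneg ‖f x‖)
    i1 i2
  simp only [Real.sqrt_sq (norm_nonneg _)] at cs
  rw [h2, norm_Lp_two_eq, ← h3, mul_comm]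
  refine (norm_integral_le_integral_norm _).trans ?_
  simpa only [norm_smul] using cs.2

open TemperedDistribution in
-- For fixed `h` the ratio `⟨ξ⟩ / ⟨2πhξ⟩` is bounded by `1 + (2πh)⁻¹`, so the semiclassical and the
-- ordinary Bessel potentials define the same space.
lemma semiclassicalNorm_neg_one_lt_top {h : ℝ} (hh : 0 < h) {T : 𝓢'(Rn n, ℂ)}
    (hT : MemSobolev (-1) 2 T) : semiclassicalNorm h (-1) T < ⊤ := by
  have t1 := besselSymbol_ofReal_hasTemperateGrowth (n := n) h (-1)
  have t2 : Function.HasTemperateGrowth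
      (fun ξ : Rn n => (((1 + ‖ξ‖ ^ 2) ^ ((1 : ℝ) / 2) : ℝ) : ℂ)) := by fun_prop
  have h1 : semiclassicalBessel h (-1) T = fourierMultiplierCLM ℂ
      ((fun ξ : Rn n => (((1 + ‖ξ‖ ^ 2) ^ ((1 : ℝ) / 2) : ℝ) : ℂ))
        * fun ξ : Rn n => ((besselSymbol h (-1) ξ : ℝ) : ℂ)) (besselPotential (Rn n) ℂ (-1) T) := by
    have h2 : T = besselPotential (Rn n) ℂ 1 (besselPotential (Rn n) ℂ (-1) T) := by
      rw [besselPotential_besselPotential_apply]; simp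
    conv_lhs => rw [h2, semiclassicalBessel_eq]
    rw [← fourierMultiplierCLM_fourierMultiplierCLM_apply t2 t1]
    rfl
  have h3 : MemSobolev 0 2 (besselPotential (Rn n) ℂ (-1) T) := by
    rw [memSobolev_besselPotential_iff]; simpa using hT
  have h4 := h3.fourierMultiplierCLM_of_bounded (t2.mul t1) (by
    refine ⟨1 + (2 * Real.pi * h)⁻¹, fun ξ => ?_⟩
    have hc : 0 < 2 * Real.pi * h := by positivity
    rw [Pi.mul_apply, ← Complex.ofReal_mul, Complex.norm_real, Real.norm_of_nonneg (by
      unfold besselSymbol; positivity), besselSymbol, neg_div, Real.rpow_neg (by positivity),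
      ← div_eq_mul_inv, ← Real.sqrt_eq_rpow, ← Real.sqrt_eq_rpow, div_le_iff₀ (by positivity)]
    rw [norm_smul, Real.norm_of_nonneg hc.le]
    refine Real.sqrt_le_iff.2 ⟨by positivity, ?_⟩
    rw [mul_pow, Real.sq_sqrt (by positivity)]
    have e1 : (2 * Real.pi * h)⁻¹ * (2 * Real.pi * h) = 1 := inv_mul_cancel₀ hc.ne'
    have e2 : 1 ≤ (1 + (2 * Real.pi * h)⁻¹) ^ 2 := by
      have : 0 ≤ (2 * Real.pi * h)⁻¹ := by positivity
      exact one_le_pow₀ (by linarith)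
    have e3 : (2 * Real.pi * h)⁻¹ ^ 2 ≤ (1 + (2 * Real.pi * h)⁻¹) ^ 2 := by gcongr; linarith
    have e4 : ‖ξ‖ ^ 2 = (2 * Real.pi * h)⁻¹ ^ 2 * (2 * Real.pi * h * ‖ξ‖) ^ 2 := by
      rw [← mul_pow, ← mul_assoc, e1, one_mul]
    rw [mul_add, mul_one, e4]
    exact add_le_add e2 (by
      rw [← e4]
      calc ‖ξ‖ ^ 2 = (2 * Real.pi * h)⁻¹ ^ 2 * (2 * Real.pi * h * ‖ξ‖) ^ 2 := e4
        _ ≤ _ := by gcongr))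
  rw [← h1, memSobolev_zero_iff] at h4
  obtain ⟨f, hf⟩ := h4
  exact (iInf₂_le f hf).trans_lt enorm_lt_top

/-! ### The sesquilinear form of the conjugated operator -/

open LineDeriv

/-- The integrand of the form of the conjugated magnetic Schrödinger operator. -/
def formDensity (h : ℝ) (ψ : Rn n → ℝ) (A : Rn n → EuclideanSpace ℂ (Fin n)) (q w θ : Rn n → ℂ)
    (x : Rn n) : ℂ :=
  (∑ j, (h * D j w x + Complex.I * ((partialDeriv j ψ x : ℝ) : ℂ) * w x + h * A x j * w x)
      * (-(h * D j θ x) + Complex.I * ((partialDeriv j ψ x : ℝ) : ℂ) * θ x + h * A x j * θ x))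
    + h ^ 2 * q x * w x * θ x

lemma partialDeriv_cexp_ofReal {g : Rn n → ℝ} {x : Rn n} (hg : DifferentiableAt ℝ g x)
    (j : Fin n) : partialDeriv j (fun y => Complex.exp ((g y : ℝ) : ℂ)) x
      = Complex.exp ((g x : ℝ) : ℂ) * ((partialDeriv j g x : ℝ) : ℂ) := by
  have h1 : (fun y => Complex.exp ((g y : ℝ) : ℂ))
      = fun y => Complex.ofRealCLM (Real.exp (g y)) := by ext y; simp
  rw [h1, partialDeriv_clm_comp Complex.ofRealCLM hg.exp]
  simp [partialDeriv, fderiv_exp hg]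

lemma D_cexp_mul {g : Rn n → ℝ} {w : Rn n → ℂ} {x : Rn n} (hg : DifferentiableAt ℝ g x)
    (hw : DifferentiableAt ℝ w x) (j : Fin n) :
    D j (fun y => Complex.exp ((g y : ℝ) : ℂ) * w y) x = Complex.exp ((g x : ℝ) : ℂ)
      * (D j w x - Complex.I * ((partialDeriv j g x : ℝ) : ℂ) * w x) := by
  have he : DifferentiableAt ℝ (fun y => Complex.exp ((g y : ℝ) : ℂ)) x :=
    (Complex.ofRealCLM.differentiableAt.comp x hg).cexp
  simp only [D]
  rw [partialDeriv_mul he hw, partialDeriv_cexp_ofReal hg, Complex.inv_I]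
  ring

/-- Differentiating the exponentials turns `hD` into `hD + i∇ψ` on `w` and `-hD` into `-hD + i∇ψ` on
`θ`, and the exponentials cancel. Differentiability is required only in `Ω`, so the identity applies
to the given weight as well as to its global extension. -/
lemma conjugatedSchrodinger_eq {Ω : Set (Rn n)} (hΩ : MeasurableSet Ω) {ψ : Rn n → ℝ}
    (A : Rn n → EuclideanSpace ℂ (Fin n)) (q : Rn n → ℂ) {h : ℝ} (hh : h ≠ 0) {w θ : Rn n → ℂ}
    (hψ : ∀ x ∈ Ω, DifferentiableAt ℝ ψ x) (hw : ∀ x ∈ Ω, DifferentiableAt ℝ w x)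
    (hθ : ∀ x ∈ Ω, DifferentiableAt ℝ θ x) :
    conjugatedSchrodinger Ω ψ A q h w θ = ∫ x in Ω, formDensity h ψ A q w θ x := by
  simp only [conjugatedSchrodinger, mulDistribution, magneticSchrodinger]
  rw [← integral_const_mul]
  refine setIntegral_congr_fun hΩ fun x hx => ?_
  have d1 : DifferentiableAt ℝ (fun y => ψ y / h) x := by
    simpa [div_eq_mul_inv] using (hψ x hx).mul_const h⁻¹
  have d2 : DifferentiableAt ℝ (fun y => -(ψ y / h)) x := d1.neg
  have p1 (j : Fin n) : partialDeriv j (fun y => ψ y / h) x = partialDeriv j ψ x / h := by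
    simp only [div_eq_inv_mul]
    exact partialDeriv_const_mul (hψ x hx) _ j
  have p2 (j : Fin n) : partialDeriv j (fun y => -(ψ y / h)) x = -(partialDeriv j ψ x / h) := by
    rw [← p1, ← neg_one_mul, ← partialDeriv_const_mul d1]
    simp
  have hhC : (h : ℂ) ≠ 0 := by exact_mod_cast hh
  have hexp : Complex.exp ((-(ψ x / h) : ℝ) : ℂ) * Complex.exp ((ψ x / h : ℝ) : ℂ) = 1 := by
    rw [← Complex.exp_add]; simp
  simp only [D_cexp_mul d1 (hθ x hx), D_cexp_mul d2 (hw x hx), p1, p2, formDensity, mul_add,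
    Finset.mul_sum]
  congr 1
  · refine Finset.sum_congr rfl fun j _ => ?_
    obtain ⟨a, ha⟩ : ∃ a, a = Complex.exp ((-(ψ x / h) : ℝ) : ℂ) := ⟨_, rfl⟩
    obtain ⟨b, hb⟩ : ∃ b, b = Complex.exp ((ψ x / h : ℝ) : ℂ) := ⟨_, rfl⟩
    rw [← ha, ← hb] at hexp ⊢
    have e1 (c : ℂ) : (h : ℂ) * (c / h) = c := by field_simp
    push_cast
    have key : (h : ℂ) ^ 2 * ((a * D j w x - a * (Complex.I * -(((partialDeriv j ψ x : ℝ) : ℂ) / h)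
        * w x) + A x j * (a * w x)) * (-(b * D j θ x - b * (Complex.I
        * (((partialDeriv j ψ x : ℝ) : ℂ) / h) * θ x)) + A x j * (b * θ x)))
      = (a * b) * ((h * D j w x + Complex.I * (h * (((partialDeriv j ψ x : ℝ) : ℂ) / h)) * w x
        + h * A x j * w x) * (-(h * D j θ x)
          + Complex.I * (h * (((partialDeriv j ψ x : ℝ) : ℂ) / h)) * θ x + h * A x j * θ x)) := by
      ring
    rw [hexp, one_mul, e1] at key
    linear_combination key
  · linear_combination ((h : ℂ) ^ 2 * q x * w x * θ x) * hexp

/-! ### Integration by parts -/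

/-- The form of the conjugated Laplacian. -/
lemma integral_formDensity_zero {Ω : Set (Rn n)} (h : ℝ) {ψ : Rn n → ℝ} (hψ : ContDiff ℝ ∞ ψ)
    {w θ : Rn n → ℂ} (hw : ContDiff ℝ ∞ w) (hwc : HasCompactSupport w) (hwΩ : tsupport w ⊆ Ω)
    (hθ : ContDiff ℝ ∞ θ) :
    ∫ x in Ω, formDensity h ψ 0 0 w θ x = ∫ x, conjLaplacianC h ψ w x * θ x := by
  have hz (x : Rn n) (hx : x ∉ Ω) : formDensity h ψ 0 0 w θ x = 0 := by
    have h1 : x ∉ tsupport w := fun h' => hx (hwΩ h')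
    have h2 (j : Fin n) : partialDeriv j w x = 0 :=
      image_eq_zero_of_notMem_tsupport fun h' => h1 (tsupport_partialDeriv_subset w j h')
    simp [formDensity, D, h2, image_eq_zero_of_notMem_tsupport h1]
  rw [setIntegral_eq_integral_of_forall_compl_eq_zero hz]
  have hψC (j : Fin n) : ContDiff ℝ ∞ fun y => ((partialDeriv j ψ y : ℝ) : ℂ) :=
    contDiff_ofReal (contDiff_partialDeriv hψ j)
  have s1 (j : Fin n) : ContDiff ℝ ∞ fun y => θ y * partialDeriv j w y :=
    hθ.mul (contDiff_partialDeriv hw j)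
  have s2 (j : Fin n) : ContDiff ℝ ∞ fun y => ((partialDeriv j ψ y : ℝ) : ℂ) * (w y * θ y) :=
    (hψC j).mul (hw.mul hθ)
  have c1 (j : Fin n) : HasCompactSupport fun y => θ y * partialDeriv j w y :=
    (HasCompactSupport.partialDeriv hwc j).mul_left
  have c2 (j : Fin n) : HasCompactSupport fun y => ((partialDeriv j ψ y : ℝ) : ℂ) * (w y * θ y) :=
    (hwc.mul_right (f' := θ)).mul_left
  have i1 (j : Fin n) : Integrable (partialDeriv j fun y => θ y * partialDeriv j w y) :=
    (contDiff_partialDeriv (s1 j) j).continuous.integrable_of_hasCompactSupport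
      (HasCompactSupport.partialDeriv (c1 j) j)
  have i2 (j : Fin n) : Integrable
      (partialDeriv j fun y => ((partialDeriv j ψ y : ℝ) : ℂ) * (w y * θ y)) :=
    (contDiff_partialDeriv (s2 j) j).continuous.integrable_of_hasCompactSupport
      (HasCompactSupport.partialDeriv (c2 j) j)
  have iP : Integrable fun x => conjLaplacianC h ψ w x * θ x :=
    ((contDiff_conjLaplacianC h hψ hw).mul hθ).continuous.integrable_of_hasCompactSupport
      (hasCompactSupport_conjLaplacianC h ψ hwc).mul_right
  have d1 (j : Fin n) (x : Rn n) : partialDeriv j (fun y => θ y * partialDeriv j w y) x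
      = partialDeriv j θ x * partialDeriv j w x
        + θ x * partialDeriv j (partialDeriv j w) x :=
    partialDeriv_mul (ContDiff.differentiableAt_infty hθ x)
      (ContDiff.differentiableAt_infty (contDiff_partialDeriv hw j) x) j
  have d2 (j : Fin n) (x : Rn n) :
      partialDeriv j (fun y => ((partialDeriv j ψ y : ℝ) : ℂ) * (w y * θ y)) x
      = ((partialDeriv j (partialDeriv j ψ) x : ℝ) : ℂ) * (w x * θ x)
        + ((partialDeriv j ψ x : ℝ) : ℂ)
          * (partialDeriv j w x * θ x + w x * partialDeriv j θ x) := by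
    rw [partialDeriv_mul (ContDiff.differentiableAt_infty (hψC j) x)
      (ContDiff.differentiableAt_infty (hw.mul hθ) x),
      partialDeriv_ofReal (contDiff_partialDeriv hψ j),
      partialDeriv_mul (ContDiff.differentiableAt_infty hw x)
        (ContDiff.differentiableAt_infty hθ x)]
  -- The two sides differ by the divergence of the compactly supported field `h² θ∇w - h wθ∇ψ`.
  have key (x : Rn n) : formDensity h ψ 0 0 w θ x = conjLaplacianC h ψ w x * θ x
      + ∑ j, ((h : ℂ) ^ 2 * partialDeriv j (fun y => θ y * partialDeriv j w y) x
        - h * partialDeriv j (fun y => ((partialDeriv j ψ y : ℝ) : ℂ) * (w y * θ y)) x) := by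
    simp only [d1, d2, formDensity, conjLaplacianC, D, lap, grdDot, Pi.zero_apply, mul_zero,
      zero_mul, add_zero, PiLp.zero_apply]
    push_cast
    simp only [Finset.mul_sum, sub_mul, add_mul, Finset.sum_mul, Finset.sum_sub_distrib,
      Finset.sum_add_distrib, mul_add]
    rw [← sub_eq_zero]
    simp only [← Finset.sum_add_distrib, ← Finset.sum_sub_distrib]
    refine Finset.sum_eq_zero fun j _ => ?_
    rw [Complex.inv_I]
    linear_combination (-(h : ℂ) ^ 2 * partialDeriv j w x * partialDeriv j θ x
      + h * ((partialDeriv j ψ x : ℝ) : ℂ) * (w x * partialDeriv j θ x - θ x * partialDeriv j w x)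
      + ((partialDeriv j ψ x : ℝ) : ℂ) ^ 2 * w x * θ x) * Complex.I_sq
  have i3 (j : Fin n) : Integrable fun x =>
      (h : ℂ) ^ 2 * partialDeriv j (fun y => θ y * partialDeriv j w y) x
        - h * partialDeriv j (fun y => ((partialDeriv j ψ y : ℝ) : ℂ) * (w y * θ y)) x :=
    ((i1 j).const_mul _).sub ((i2 j).const_mul _)
  simp only [key]
  rw [integral_add iP (integrable_finsetSum _ fun j _ => i3 j),
    integral_finsetSum _ fun j _ => i3 j]
  rw [Finset.sum_eq_zero, add_zero]
  intro j _
  rw [integral_sub ((i1 j).const_mul _) ((i2 j).const_mul _), integral_const_mul,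
    integral_const_mul, integral_partialDeriv_eq_zero (s1 j) (c1 j),
    integral_partialDeriv_eq_zero (s2 j) (c2 j)]
  simp

/-- The complex conjugate of a Schwartz function. -/
def conjSchwartz (g : 𝓢(Rn n, ℂ)) : 𝓢(Rn n, ℂ) :=
  SchwartzMap.postcompCLM (𝕜 := ℝ) (Complex.conjCLE : ℂ →L[ℝ] ℂ) g

lemma conjSchwartz_apply (g : 𝓢(Rn n, ℂ)) (x : Rn n) :
    conjSchwartz g x = (starRingEnd ℂ) (g x) := rfl

lemma partialDeriv_conjSchwartz (g : 𝓢(Rn n, ℂ)) (j : Fin n) (x : Rn n) :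
    partialDeriv j (conjSchwartz g) x = (starRingEnd ℂ) (partialDeriv j g x) :=
  partialDeriv_clm_comp (Complex.conjCLE : ℂ →L[ℝ] ℂ) g.differentiableAt j

lemma sclEnergy_conjSchwartz (h : ℝ) (g : 𝓢(Rn n, ℂ)) :
    sclEnergy h (conjSchwartz g) = sclEnergy h g := by
  simp only [sclEnergy, energyDensity, partialDeriv_conjSchwartz, conjSchwartz_apply,
    Complex.norm_conj]

/-- The pairing is bilinear, so the conjugate of `g` is the test function that produces the energy,
after one integration by parts. -/
lemma integral_resolvent_mul_conj (h : ℝ) (g : 𝓢(Rn n, ℂ)) :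
    ∫ x, (g x - (h : ℂ) ^ 2 * ∑ k, partialDeriv k (partialDeriv k g) x) * conjSchwartz g x
      = (sclEnergy h g : ℂ) := by
  have ns (z : ℂ) : z * (starRingEnd ℂ) z = ((‖z‖ ^ 2 : ℝ) : ℂ) := by
    rw [Complex.mul_conj, Complex.normSq_eq_norm_sq]
  have im (F G : 𝓢(Rn n, ℂ)) : Integrable fun x => F x * G x :=
    (F.memLp 2).integrable_mul (G.memLp 2)
  have i0 : Integrable fun x => g x * conjSchwartz g x := im _ _
  have i1 (k : Fin n) : Integrable fun x =>
      conjSchwartz g x * partialDeriv k (partialDeriv k g) x := by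
    rw [partialDeriv_schwartz, partialDeriv_schwartz]; exact im _ _
  have e1 (k : Fin n) : ∫ x, conjSchwartz g x * partialDeriv k (partialDeriv k g) x
      = -((∫ x, ‖partialDeriv k g x‖ ^ 2 : ℝ) : ℂ) := by
    rw [partialDeriv_schwartz, partialDeriv_schwartz,
      SchwartzMap.integral_mul_lineDerivOp_right_eq_neg_left, ← integral_complex_ofReal]
    congr 1
    refine integral_congr_ae (.of_forall fun x => ?_)
    simp only [← partialDeriv_schwartz, partialDeriv_conjSchwartz, ← ns]
    ring
  have i2 (k : Fin n) : Integrable fun x => ‖partialDeriv k g x‖ ^ 2 := by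
    rw [partialDeriv_schwartz]; exact integrable_norm_sq_schwartz _
  have e2 : sclEnergy h g
      = (∫ x, ‖g x‖ ^ 2) + h ^ 2 * ∑ k, ∫ x, ‖partialDeriv k g x‖ ^ 2 := by
    simp only [sclEnergy, energyDensity]
    rw [integral_add (integrable_norm_sq_schwartz g)
      ((integrable_finsetSum _ fun k _ => i2 k).const_mul _), integral_const_mul,
      integral_finsetSum _ fun k _ => i2 k]
  have e3 (x : Rn n) : (g x - (h : ℂ) ^ 2 * ∑ k, partialDeriv k (partialDeriv k g) x)
      * conjSchwartz g x = g x * conjSchwartz g x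
        - (h : ℂ) ^ 2 * ∑ k, conjSchwartz g x * partialDeriv k (partialDeriv k g) x := by
    rw [← Finset.mul_sum]; ring
  simp only [e3]
  rw [integral_sub i0 ((integrable_finsetSum _ fun k _ => i1 k).const_mul _), integral_const_mul,
    integral_finsetSum _ fun k _ => i1 k, e2]
  simp only [e1]
  simp only [conjSchwartz_apply, ns]
  rw [integral_complex_ofReal]
  push_cast
  simp

/-! ### The conjugated operator as a tempered distribution -/

section Form

open LineDeriv TemperedDistribution

variable {Ω : Set (Rn n)} {A : Rn n → EuclideanSpace ℂ (Fin n)} {q : Rn n → ℂ} {ψ : Rn n → ℝ}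

/-- The factor of `formDensity` that contains `w`. -/
def magneticDeriv (h : ℝ) (ψ : Rn n → ℝ) (A : Rn n → EuclideanSpace ℂ (Fin n)) (w : Rn n → ℂ)
    (j : Fin n) (x : Rn n) : ℂ :=
  h * D j w x + Complex.I * ((partialDeriv j ψ x : ℝ) : ℂ) * w x + h * A x j * w x

/-- The zeroth order coefficient of the test function in `formDensity`. -/
def magneticPotential (h : ℝ) (ψ : Rn n → ℝ) (A : Rn n → EuclideanSpace ℂ (Fin n))
    (q w : Rn n → ℂ) (x : Rn n) : ℂ :=
  (∑ j, magneticDeriv h ψ A w j x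
      * (Complex.I * ((partialDeriv j ψ x : ℝ) : ℂ) + h * A x j))
    + h ^ 2 * q x * w x

/-- Sorting by derivatives of `θ` shows an `L²` function plus derivatives of `L²` functions, hence
an element of `H⁻¹`. -/
lemma formDensity_eq (h : ℝ) (ψ : Rn n → ℝ) (A : Rn n → EuclideanSpace ℂ (Fin n))
    (q w θ : Rn n → ℂ) (x : Rn n) :
    formDensity h ψ A q w θ x = θ x * magneticPotential h ψ A q w x
      + ∑ j, h * Complex.I * (partialDeriv j θ x * magneticDeriv h ψ A w j x) := by
  simp only [formDensity, magneticPotential, mul_add, Finset.mul_sum]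
  rw [add_right_comm, ← Finset.sum_add_distrib]
  congr 1
  · refine Finset.sum_congr rfl fun j _ => ?_
    simp only [magneticDeriv, D, Complex.inv_I]
    ring
  · ring

lemma memLp_schwartz (w : 𝓢(Rn n, ℂ)) : MemLp w 2 (volume.restrict Ω) :=
  (w.memLp 2).restrict Ω

lemma memLp_component (hA : MemLp A ⊤ (volume.restrict Ω)) (j : Fin n) :
    MemLp (fun x => A x j) ⊤ (volume.restrict Ω) :=
  (EuclideanSpace.proj (𝕜 := ℂ) j).comp_memLp' hA

lemma memLp_partialDeriv_ofReal (hψ : ContDiff ℝ ∞ ψ) (hψc : HasCompactSupport ψ) (j : Fin n) :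
    MemLp (fun x => ((partialDeriv j ψ x : ℝ) : ℂ)) ⊤ (volume.restrict Ω) :=
  Complex.ofRealCLM.comp_memLp' ((contDiff_partialDeriv hψ j).continuous.memLp_top_of_hasCompactSupport
    (HasCompactSupport.partialDeriv hψc j) _)

lemma memLp_magneticDeriv (h : ℝ) (hψ : ContDiff ℝ ∞ ψ) (hψc : HasCompactSupport ψ)
    (hA : MemLp A ⊤ (volume.restrict Ω)) (w : 𝓢(Rn n, ℂ)) (j : Fin n) :
    MemLp (magneticDeriv h ψ A w j) 2 (volume.restrict Ω) := by
  have h1 : MemLp (fun x => D j w x) 2 (volume.restrict Ω) := by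
    simp only [D]
    rw [partialDeriv_schwartz]
    exact (memLp_schwartz _).const_mul _
  have h2 : MemLp (fun x => Complex.I * ((partialDeriv j ψ x : ℝ) : ℂ) * w x) 2
      (volume.restrict Ω) :=
    (memLp_schwartz w).mul' ((memLp_partialDeriv_ofReal hψ hψc j).const_mul _)
  have h3 : MemLp (fun x => h * A x j * w x) 2 (volume.restrict Ω) :=
    (memLp_schwartz w).mul' ((memLp_component hA j).const_mul _)
  exact ((h1.const_mul _).add h2).add h3

lemma memLp_magneticPotential (h : ℝ) (hψ : ContDiff ℝ ∞ ψ) (hψc : HasCompactSupport ψ)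
    (hA : MemLp A ⊤ (volume.restrict Ω)) (hq : MemLp q ⊤ (volume.restrict Ω))
    (w : 𝓢(Rn n, ℂ)) : MemLp (magneticPotential h ψ A q w) 2 (volume.restrict Ω) := by
  refine MemLp.add (memLp_finsetSum _ fun j _ => ?_) ((memLp_schwartz w).mul' (hq.const_mul _))
  exact MemLp.mul' (((memLp_partialDeriv_ofReal hψ hψc j).const_mul _).add
    ((memLp_component hA j).const_mul _)) (memLp_magneticDeriv h hψ hψc hA w j)

lemma integrable_schwartz_mul {F : Rn n → ℂ} (hF : MemLp F 2 (volume.restrict Ω))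
    (θ : 𝓢(Rn n, ℂ)) : Integrable (fun x => θ x * F x) (volume.restrict Ω) :=
  (memLp_schwartz θ).integrable_mul hF

lemma integrable_partialDeriv_mul {F : Rn n → ℂ} (hF : MemLp F 2 (volume.restrict Ω))
    (θ : 𝓢(Rn n, ℂ)) (j : Fin n) :
    Integrable (fun x => partialDeriv j θ x * F x) (volume.restrict Ω) := by
  rw [partialDeriv_schwartz]
  exact integrable_schwartz_mul hF _

lemma integrable_formDensity (h : ℝ) (hψ : ContDiff ℝ ∞ ψ) (hψc : HasCompactSupport ψ)
    (hA : MemLp A ⊤ (volume.restrict Ω)) (hq : MemLp q ⊤ (volume.restrict Ω))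
    (w θ : 𝓢(Rn n, ℂ)) : Integrable (formDensity h ψ A q w θ) (volume.restrict Ω) := by
  refine Integrable.congr ?_ (.of_forall fun x => (formDensity_eq h ψ A q w θ x).symm)
  exact (integrable_schwartz_mul (memLp_magneticPotential h hψ hψc hA hq w) θ).add
    (integrable_finsetSum _ fun j _ => (integrable_partialDeriv_mul
      (memLp_magneticDeriv h hψ hψc hA w j) θ j).const_mul _)

lemma exists_Lp_apply_eq (hΩ : MeasurableSet Ω) {F : Rn n → ℂ}
    (hF : MemLp F 2 (volume.restrict Ω)) :
    ∃ f : Lp ℂ 2 (volume : Measure (Rn n)), ∀ θ : 𝓢(Rn n, ℂ),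
      (f : 𝓢'(Rn n, ℂ)) θ = ∫ x in Ω, θ x * F x := by
  have h1 : MemLp (Ω.indicator F) 2 volume := (memLp_indicator_iff_restrict hΩ).2 hF
  refine ⟨h1.toLp, fun θ => ?_⟩
  rw [Lp.toTemperedDistribution_apply, ← integral_indicator hΩ]
  refine integral_congr_ae ?_
  filter_upwards [h1.coeFn_toLp] with x hx
  rw [hx]
  by_cases hxΩ : x ∈ Ω <;> simp [hxΩ]

lemma memSobolev_sum {ι : Type*} (s : Finset ι) {r : ℝ} {T : ι → 𝓢'(Rn n, ℂ)}
    (hT : ∀ i ∈ s, MemSobolev r 2 (T i)) : MemSobolev r 2 (∑ i ∈ s, T i) := by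
  classical
  induction s using Finset.induction_on with
  | empty => simp
  | insert i s hi ih =>
    rw [Finset.sum_insert hi]
    exact (hT i (Finset.mem_insert_self i s)).add
      (ih fun j hj => hT j (Finset.mem_insert_of_mem hj))

/-- The form of the conjugated magnetic Schrödinger operator is given by a distribution in
`H⁻¹`. -/
lemma exists_temperedDistribution_formDensity (hΩ : MeasurableSet Ω) (h : ℝ)
    (hψ : ContDiff ℝ ∞ ψ) (hψc : HasCompactSupport ψ)
    (hA : MemLp A ⊤ (volume.restrict Ω)) (hq : MemLp q ⊤ (volume.restrict Ω))
    (w : 𝓢(Rn n, ℂ)) :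
    ∃ T : 𝓢'(Rn n, ℂ), (∀ θ : 𝓢(Rn n, ℂ), T θ = ∫ x in Ω, formDensity h ψ A q w θ x) ∧
      MemSobolev (-1) 2 T := by
  obtain ⟨f₀, hf₀⟩ := exists_Lp_apply_eq hΩ (memLp_magneticPotential h hψ hψc hA hq w)
  choose f hf using fun j => exists_Lp_apply_eq hΩ (memLp_magneticDeriv h hψ hψc hA w j)
  refine ⟨(f₀ : 𝓢'(Rn n, ℂ)) - ∑ j, ((h : ℂ) * Complex.I) •
    (∂_{EuclideanSpace.single j (1 : ℝ)} (f j : 𝓢'(Rn n, ℂ)) : 𝓢'(Rn n, ℂ)), fun θ => ?_, ?_⟩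
  · have e1 (j : Fin n) : (∂_{EuclideanSpace.single j (1 : ℝ)} (f j : 𝓢'(Rn n, ℂ)) :
        𝓢'(Rn n, ℂ)) θ = -∫ x in Ω, partialDeriv j θ x * magneticDeriv h ψ A w j x := by
      rw [TemperedDistribution.lineDerivOp_apply_apply, map_neg, hf, partialDeriv_schwartz]
    simp only [formDensity_eq]
    rw [integral_add (integrable_schwartz_mul (memLp_magneticPotential h hψ hψc hA hq w) θ)
      (integrable_finsetSum _ fun j _ => (integrable_partialDeriv_mul
        (memLp_magneticDeriv h hψ hψc hA w j) θ j).const_mul _),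
      integral_finsetSum _ fun j _ => (integrable_partialDeriv_mul
        (memLp_magneticDeriv h hψ hψc hA w j) θ j).const_mul _]
    simp only [integral_const_mul]
    rw [← hf₀, sub_eq_add_neg]
    simp [e1, sum_apply]
  · refine MemSobolev.sub ?_ (memSobolev_sum _ fun j _ => MemSobolev.smul _ ?_)
    · exact (memSobolev_zero_iff.2 ⟨f₀, rfl⟩).mono (by norm_num)
    · have h1 := (memSobolev_zero_iff.2 ⟨f j, rfl⟩ :
        MemSobolev 0 2 (f j : 𝓢'(Rn n, ℂ))).lineDerivOp (m := EuclideanSpace.single j (1 : ℝ))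
      simpa using h1

/-! ### The magnetic and electric potentials as a perturbation -/

lemma exists_ae_bound {F : Type*} [NormedAddCommGroup F] {f : Rn n → F}
    (hf : MemLp f ⊤ (volume.restrict Ω)) :
    ∃ K : ℝ, 0 ≤ K ∧ ∀ᵐ x ∂(volume.restrict Ω), ‖f x‖ ≤ K := by
  have h1 : eLpNormEssSup f (volume.restrict Ω) ≠ ⊤ := by
    rw [← eLpNorm_exponent_top]; exact hf.2.ne
  refine ⟨(eLpNormEssSup f (volume.restrict Ω)).toReal, ENNReal.toReal_nonneg, ?_⟩
  filter_upwards [ae_le_eLpNormEssSup (f := f) (μ := volume.restrict Ω)] with x hx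
  have := ENNReal.toReal_mono h1 hx
  simpa using this

lemma norm_le_sqrt_energyDensity (h : ℝ) (f : Rn n → ℂ) (x : Rn n) :
    ‖f x‖ ≤ √(energyDensity h f x) := by
  refine Real.le_sqrt_of_sq_le ?_
  rw [energyDensity, le_add_iff_nonneg_right]
  exact mul_nonneg (sq_nonneg _) (Finset.sum_nonneg fun _ _ => sq_nonneg _)

lemma norm_D_le_sqrt_energyDensity (h : ℝ) (f : Rn n → ℂ) (x : Rn n) (j : Fin n) :
    ‖(h : ℂ) * D j f x‖ ≤ √(energyDensity h f x) := by
  refine Real.le_sqrt_of_sq_le ?_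
  have h1 : ‖partialDeriv j f x‖ ^ 2 ≤ ∑ k, ‖partialDeriv k f x‖ ^ 2 :=
    Finset.single_le_sum (f := fun k => ‖partialDeriv k f x‖ ^ 2) (fun _ _ => sq_nonneg _)
      (Finset.mem_univ j)
  have h2 : ‖(h : ℂ) * D j f x‖ ^ 2 = h ^ 2 * ‖partialDeriv j f x‖ ^ 2 := by
    simp [D, mul_pow]
  rw [h2, energyDensity]
  have h3 := mul_le_mul_of_nonneg_left h1 (sq_nonneg h)
  have h4 := sq_nonneg ‖f x‖
  linarith

/-- Every term containing `A` or `q` carries a factor `h` and at most one derivative on each of `w`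
and `θ`, each with its own `h`. No derivative of `A` occurs. -/
lemma norm_formDensity_sub_le {h K : ℝ} (hh : 0 ≤ h) (hh1 : h ≤ 1) (hK : 0 ≤ K)
    {w θ : Rn n → ℂ} {x : Rn n} (hψ : ∀ j, |partialDeriv j ψ x| ≤ K) (hA : ‖A x‖ ≤ K)
    (hq : ‖q x‖ ≤ K) :
    ‖formDensity h ψ A q w θ x - formDensity h ψ 0 0 w θ x‖
      ≤ h * (n * (2 * K * (1 + K) + K ^ 2) + K)
        * (√(energyDensity h w x) * √(energyDensity h θ x)) := by
  obtain ⟨a, ha⟩ : ∃ a, a = √(energyDensity h w x) := ⟨_, rfl⟩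
  obtain ⟨b, hb⟩ : ∃ b, b = √(energyDensity h θ x) := ⟨_, rfl⟩
  have ha0 : 0 ≤ a := ha ▸ Real.sqrt_nonneg _
  have hb0 : 0 ≤ b := hb ▸ Real.sqrt_nonneg _
  have hw : ‖w x‖ ≤ a := ha ▸ norm_le_sqrt_energyDensity h w x
  have hθ : ‖θ x‖ ≤ b := hb ▸ norm_le_sqrt_energyDensity h θ x
  have hdw (j : Fin n) : ‖(h : ℂ) * D j w x‖ ≤ a := ha ▸ norm_D_le_sqrt_energyDensity h w x j
  have hdθ (j : Fin n) : ‖(h : ℂ) * D j θ x‖ ≤ b := hb ▸ norm_D_le_sqrt_energyDensity h θ x j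
  have hp (j : Fin n) : ‖Complex.I * ((partialDeriv j ψ x : ℝ) : ℂ)‖ ≤ K := by
    simpa using hψ j
  have hAj (j : Fin n) : ‖A x j‖ ≤ K := (PiLp.norm_apply_le _ _).trans hA
  have hP (j : Fin n) : ‖(h : ℂ) * D j w x + Complex.I * ((partialDeriv j ψ x : ℝ) : ℂ) * w x‖
      ≤ (1 + K) * a := by
    refine (norm_add_le _ _).trans ?_
    rw [norm_mul _ (w x), add_mul, one_mul]
    exact add_le_add (hdw j) (mul_le_mul (hp j) hw (norm_nonneg _) hK)
  have hQ (j : Fin n) : ‖-((h : ℂ) * D j θ x) + Complex.I * ((partialDeriv j ψ x : ℝ) : ℂ) * θ x‖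
      ≤ (1 + K) * b := by
    refine (norm_add_le _ _).trans ?_
    rw [norm_mul _ (θ x), norm_neg, add_mul, one_mul]
    exact add_le_add (hdθ j) (mul_le_mul (hp j) hθ (norm_nonneg _) hK)
  have e1 : formDensity h ψ A q w θ x - formDensity h ψ 0 0 w θ x
      = h * ((∑ j, (A x j * (((h : ℂ) * D j w x
          + Complex.I * ((partialDeriv j ψ x : ℝ) : ℂ) * w x) * θ x
        + w x * (-((h : ℂ) * D j θ x) + Complex.I * ((partialDeriv j ψ x : ℝ) : ℂ) * θ x))
        + h * (A x j * A x j * (w x * θ x)))) + h * (q x * (w x * θ x))) := by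
    simp only [formDensity, Pi.zero_apply, PiLp.zero_apply, mul_zero, zero_mul, add_zero]
    rw [add_sub_right_comm, ← Finset.sum_sub_distrib, mul_add, Finset.mul_sum]
    congr 1
    · exact Finset.sum_congr rfl fun j _ => by ring
    · ring
  have hwθ : ‖w x * θ x‖ ≤ a * b := by
    rw [norm_mul]; exact mul_le_mul hw hθ (norm_nonneg _) ha0
  have hab := mul_nonneg ha0 hb0
  have hhn : ‖(h : ℂ)‖ ≤ 1 := by simpa [abs_of_nonneg hh] using hh1
  have e2 (j : Fin n) : ‖A x j * (((h : ℂ) * D j w x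
          + Complex.I * ((partialDeriv j ψ x : ℝ) : ℂ) * w x) * θ x
        + w x * (-((h : ℂ) * D j θ x) + Complex.I * ((partialDeriv j ψ x : ℝ) : ℂ) * θ x))
        + h * (A x j * A x j * (w x * θ x))‖ ≤ (2 * K * (1 + K) + K ^ 2) * (a * b) := by
    refine (norm_add_le _ _).trans ?_
    have t1 := mul_le_mul (hP j) hθ (norm_nonneg _) (by positivity)
    have t2 := mul_le_mul hw (hQ j) (norm_nonneg _) ha0
    rw [← norm_mul] at t1 t2
    have t3 := (norm_add_le _ _).trans (add_le_add t1 t2)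
    have t4 := mul_le_mul (hAj j) t3 (norm_nonneg _) hK
    rw [← norm_mul] at t4
    have t5 := mul_le_mul (mul_le_mul (hAj j) (hAj j) (norm_nonneg _) hK) hwθ (norm_nonneg _)
      (mul_nonneg hK hK)
    rw [← norm_mul, ← norm_mul] at t5
    have t6 := mul_le_mul hhn t5 (norm_nonneg _) zero_le_one
    rw [← norm_mul] at t6
    refine (add_le_add t4 t6).trans (le_of_eq ?_)
    ring
  have e3 : ‖(h : ℂ) * (q x * (w x * θ x))‖ ≤ K * (a * b) := by
    have t5 := mul_le_mul hq hwθ (norm_nonneg _) hK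
    rw [← norm_mul] at t5
    have t6 := mul_le_mul hhn t5 (norm_nonneg _) zero_le_one
    rwa [← norm_mul, one_mul] at t6
  rw [e1, norm_mul, Complex.norm_real, Real.norm_eq_abs, abs_of_nonneg hh, ← ha, ← hb, mul_assoc]
  refine mul_le_mul_of_nonneg_left ((norm_add_le _ _).trans ?_) hh
  have e4 := (norm_sum_le _ _).trans (Finset.sum_le_sum fun j (_ : j ∈ Finset.univ) => e2 j)
  refine (add_le_add e4 e3).trans (le_of_eq ?_)
  simp only [Finset.sum_const, Finset.card_univ, Fintype.card_fin, nsmul_eq_mul]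
  ring

/-- The potentials are a perturbation of order `h` of the conjugated Laplacian. -/
lemma norm_integral_formDensity_sub_le {h K : ℝ} (hh : 0 ≤ h)
    (hh1 : h ≤ 1) (hK : 0 ≤ K)
    (hψ : ContDiff ℝ ∞ ψ) (hψc : HasCompactSupport ψ) (hψK : ∀ j x, |partialDeriv j ψ x| ≤ K)
    (hA : MemLp A ⊤ (volume.restrict Ω)) (hAK : ∀ᵐ x ∂(volume.restrict Ω), ‖A x‖ ≤ K)
    (hq : MemLp q ⊤ (volume.restrict Ω)) (hqK : ∀ᵐ x ∂(volume.restrict Ω), ‖q x‖ ≤ K)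
    (w θ : 𝓢(Rn n, ℂ)) (hwc : HasCompactSupport w) (hwΩ : tsupport w ⊆ Ω) :
    ‖(∫ x in Ω, formDensity h ψ A q w θ x) - ∫ x, conjLaplacianC h ψ w x * θ x‖
      ≤ h * (n * (2 * K * (1 + K) + K ^ 2) + K) * (√(sclEnergy h w) * √(sclEnergy h θ)) := by
  have hC : 0 ≤ h * (n * (2 * K * (1 + K) + K ^ 2) + K) := by positivity
  obtain ⟨i1, hi1⟩ := integral_sqrt_mul_sqrt_le (energyDensity_nonneg h w)
    (energyDensity_nonneg h θ) (integrable_energyDensity h w) (integrable_energyDensity h θ)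
  rw [← integral_formDensity_zero h hψ (w.smooth ⊤) hwc hwΩ (θ.smooth ⊤),
    ← integral_sub (integrable_formDensity h hψ hψc hA hq w θ)
      (integrable_formDensity h hψ hψc MemLp.zero MemLp.zero w θ)]
  refine (norm_integral_le_integral_norm _).trans ?_
  have s1 : ∫ x in Ω, ‖formDensity h ψ A q w θ x - formDensity h ψ 0 0 w θ x‖
      ≤ ∫ x in Ω, h * (n * (2 * K * (1 + K) + K ^ 2) + K)
        * (√(energyDensity h w x) * √(energyDensity h θ x)) := by
    refine integral_mono_ae ((integrable_formDensity h hψ hψc hA hq w θ).sub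
      (integrable_formDensity h hψ hψc MemLp.zero MemLp.zero w θ)).norm
      (i1.restrict.const_mul _) ?_
    filter_upwards [hAK, hqK] with x hx1 hx2
    exact norm_formDensity_sub_le hh hh1 hK (fun j => hψK j x) hx1 hx2
  refine s1.trans ?_
  rw [integral_const_mul]
  refine mul_le_mul_of_nonneg_left ?_ hC
  refine le_trans ?_ hi1
  exact setIntegral_le_integral i1 (.of_forall fun x => by positivity)

end Form

/-! ### Limiting Carleman weights -/

open scoped Manifold in
lemma exists_cutoff {K U : Set (Rn n)} (hK : IsCompact K) (hU : IsOpen U) (hKU : K ⊆ U) :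
    ∃ χ : Rn n → ℝ, ContDiff ℝ ∞ χ ∧ HasCompactSupport χ ∧ tsupport χ ⊆ U ∧
      ∃ V, IsOpen V ∧ K ⊆ V ∧ ∀ x ∈ V, χ x = 1 := by
  obtain ⟨L, hL, hKL, hLU⟩ := exists_compact_between hK hU hKU
  obtain ⟨f, hf1, hf0, -⟩ := exists_contMDiffMap_one_nhds_of_subset_interior
    (n := (⊤ : ℕ∞)) 𝓘(ℝ, Rn n) hK.isClosed hKL
  have hts : tsupport f ⊆ L := closure_minimal (fun x hx => by
    by_contra hxL
    exact hx (hf0 x hxL)) hL.isClosed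
  obtain ⟨V, hV, hKV, hV1⟩ := (Filter.eventually_iff_exists_mem.1 hf1).elim fun W hW => by
    obtain ⟨V, hV, hKV, hVW⟩ := mem_nhdsSet_iff_exists.1 hW.1
    exact (⟨V, hV, hKV, fun x hx => hW.2 x (hVW hx)⟩ :
      ∃ V, IsOpen V ∧ K ⊆ V ∧ ∀ x ∈ V, f x = 1)
  exact ⟨f, f.contMDiff.contDiff, hL.of_isClosed_subset (isClosed_tsupport _) hts, hts.trans hLU,
    V, hV, hKV, hV1⟩

/-- The product with a cutoff is smooth whatever `f` is outside `U`. Agreement on an open set, not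
only on `K`, makes all derivatives agree there. -/
lemma exists_extension {K U : Set (Rn n)} (hK : IsCompact K) (hU : IsOpen U) (hKU : K ⊆ U)
    {f : Rn n → ℝ} (hf : ContDiffOn ℝ ∞ f U) :
    ∃ g : Rn n → ℝ, ContDiff ℝ ∞ g ∧ HasCompactSupport g ∧
      ∃ V, IsOpen V ∧ K ⊆ V ∧ V ⊆ U ∧ ∀ x ∈ V, g x = f x := by
  obtain ⟨χ, hχ, hχc, hχU, V, hV, hKV, hV1⟩ := exists_cutoff hK hU hKU
  refine ⟨fun x => χ x * f x, ?_, hχc.mul_right, V ∩ U, hV.inter hU, subset_inter hKV hKU,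
    inter_subset_right, fun x hx => by simp [hV1 x hx.1]⟩
  refine contDiff_iff_contDiffAt.2 fun x => ?_
  by_cases hx : x ∈ tsupport χ
  · exact hχ.contDiffAt.mul (hf.contDiffAt (hU.mem_nhds (hχU hx)))
  · have h0 : (fun x => χ x * f x) =ᶠ[nhds x] fun _ => 0 := by
      filter_upwards [(isClosed_tsupport χ).isOpen_compl.mem_nhds hx] with y hy
      rw [image_eq_zero_of_notMem_tsupport hy, zero_mul]
    exact contDiffAt_const.congr_of_eventuallyEq h0

/-! ### The symbol and its Poisson bracket in coordinates. -/

lemma gradient_apply {f : Rn n → ℝ} {x : Rn n} (k : Fin n) :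
    gradient f x k = partialDeriv k f x := by
  have h1 : inner ℝ (gradient f x) (EuclideanSpace.single k (1 : ℝ))
      = fderiv ℝ f x (EuclideanSpace.single k 1) := by
    simp [gradient]
  rw [partialDeriv, ← h1, EuclideanSpace.inner_single_right]
  simp

lemma norm_sq_gradient (f : Rn n → ℝ) (x : Rn n) : ‖gradient f x‖ ^ 2 = grdDot f f x := by
  rw [EuclideanSpace.norm_sq_eq]
  simp only [gradient_apply, grdDot, Real.norm_eq_abs, sq_abs]
  simp only [sq]

lemma inner_gradient (f : Rn n → ℝ) (x ξ : Rn n) :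
    inner ℝ (gradient f x) ξ = ∑ k, partialDeriv k f x * ξ k := by
  rw [PiLp.inner_apply]
  refine Finset.sum_congr rfl fun k _ => ?_
  rw [gradient_apply]
  simp [mul_comm]

lemma carlemanSymbol_re (f : Rn n → ℝ) (x ξ : Rn n) :
    (carlemanSymbol f x ξ).re = ‖ξ‖ ^ 2 - grdDot f f x := by
  rw [← norm_sq_gradient]
  simp [carlemanSymbol, -Complex.ofReal_pow]

lemma carlemanSymbol_im (f : Rn n → ℝ) (x ξ : Rn n) :
    (carlemanSymbol f x ξ).im = 2 * ∑ k, partialDeriv k f x * ξ k := by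
  rw [← inner_gradient]
  simp [carlemanSymbol, -Complex.ofReal_pow]

lemma partialDeriv_norm_sq_sub (c : ℝ) (ξ : Rn n) (j : Fin n) :
    partialDeriv j (fun η : Rn n => ‖η‖ ^ 2 - c) ξ = 2 * ξ j := by
  rw [partialDeriv, fderiv_sub_const, fderiv_norm_sq_apply]
  simp [EuclideanSpace.inner_single_right]

lemma partialDeriv_two_mul_sum (a : Fin n → ℝ) (ξ : Rn n) (j : Fin n) :
    partialDeriv j (fun η : Rn n => 2 * ∑ k, a k * η k) ξ = 2 * a j := by
  have h1 : (fun η : Rn n => 2 * ∑ k, a k * η k)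
      = ⇑((2 : ℝ) • ∑ k, a k • (EuclideanSpace.proj k : Rn n →L[ℝ] ℝ)) := by
    ext η; simp
  rw [h1, partialDeriv, ContinuousLinearMap.fderiv]
  simp

lemma poissonBracket_carlemanSymbol {f : Rn n → ℝ} (hf : ContDiff ℝ ∞ f) (x ξ : Rn n) :
    poissonBracket (fun y η => (carlemanSymbol f y η).re)
      (fun y η => (carlemanSymbol f y η).im) x ξ
      = 4 * hessForm f x ξ ξ + 2 * grdDot f (grdDot f f) x := by
  have e1 (j : Fin n) : partialDeriv j (fun y => 2 * ∑ k, partialDeriv k f y * ξ k) x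
      = 2 * ∑ k, partialDeriv j (partialDeriv k f) x * ξ k := by
    have s1 (k : Fin n) : ContDiff ℝ ∞ fun y => partialDeriv k f y * ξ k :=
      (contDiff_partialDeriv hf k).mul contDiff_const
    rw [partialDeriv_const_mul (ContDiff.differentiableAt_infty (ContDiff.sum fun k _ => s1 k) x),
      partialDeriv_sum fun k _ => ContDiff.differentiableAt_infty (s1 k) x]
    congr 1
    refine Finset.sum_congr rfl fun k _ => ?_
    simp only [mul_comm _ (ξ k)]
    exact partialDeriv_const_mul (ContDiff.differentiableAt_infty (contDiff_partialDeriv hf k) x) _ j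
  have e2 (j : Fin n) : partialDeriv j (fun y => ‖ξ‖ ^ 2 - grdDot f f y) x
      = -partialDeriv j (grdDot f f) x := by
    simp [partialDeriv, fderiv_const_sub]
  simp only [poissonBracket, carlemanSymbol_re, carlemanSymbol_im, partialDeriv_norm_sq_sub,
    partialDeriv_two_mul_sum, e1, e2]
  simp only [hessForm, grdDot, Finset.mul_sum, ← Finset.sum_add_distrib]
  refine Finset.sum_congr rfl fun j _ => ?_
  rw [sub_eq_add_neg]
  congr 1
  · exact Finset.sum_congr rfl fun k _ => by ring
  · unfold grdDot
    ring

lemma IsLimitingCarlemanWeight.congr {f g : Rn n → ℝ} {U V : Set (Rn n)}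
    (hf : IsLimitingCarlemanWeight U f) (hV : IsOpen V) (hVU : V ⊆ U) (hfg : ∀ x ∈ V, g x = f x) :
    IsLimitingCarlemanWeight V g := by
  have h1 (x : Rn n) (hx : x ∈ V) : gradient g x = gradient f x := by
    have h2 : g =ᶠ[nhds x] f := Filter.eventuallyEq_of_mem (hV.mem_nhds hx) hfg
    simp only [gradient, h2.fderiv_eq]
  have h3 (x : Rn n) (hx : x ∈ V) (ξ : Rn n) : carlemanSymbol g x ξ = carlemanSymbol f x ξ := by
    simp only [carlemanSymbol, h1 x hx]
  refine ⟨(hf.smooth.mono hVU).congr hfg, fun x hx => h1 x hx ▸ hf.gradient_ne_zero x (hVU hx),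
    fun x hx ξ h0 => ?_⟩
  rw [h3 x hx] at h0
  rw [← hf.bracket_eq_zero x (hVU hx) ξ h0]
  have ev (F : ℂ → ℝ) : (fun y => F (carlemanSymbol g y ξ))
      =ᶠ[nhds x] fun y => F (carlemanSymbol f y ξ) := by
    filter_upwards [hV.mem_nhds hx] with y hy
    rw [h3 y hy]
  simp only [poissonBracket, partialDeriv_congr (ev Complex.re), partialDeriv_congr (ev Complex.im),
    h3 x hx]

lemma sum_grd_grdDot_self {f : Rn n → ℝ} (hf : ContDiff ℝ ∞ f) (x : Rn n) (X : Fin n → ℝ) :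
    ∑ k, grd (grdDot f f) x k * X k = 2 * hessForm f x (grd f x) X := by
  -- Any vector is the gradient of a linear function, so the identity for `∇g · ∇(∇f · ∇f)` applies
  -- to `X`.
  have h1 : ∃ g : Rn n → ℝ, grd g x = X := by
    refine ⟨fun η => 2 * ∑ k, (X k / 2) * η k, funext fun j => ?_⟩
    rw [grd, partialDeriv_two_mul_sum (fun k => X k / 2)]
    ring
  obtain ⟨g, rfl⟩ := h1
  have h2 := grdDot_grdDot hf hf g x
  rw [hessForm_comm hf x (grd f x), two_mul, ← h2]
  exact Finset.sum_congr rfl fun k _ => mul_comm _ _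

lemma hessForm_sub_mul {f : Rn n → ℝ} (hf : ContDiff ℝ ∞ f) (x : Rn n) (X p : Fin n → ℝ) (t : ℝ) :
    hessForm f x (fun k => X k - t * p k) (fun k => X k - t * p k)
      = hessForm f x X X - 2 * t * hessForm f x p X + t ^ 2 * hessForm f x p p := by
  have h1 : 2 * t * hessForm f x p X = t * hessForm f x p X + t * hessForm f x X p := by
    rw [hessForm_comm hf x X p]; ring
  rw [h1]
  simp only [hessForm, Finset.mul_sum, ← Finset.sum_add_distrib, ← Finset.sum_sub_distrib]
  exact Finset.sum_congr rfl fun j _ => Finset.sum_congr rfl fun k _ => by ring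

lemma hessForm_mul_mul (f : Rn n → ℝ) (x : Rn n) (X : Fin n → ℝ) (s : ℝ) :
    hessForm f x (fun k => s * X k) (fun k => s * X k) = s ^ 2 * hessForm f x X X := by
  simp only [hessForm, Finset.mul_sum]
  exact Finset.sum_congr rfl fun j _ => Finset.sum_congr rfl fun k _ => by ring

/-- The Hessian of a limiting Carleman weight. -/
lemma hessForm_eq_of_isLimitingCarlemanWeight {f : Rn n → ℝ} {V : Set (Rn n)}
    (hf : ContDiff ℝ ∞ f) (hV : IsLimitingCarlemanWeight V f) {x : Rn n} (hx : x ∈ V) {r : ℝ}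
    (hr : r * grdDot f f x = 1) (X : Fin n → ℝ) :
    hessForm f x X X = -(r / 2 * grdDot f (grdDot f f) x) * (∑ k, X k * X k)
      + r * (∑ k, grd f x k * X k) * ∑ k, grd (grdDot f f) x k * X k := by
  have hG : grdDot f (grdDot f f) x = 2 * hessForm f x (grd f x) (grd f x) := by
    rw [grdDot_grdDot hf hf]; ring
  -- The two conditions on `ξ` say that the symbol vanishes at `(x, ξ)`.
  have key (ξ : Fin n → ℝ) (h1 : ∑ k, grd f x k * ξ k = 0)
      (h2 : ∑ k, ξ k * ξ k = grdDot f f x) :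
      hessForm f x ξ ξ = -(grdDot f (grdDot f f) x / 2) := by
    have h3 : carlemanSymbol f x (WithLp.toLp 2 ξ) = 0 := by
      apply Complex.ext
      · rw [carlemanSymbol_re, EuclideanSpace.norm_sq_eq, ← h2]
        simp [sq]
      · rw [carlemanSymbol_im]
        have h4 : ∑ k, partialDeriv k f x * ξ k = 0 := h1
        simp [h4]
    have h5 := hV.bracket_eq_zero x hx _ h3
    rw [poissonBracket_carlemanSymbol hf] at h5
    have h6 : hessForm f x (WithLp.toLp 2 ξ) (WithLp.toLp 2 ξ) = hessForm f x ξ ξ := rfl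
    linarith
  -- Both sides are homogeneous of degree two, so `Y` may be rescaled to the length of the gradient.
  have perp (Y : Fin n → ℝ) (h1 : ∑ k, grd f x k * Y k = 0) :
      hessForm f x Y Y = -(r / 2 * grdDot f (grdDot f f) x) * ∑ k, Y k * Y k := by
    have hY : 0 ≤ ∑ k, Y k * Y k := Finset.sum_nonneg fun k _ => mul_self_nonneg _
    rcases hY.eq_or_lt with h0 | hpos
    · have hY0 (k : Fin n) : Y k = 0 := by
        have := (Finset.sum_eq_zero_iff_of_nonneg fun k _ => mul_self_nonneg (Y k)).1 h0.symm k
          (Finset.mem_univ k)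
        exact mul_self_eq_zero.1 this
      simp [hessForm, hY0]
    · have hP : 0 ≤ grdDot f f x := grdDot_self_nonneg f x
      obtain ⟨N, hN⟩ : ∃ N, N = ∑ k, Y k * Y k := ⟨_, rfl⟩
      rw [← hN] at hpos ⊢
      have hs : √(grdDot f f x / N) ^ 2 = grdDot f f x / N := Real.sq_sqrt (by positivity)
      have h3 := key (fun k => √(grdDot f f x / N) * Y k)
        (by
          simp only [mul_left_comm _ √(grdDot f f x / N), ← Finset.mul_sum, h1, mul_zero])
        (by
          have : ∑ k, √(grdDot f f x / N) * Y k * (√(grdDot f f x / N) * Y k)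
              = √(grdDot f f x / N) ^ 2 * N := by
            rw [hN, Finset.mul_sum]
            exact Finset.sum_congr rfl fun k _ => by ring
          rw [this, hs]
          field_simp)
      rw [hessForm_mul_mul, hs] at h3
      have h4 : grdDot f f x * hessForm f x Y Y = -(grdDot f (grdDot f f) x / 2) * N := by
        rw [← h3]; field_simp
      linear_combination r * h4 - hessForm f x Y Y * hr
  obtain ⟨c, hc⟩ : ∃ c, c = ∑ k, grd f x k * X k := ⟨_, rfl⟩
  obtain ⟨P, hP⟩ : ∃ P, P = grdDot f f x := ⟨_, rfl⟩
  have hP' : ∑ k, grd f x k * grd f x k = P := hP.symm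
  obtain ⟨N, hN⟩ : ∃ N, N = ∑ k, X k * X k := ⟨_, rfl⟩
  -- The component of `X` orthogonal to the gradient; `r` is the inverse squared length of the
  -- gradient.
  have h7 := perp (fun k => X k - (r * c) * grd f x k) (by
    simp only [mul_sub, Finset.sum_sub_distrib, mul_left_comm _ (r * c), ← Finset.mul_sum]
    rw [← hc, hP', mul_right_comm, hP, hr]; ring)
  have h8 : ∑ k, (X k - (r * c) * grd f x k) * (X k - (r * c) * grd f x k)
      = N - 2 * (r * c) * c + (r * c) ^ 2 * P := by
    rw [hN, ← hP', Finset.mul_sum, mul_assoc]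
    nth_rewrite 4 [hc]
    simp only [Finset.mul_sum, ← Finset.sum_add_distrib, ← Finset.sum_sub_distrib]
    exact Finset.sum_congr rfl fun k _ => by ring
  rw [hessForm_sub_mul hf, h8] at h7
  rw [sum_grd_grdDot_self hf, ← hc, ← hN]
  rw [hG] at h7 ⊢
  rw [← hP] at hr
  obtain ⟨H, hH⟩ : ∃ H, H = hessForm f x (grd f x) (grd f x) := ⟨_, rfl⟩
  rw [← hH] at h7 ⊢
  linear_combination h7 - r ^ 2 * c ^ 2 * H * hr

/-- A limiting Carleman weight agrees near a compact set with a global one. -/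
lemma exists_isWeightOn {K U : Set (Rn n)} (hK : IsCompact K) (hU : IsOpen U) (hKU : K ⊆ U)
    {φ : Rn n → ℝ} (hφ : IsLimitingCarlemanWeight U φ) :
    ∃ (f ρ : Rn n → ℝ) (V : Set (Rn n)), IsWeightOn f ρ V ∧ IsOpen V ∧ K ⊆ V ∧
      ∀ x ∈ V, f x = φ x := by
  obtain ⟨f, hf, hfc, V, hV, hKV, hVU, hfV⟩ := exists_extension hK hU hKU hφ.smooth
  have hfw := hφ.congr hV hVU hfV
  have hne (x : Rn n) (hx : x ∈ V) : grdDot f f x ≠ 0 := by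
    rw [← norm_sq_gradient]
    exact pow_ne_zero 2 (norm_ne_zero_iff.2 (hfw.gradient_ne_zero x hx))
  -- `|∇f|⁻²` is known to be smooth only on `V`, so it needs its own extension and a smaller
  -- neighbourhood.
  obtain ⟨ρ, hρ, hρc, W, hW, hKW, hWV, hρW⟩ := exists_extension hK hV hKV
    (f := fun x => (grdDot f f x)⁻¹) ((contDiff_grdDot hf hf).contDiffOn.inv hne)
  have hr (x : Rn n) (hx : x ∈ W) : ρ x * grdDot f f x = 1 := by
    rw [hρW x hx, inv_mul_cancel₀ (hne x (hWV hx))]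
  exact ⟨f, ρ, W, ⟨hf, hfc, hρ, hρc, hr, fun x hx X =>
    hessForm_eq_of_isLimitingCarlemanWeight hf hfw (hWV hx) (hr x hx) X⟩, hW, hKW,
    fun x hx => hfV x (hWV hx)⟩

/-! ### Multiplication by the exponential of a function with compact support -/

section Exponential

variable {g : Rn n → ℝ}

lemma hasCompactSupport_exp_sub_one (hgc : HasCompactSupport g) :
    HasCompactSupport fun x => Real.exp (g x) - 1 :=
  hgc.comp_left (g := fun t => Real.exp t - 1) (by simp)

lemma exists_bound_exp (hg : ContDiff ℝ ∞ g) (hgc : HasCompactSupport g) :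
    ∃ B : ℝ, 0 ≤ B ∧ ∀ x, Real.exp (g x) ^ 2 ≤ B ∧
      grdDot (fun y => Real.exp (g y)) (fun y => Real.exp (g y)) x ≤ B := by
  have hc := hasCompactSupport_exp_sub_one hgc
  have hs : ContDiff ℝ ∞ fun x => Real.exp (g x) - 1 := hg.exp.sub contDiff_const
  obtain ⟨M₁, h1⟩ := exists_forall_abs_le hs.continuous hc
  obtain ⟨M₂, h2⟩ := exists_forall_abs_le (contDiff_grdDot hs hs).continuous
    (hasCompactSupport_grdDot_right _ hc)
  refine ⟨max ((1 + M₁) ^ 2) M₂, le_max_of_le_left (sq_nonneg _), fun x =>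
    ⟨le_max_of_le_left ?_, le_max_of_le_right ?_⟩⟩
  · have h3 := (abs_le.1 (h1 x)).2
    exact pow_le_pow_left₀ (Real.exp_pos _).le (by linarith) 2
  · refine le_trans (le_of_eq ?_) ((le_abs_self _).trans (h2 x))
    simp [grdDot, partialDeriv, fderiv_sub_const]

/-- The factor `exp g - 1` has compact support, so the product differs from `θ` by a smooth
compactly supported function. -/
lemma exists_schwartz_exp_mul (hg : ContDiff ℝ ∞ g) (hgc : HasCompactSupport g)
    (θ : 𝓢(Rn n, ℂ)) : ∃ η : 𝓢(Rn n, ℂ), ∀ x, η x = ((Real.exp (g x) : ℝ) : ℂ) * θ x := by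
  have hc : HasCompactSupport fun x => ((Real.exp (g x) - 1 : ℝ) : ℂ) * θ x :=
    ((hasCompactSupport_exp_sub_one hgc).comp_left (g := Complex.ofReal) rfl).mul_right
  have hs : ContDiff ℝ ∞ fun x => ((Real.exp (g x) - 1 : ℝ) : ℂ) * θ x :=
    (contDiff_ofReal (hg.exp.sub contDiff_const)).mul (θ.smooth ⊤)
  refine ⟨θ + hc.toSchwartzMap hs, fun x => ?_⟩
  have h1 : (hc.toSchwartzMap hs) x = ((Real.exp (g x) - 1 : ℝ) : ℂ) * θ x := rfl
  rw [add_apply, h1]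
  push_cast
  ring

lemma sclEnergy_exp_mul_le {h B : ℝ} (hh : 0 ≤ h) (hh1 : h ≤ 1) (hg : ContDiff ℝ ∞ g)
    (hB : ∀ x, Real.exp (g x) ^ 2 ≤ B ∧
      grdDot (fun y => Real.exp (g y)) (fun y => Real.exp (g y)) x ≤ B)
    {θ η : 𝓢(Rn n, ℂ)} (hη : ∀ x, η x = ((Real.exp (g x) : ℝ) : ℂ) * θ x) :
    sclEnergy h η ≤ 3 * B * sclEnergy h θ := by
  rw [sclEnergy, sclEnergy, ← integral_const_mul]
  refine integral_mono (integrable_energyDensity h η)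
    ((integrable_energyDensity h θ).const_mul _) fun x => ?_
  rw [show ⇑η = fun y => ((Real.exp (g y) : ℝ) : ℂ) * θ y from funext hη]
  exact energyDensity_mul_le hh hh1 hg.exp (θ.smooth ⊤) (hB x).1 (hB x).2

/-- A change of the weight by `h g` is the same as multiplication of the argument and the test
function by `exp g`. This passes between `φ` and the convexified weight. -/
lemma conjugatedSchrodinger_exp_mul (Ω : Set (Rn n)) (φ : Rn n → ℝ)
    (A : Rn n → EuclideanSpace ℂ (Fin n)) (q : Rn n → ℂ) {h : ℝ} (hh : h ≠ 0) (u θ : Rn n → ℂ) :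
    conjugatedSchrodinger Ω φ A q h u (fun x => ((Real.exp (g x) : ℝ) : ℂ) * θ x)
      = conjugatedSchrodinger Ω (fun x => φ x + h * g x) A q h
        (fun x => ((Real.exp (g x) : ℝ) : ℂ) * u x) θ := by
  have e1 : (fun x => Complex.exp ((φ x / h : ℝ) : ℂ) * (((Real.exp (g x) : ℝ) : ℂ) * θ x))
      = fun x => Complex.exp (((φ x + h * g x) / h : ℝ) : ℂ) * θ x := by
    ext x
    rw [← mul_assoc, Complex.ofReal_exp, ← Complex.exp_add, add_div, mul_div_cancel_left₀ _ hh]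
    push_cast
    rfl
  have e2 : (fun x => Complex.exp ((-((φ x + h * g x) / h) : ℝ) : ℂ)
      * (((Real.exp (g x) : ℝ) : ℂ) * u x))
      = fun x => Complex.exp ((-(φ x / h) : ℝ) : ℂ) * u x := by
    ext x
    rw [← mul_assoc, Complex.ofReal_exp, ← Complex.exp_add, add_div, mul_div_cancel_left₀ _ hh]
    push_cast
    ring_nf
  simp only [conjugatedSchrodinger, mulDistribution, e1, e2]

end Exponential

/-! ### The Carleman estimate with a gain of two derivatives -/

lemma exists_bound_partialDeriv_convexified {φ : Rn n → ℝ} (hφ : ContDiff ℝ ∞ φ)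
    (hφc : HasCompactSupport φ) :
    ∃ K₀ : ℝ, ∀ K, K₀ ≤ K → ∀ τ, 0 ≤ τ → τ ≤ 1 → ∀ j x,
      |partialDeriv j (convexified φ τ) x| ≤ K := by
  obtain ⟨M, hM⟩ := exists_uniform_bound hφ ((hφ.mul hφ).div_const 2) hφc
    (hφc.mul_right (f' := φ) |>.comp_left (g := fun t => t / 2) (by simp))
  refine ⟨max 1 M, fun K hK τ hτ hτ1 j x => ?_⟩
  have h1 : 1 ≤ K := (le_max_left _ _).trans hK
  have h2 := (hM K ((le_max_right _ _).trans hK) τ hτ hτ1 x).2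
  refine abs_le_of_sq_le_sq ?_ (by linarith)
  have h3 : partialDeriv j (convexified φ τ) x ^ 2 ≤ grdDot (convexified φ τ) (convexified φ τ) x := by
    rw [sq]
    exact Finset.single_le_sum (f := fun k => partialDeriv k (convexified φ τ) x
      * partialDeriv k (convexified φ τ) x) (fun _ _ => mul_self_nonneg _) (Finset.mem_univ j)
  refine (h3.trans h2).trans ?_
  nlinarith

lemma le_of_absorb {s N C₁ ha b : ℝ} (h1 : ha ≤ s * b) (h2 : b ≤ N + C₁ * ha)
    (hs : 0 ≤ s) (hsC : s * C₁ ≤ 1 / 2) (h0 : 0 ≤ ha) : ha ≤ 2 * s * N := by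
  have h3 := mul_le_mul_of_nonneg_left h2 hs
  have h4 := mul_le_mul_of_nonneg_right hsC h0
  linarith

/-- The Carleman estimate for functions in the form domain. -/
theorem carleman_formDensity {φ ρ : Rn n → ℝ} {V Ω : Set (Rn n)} (H : IsWeightOn φ ρ V)
    (hV : IsOpen V) (hΩ : IsOpen Ω) (hΩb : Bornology.IsBounded Ω) (hΩV : closure Ω ⊆ V)
    {A : Rn n → EuclideanSpace ℂ (Fin n)} (hA : MemLp A ⊤ (volume.restrict Ω))
    {q : Rn n → ℂ} (hq : MemLp q ⊤ (volume.restrict Ω)) :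
    ∃ C : ℝ, 0 < C ∧ ∃ h₀ : ℝ, 0 < h₀ ∧ ∀ h : ℝ, 0 < h → h < h₀ →
      ∀ u : 𝓢(Rn n, ℂ), HasCompactSupport u → tsupport u ⊆ Ω →
      ∀ T : 𝓢'(Rn n, ℂ), (∀ θ : 𝓢(Rn n, ℂ), T θ = ∫ x in Ω, formDensity h φ A q u θ x) →
      ∀ f : Lp ℂ 2 (volume : Measure (Rn n)),
        semiclassicalBessel h (-1) T = (f : 𝓢'(Rn n, ℂ)) → h * √(sclEnergy h u) ≤ C * ‖f‖ := by
  obtain ⟨χ, hχ, hχc, hχV, W, -, hΩW, hW⟩ := exists_cutoff hΩb.isCompact_closure hV hΩV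
  obtain ⟨M, hM, hcarl⟩ := carleman_shift_complex H hχ hχc hχV
  obtain ⟨K₁, hK₁⟩ := exists_bound_partialDeriv_convexified H.smooth H.compact
  obtain ⟨K₂, hK₂, hAK⟩ := exists_ae_bound hA
  obtain ⟨K₃, hK₃, hqK⟩ := exists_ae_bound hq
  obtain ⟨K, hK⟩ : ∃ K, K = max K₁ (max K₂ K₃) := ⟨_, rfl⟩
  have k1 : K₁ ≤ K := hK ▸ le_max_left _ _
  have k2 : K₂ ≤ K := hK ▸ (le_max_left _ _).trans (le_max_right _ _)
  have k3 : K₃ ≤ K := hK ▸ (le_max_right _ _).trans (le_max_right _ _)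
  have hK0 : 0 ≤ K := hK₂.trans k2
  obtain ⟨C₁, hC₁⟩ : ∃ C₁ : ℝ, C₁ = n * (2 * K * (1 + K) + K ^ 2) + K := ⟨_, rfl⟩
  have hC₁0 : 0 ≤ C₁ := by rw [hC₁]; positivity
  -- Chosen so that `√(εM) C₁ ≤ 1/2`, which absorbs the potentials, and `ε ≤ 1/M`, which gives `h ≤
  -- τ/M` for `τ = h/ε`.
  obtain ⟨ε, hε⟩ : ∃ ε : ℝ, ε = 1 / (M * (1 + 4 * C₁ ^ 2)) := ⟨_, rfl⟩
  have hM0 : 0 < M := by linarith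
  have hε0 : 0 < ε := by rw [hε]; positivity
  have hεM : ε * M = 1 / (1 + 4 * C₁ ^ 2) := by rw [hε]; field_simp
  have hε1 : ε ≤ 1 / M := by
    rw [le_div_iff₀ hM0, hεM, div_le_one (by positivity)]
    linarith [sq_nonneg C₁]
  have hsC : √(ε * M) * C₁ ≤ 1 / 2 := by
    refine abs_le_of_sq_le_sq' ?_ (by norm_num) |>.2
    rw [mul_pow, Real.sq_sqrt (by positivity), hεM, one_div_mul_eq_div, div_le_iff₀ (by positivity)]
    linarith
  have hgs (c : ℝ) : ContDiff ℝ ∞ fun x => c * (φ x * φ x / 2) :=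
    contDiff_const.mul ((H.smooth.mul H.smooth).div_const 2)
  have hgc (c : ℝ) : HasCompactSupport fun x => c * (φ x * φ x / 2) :=
    H.compact.comp_left (g := fun t => c * (t * t / 2)) (by simp)
  obtain ⟨B₁, hB₁, hE⟩ := exists_bound_exp (hgs (1 / ε)) (hgc (1 / ε))
  obtain ⟨B₂, hB₂, hE'⟩ := exists_bound_exp (hgs (-(1 / ε))) (hgc (-(1 / ε)))
  -- The summand one only makes the constant positive; `h < ε/M` means `τ < 1/M`.
  refine ⟨√(3 * B₂) * (2 * √(ε * M) * √(3 * B₁)) + 1, by positivity, min 1 (ε / M),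
    lt_min one_pos (by positivity), fun h hh hh0 u huc huΩ T hT f hf => ?_⟩
  have hh1 : h ≤ 1 := hh0.le.trans (min_le_left _ _)
  have hhε : h ≤ ε / M := hh0.le.trans (min_le_right _ _)
  obtain ⟨τ, hτ⟩ : ∃ τ, τ = h / ε := ⟨_, rfl⟩
  have hτ0 : 0 < τ := by rw [hτ]; positivity
  have hτM : τ ≤ 1 / M := by
    rw [hτ, div_le_iff₀ hε0, one_div_mul_eq_div]; exact hhε
  have hτ1 : τ ≤ 1 := hτM.trans (by rw [div_le_one hM0]; exact hM)
  have hhτ : h ≤ τ / M := by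
    rw [hτ, le_div_iff₀ hM0, le_div_iff₀ hε0, mul_assoc]
    refine mul_le_of_le_one_right hh.le ?_
    rw [le_div_iff₀ hM0] at hε1
    linarith
  have hψs : ContDiff ℝ ∞ (convexified φ τ) := contDiff_convexified H.smooth τ
  have hψc : HasCompactSupport (convexified φ τ) :=
    H.compact.comp_left (g := fun t => t + τ * (t * t / 2)) (by simp)
  obtain ⟨w, hw⟩ := exists_schwartz_exp_mul (hgs (1 / ε)) (hgc (1 / ε)) u
  have hwu : tsupport w ⊆ tsupport u := by
    refine closure_mono fun x hx => ?_
    rw [Function.mem_support, hw] at hx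
    exact right_ne_zero_of_mul hx
  have hwc : HasCompactSupport w := huc.of_isClosed_subset (isClosed_tsupport _) hwu
  have huw (x : Rn n) : u x = ((Real.exp (-(1 / ε) * (φ x * φ x / 2)) : ℝ) : ℂ) * w x := by
    rw [hw, ← mul_assoc, ← Complex.ofReal_mul, ← Real.exp_add]
    simp
  have hPc := hasCompactSupport_conjLaplacianC h (convexified φ τ) hwc
  have hPs := contDiff_conjLaplacianC h hψs (w.smooth ⊤)
  obtain ⟨g, hg⟩ := exists_schwartz_resolvent h (hPc.toSchwartzMap hPs)
  have hg' (x : Rn n) : g x - (h : ℂ) ^ 2 * ∑ k, partialDeriv k (partialDeriv k g) x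
      = conjLaplacianC h (convexified φ τ) w x := hg x
  have main1 := hcarl h τ hh hτ0 hτM hhτ w hwc
    (fun x hx => hW x (hΩW (subset_closure (huΩ (hwu hx))))) g hg'
  -- With this test function, `T` evaluates the form of the convexified operator at `w` and the
  -- conjugate of `g`.
  obtain ⟨η, hη⟩ := exists_schwartz_exp_mul (hgs (1 / ε)) (hgc (1 / ε)) (conjSchwartz g)
  have hTη : T η = ∫ x in Ω, formDensity h (convexified φ τ) A q w (conjSchwartz g) x := by
    rw [hT, ← conjugatedSchrodinger_eq hΩ.measurableSet A q hh.ne'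
      (fun x _ => ContDiff.differentiableAt_infty H.smooth x) (fun _ _ => u.differentiableAt)
      (fun _ _ => η.differentiableAt), ← conjugatedSchrodinger_eq hΩ.measurableSet A q hh.ne'
      (fun x _ => ContDiff.differentiableAt_infty hψs x) (fun _ _ => w.differentiableAt)
      (fun _ _ => (conjSchwartz g).differentiableAt), show ⇑η = _ from funext hη,
      show ⇑w = _ from funext hw, conjugatedSchrodinger_exp_mul Ω φ A q hh.ne']
    congr 1
    ext x
    rw [convexified, hτ]
    ring
  have hpert := norm_integral_formDensity_sub_le hh.le hh1 hK0 hψs hψc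
    (fun j x => hK₁ K k1 τ hτ0.le hτ1 j x) hA (hAK.mono fun x hx => hx.trans k2) hq
    (hqK.mono fun x hx => hx.trans k3) w (conjSchwartz g) hwc (hwu.trans huΩ)
  simp only [← hg'] at hpert
  rw [integral_resolvent_mul_conj, sclEnergy_conjSchwartz, ← hTη, ← hC₁] at hpert
  have hTb := norm_apply_le_of_semiclassicalBessel_eq hf η
  have hηE := sclEnergy_exp_mul_le hh.le hh1 (hgs (1 / ε)) hE hη
  have huE := sclEnergy_exp_mul_le hh.le hh1 (hgs (-(1 / ε))) hE' huw
  rw [sclEnergy_conjSchwartz] at hηE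
  obtain ⟨a, ha⟩ : ∃ a, a = √(sclEnergy h w) := ⟨_, rfl⟩
  obtain ⟨b, hb⟩ : ∃ b, b = √(sclEnergy h g) := ⟨_, rfl⟩
  have ha0 : 0 ≤ a := ha ▸ Real.sqrt_nonneg _
  have hb0 : 0 ≤ b := hb ▸ Real.sqrt_nonneg _
  have hηE' : √(sclEnergy h η) ≤ √(3 * B₁) * b := by
    rw [hb, ← Real.sqrt_mul (by positivity)]; exact Real.sqrt_le_sqrt hηE
  have huE' : √(sclEnergy h u) ≤ √(3 * B₂) * a := by
    rw [ha, ← Real.sqrt_mul (by positivity)]; exact Real.sqrt_le_sqrt huE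
  have hbb : sclEnergy h g = b * b := by
    rw [hb, Real.mul_self_sqrt (sclEnergy_nonneg h g)]
  have haa : sclEnergy h w = a * a := by
    rw [ha, Real.mul_self_sqrt (sclEnergy_nonneg h w)]
  -- Up to the perturbation by the potentials, `b²` is `T η`. Duality bounds `T η` by a multiple of
  -- `‖f‖ b`, and one factor `b` is divided out.
  have hb1 : b ≤ ‖f‖ * √(3 * B₁) + C₁ * (h * a) := by
    rcases hb0.eq_or_lt with h0 | hpos
    · rw [← h0]; positivity
    · refine le_of_mul_le_mul_right ?_ hpos
      rw [← ha, ← hb, hbb] at hpert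
      have t1 : ‖((b * b : ℝ) : ℂ)‖ = b * b := by
        rw [Complex.norm_real, Real.norm_eq_abs, abs_of_nonneg (by positivity)]
      have t2 := norm_sub_norm_le ((b * b : ℝ) : ℂ) (T η)
      rw [norm_sub_rev, t1] at t2
      have t3 := hTb.trans (mul_le_mul_of_nonneg_left hηE' (norm_nonneg f))
      linarith
  -- The Carleman estimate with `hτ = h²/ε`, after taking square roots.
  have hab : h * a ≤ √(ε * M) * b := by
    refine abs_le_of_sq_le_sq' ?_ (by positivity) |>.2
    rw [mul_pow, mul_pow, Real.sq_sqrt (by positivity)]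
    rw [haa, hbb, hτ] at main1
    have t1 := mul_le_mul_of_nonneg_left main1 hε0.le
    have t2 : ε * (h * (h / ε) * (a * a)) = h ^ 2 * a ^ 2 := by field_simp
    rw [t2] at t1
    linarith
  have hfin := le_of_absorb hab hb1 (Real.sqrt_nonneg _) hsC (by positivity)
  calc h * √(sclEnergy h u) ≤ h * (√(3 * B₂) * a) := mul_le_mul_of_nonneg_left huE' hh.le
    _ = √(3 * B₂) * (h * a) := by ring
    _ ≤ √(3 * B₂) * (2 * √(ε * M) * (‖f‖ * √(3 * B₁))) :=
        mul_le_mul_of_nonneg_left hfin (Real.sqrt_nonneg _)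
    _ ≤ (√(3 * B₂) * (2 * √(ε * M) * √(3 * B₁)) + 1) * ‖f‖ := by
        linarith [norm_nonneg f]

lemma formDensity_congr {h : ℝ} {φ ψ : Rn n → ℝ} (A : Rn n → EuclideanSpace ℂ (Fin n))
    (q w θ : Rn n → ℂ) {x : Rn n} (hx : φ =ᶠ[nhds x] ψ) :
    formDensity h φ A q w θ x = formDensity h ψ A q w θ x := by
  simp only [formDensity, partialDeriv_congr hx]

end MagneticCarleman

end

/-- Carleman estimate for the magnetic Schrödinger operator with a gain of two derivatives. -/
theorem proposition2p2 (n : ℕ) (hn : 3 ≤ n)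
    (Ω Ω' : Set (MagneticCarleman.Rn n))
    (hΩ : IsOpen Ω) (hΩb : Bornology.IsBounded Ω)
    (hΩ' : IsOpen Ω') (hΩΩ' : closure Ω ⊆ Ω')
    (φ : MagneticCarleman.Rn n → ℝ)
    (hφ : MagneticCarleman.IsLimitingCarlemanWeight Ω' φ)
    (A : MagneticCarleman.Rn n → EuclideanSpace ℂ (Fin n))
    (hA : MemLp A ⊤ (volume.restrict Ω))
    (q : MagneticCarleman.Rn n → ℂ)
    (hq : MemLp q ⊤ (volume.restrict Ω)) :
    ∃ C : ℝ, 0 < C ∧ ∃ h₀ : ℝ, 0 < h₀ ∧ ∀ h : ℝ, 0 < h → h < h₀ →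
      ∀ u : 𝓢(MagneticCarleman.Rn n, ℂ), HasCompactSupport (u : MagneticCarleman.Rn n → ℂ) →
        tsupport (u : MagneticCarleman.Rn n → ℂ) ⊆ Ω →
        ∃ T : 𝓢'(MagneticCarleman.Rn n, ℂ),
          (∀ ψ : 𝓢(MagneticCarleman.Rn n, ℂ),
            T ψ = MagneticCarleman.conjugatedSchrodinger Ω φ A q h u ψ) ∧
          MagneticCarleman.semiclassicalNorm h (-1) T < ⊤ ∧
          ENNReal.ofReal h * MagneticCarleman.semiclassicalNorm h 1
              (u : 𝓢'(MagneticCarleman.Rn n, ℂ)) ≤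
            ENNReal.ofReal C * MagneticCarleman.semiclassicalNorm h (-1) T := by
  obtain ⟨f, ρ, V, H, hV, hΩV, hfV⟩ :=
    MagneticCarleman.exists_isWeightOn hΩb.isCompact_closure hΩ' hΩΩ' hφ
  obtain ⟨C, hC, h₀, hh₀, hmain⟩ := MagneticCarleman.carleman_formDensity H hV hΩ hΩb hΩV hA hq
  refine ⟨C, hC, h₀, hh₀, fun h hh hhh₀ u huc huΩ => ?_⟩
  obtain ⟨T, hT, hTs⟩ := MagneticCarleman.exists_temperedDistribution_formDensity
    hΩ.measurableSet h H.smooth H.compact hA hq u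
  refine ⟨T, fun ψ => ?_, MagneticCarleman.semiclassicalNorm_neg_one_lt_top hh hTs, ?_⟩
  · rw [hT, MagneticCarleman.conjugatedSchrodinger_eq hΩ.measurableSet A q hh.ne'
      (fun x hx => (hφ.smooth.contDiffAt (hΩ'.mem_nhds (hΩΩ' (subset_closure hx)))).differentiableAt
        (by simp)) (fun _ _ => u.differentiableAt) (fun _ _ => ψ.differentiableAt)]
    refine setIntegral_congr_fun hΩ.measurableSet fun x hx => ?_
    exact MagneticCarleman.formDensity_congr A q u ψ (Filter.eventuallyEq_of_mem
      (hV.mem_nhds (hΩV (subset_closure hx))) hfV)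
  · refine (mul_le_mul_right (MagneticCarleman.semiclassicalNorm_one_le h u) _).trans ?_
    -- The norm of `T` is an infimum over its `L²` representatives, so the estimate is proved for
    -- each of them.
    rw [← ENNReal.ofReal_mul hh.le, MagneticCarleman.semiclassicalNorm,
      ENNReal.mul_iInf_of_ne (by simpa using hC) ENNReal.ofReal_ne_top]
    refine le_iInf fun F => ?_
    rw [ENNReal.mul_iInf_of_ne (by simpa using hC) ENNReal.ofReal_ne_top]
    refine le_iInf fun hF => ?_
    rw [← ofReal_norm, ← ENNReal.ofReal_mul hC.le]
    exact ENNReal.ofReal_le_ofReal (hmain h hh hhh₀ u huc huΩ T hT F hF)
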